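/- Let $d\ge 0$ and $k\ge 3$ be integers and let $f:\mathbb{R}^d\to[0,\infty)$ be a bounded measurable probability density. There is a constant $c$, depending only on $d$, $k$ and $f$, such that the following holds. Let $X_1,X_2,\dots$ be i.i.d. random vectors in $\mathbb{R}^d$ with density $f$, and let $(r_n)$ be a sequence of positive reals with $n r_n^d\to 0$ as $n\to\infty$. Let $\mathcal{C}_n$ be the Čech complex on $X_1,\dots,X_n$ at scale $r_n$: a nonempty set $\{X_i : i\in\sigma\}$ spans a face if and only if the closed balls of radius $r_n$ about the points $X_i$, $i\in\sigma$, have a common point. Let $\beta_{k-2}=\dim H_{k-2}(\mathcal{C}_n;\mathbb{Q})$. 1. If $n^k r_n^{d(k-1)}\to 0$ as $n\to\infty$, then $\beta_{k-2}=0$ asymptotically almost surely, i.e. $\mathbb{P}[\beta_{k-2}(\mathcal{C}_n)=0]\to 1$. 2. If $n^k r_n^{d(k-1)}\to\alpha$ for some $\alpha\in(0,\infty)$, then for all $n$ $$d_{TV}\big(\beta_{k-2}(\mathcal{C}_n),Y_n\big)\le c\, n r_n^d ,$$ where $Y_n$ is a Poisson random variable with $\mathbb{E}[Y_n]=\mathbb{E}[\beta_{k-2}(\mathcal{C}_n)]$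 and $d_{TV}(X,Y)=\sup_g|\mathbb{E}[g(X)]-\mathbb{E}[g(Y)]|$, the supremum being over continuous functions $g$ with $|g|\le 1$. 3. If $k\le d+1$ and $n^k r_n^{d(k-1)}\to\infty$, then $$\frac{\beta_{k-2}(\mathcal{C}_n)-\mathbb{E}[\beta_{k-2}(\mathcal{C}_n)]}{\sqrt{\mathrm{Var}(\beta_{k-2}(\mathcal{C}_n))}}\Longrightarrow\mathcal{N}(0,1)$$ in distribution. -/

import Mathlib

open MeasureTheory ProbabilityTheory Filter Topology

noncomputable section

/-- The Čech complex at scale `r` on a family of points `x : ι → E`: a nonempty finite set `σ` of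
indices is a face iff the closed balls of radius `r` about the points `x i`, `i ∈ σ`, have a
common point. -/
def cechComplex {ι E : Type*} [PseudoMetricSpace E] (x : ι → E) (r : ℝ) :
    PreAbstractSimplicialComplex ι where
  faces := {σ | σ.Nonempty ∧ (⋂ i ∈ σ, Metric.closedBall (x i) r).Nonempty}
  isRelLowerSet_faces := fun _ hσ =>
    ⟨hσ.1, fun _ hτσ hτ => ⟨hτ, hσ.2.mono (Set.biInter_subset_biInter_left hτσ)⟩⟩

/-- The simplicial boundary operator with rational coefficients, on formal combinations of finite
subsets of a linearly ordered vertex set. The facet of `σ` opposite to `i` appears with the sign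
`(-1) ^ p`, where `p` is the position of `i` in `σ`; the empty set is not a simplex, so the
boundary of a vertex is zero (the homology is not reduced). -/
def simplicialBoundary (ι : Type*) [LinearOrder ι] : (Finset ι →₀ ℚ) →ₗ[ℚ] (Finset ι →₀ ℚ) :=
  Finsupp.linearCombination ℚ fun σ =>
    ∑ i ∈ σ with (σ.erase i).Nonempty,
      Finsupp.single (σ.erase i) ((-1 : ℚ) ^ (σ.filter (· < i)).card)

namespace PreAbstractSimplicialComplex

variable {ι : Type*} [LinearOrder ι]

/-- The `k`-chains: rational combinations of the `k`-dimensional faces. -/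
def chains (K : PreAbstractSimplicialComplex ι) (k : ℕ) : Submodule ℚ (Finset ι →₀ ℚ) :=
  Finsupp.supported ℚ ℚ {σ | σ ∈ K ∧ σ.card = k + 1}

/-- The `k`-cycles. -/
def cycles (K : PreAbstractSimplicialComplex ι) (k : ℕ) : Submodule ℚ (Finset ι →₀ ℚ) :=
  K.chains k ⊓ LinearMap.ker (simplicialBoundary ι)

/-- The `k`-boundaries. -/
def boundaries (K : PreAbstractSimplicialComplex ι) (k : ℕ) : Submodule ℚ (Finset ι →₀ ℚ) :=
  (K.chains (k + 1)).map (simplicialBoundary ι)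

/-- The `k`-th Betti number `dim H_k(K; ℚ)`. -/
def betti (K : PreAbstractSimplicialComplex ι) (k : ℕ) : ℕ :=
  Module.finrank ℚ (K.cycles k ⧸ (K.boundaries k).submoduleOf (K.cycles k))

end PreAbstractSimplicialComplex

/-- The `j`-th Betti number of the Čech complex at scale `r` on the first `n` points of the random
sequence `X`. -/
def cechBetti {Ω E : Type*} [PseudoMetricSpace E] (X : ℕ → Ω → E) (n : ℕ) (r : ℝ) (j : ℕ)
    (ω : Ω) : ℕ :=
  (cechComplex (fun i : Fin n => X i ω) r).betti j

/-- Total variation distance of two laws: the supremum of the difference of the expectations of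
`g` over all continuous functions `g` bounded by one. -/
def tvDist {S : Type*} [TopologicalSpace S] [MeasurableSpace S] (μ ν : Measure S) : ℝ :=
  ⨆ g : {g : C(S, ℝ) // ∀ x, |g x| ≤ 1}, |∫ x, g.1 x ∂μ - ∫ x, g.1 x ∂ν|

end

/-! In the sparse regime the components of the complex are small. Homology in dimension `k - 2`
needs at least `k` vertices, and on exactly `k` vertices it is nonzero only for a hollow simplex
(`betti_of_card_le`). Hence β = W + D, where W counts the hollow simplices on `k` vertices and the
excess D sees only components with more than `k` points. Deleting a point changes these quantities
by at most a polynomial in the number N of nearby points. Let `p = A * r ^ d` bound the mass of a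
ball of radius `2 * r * k`, with `n * p ≤ 1`. A power of N cut off below `b` has expectation
O((np)^b) (`integral_thresholdPow_le`), so E W = O(n (np)^(k-1)) and E|D| = O(n (np)^k). Claim 1
then follows from Markov's inequality.

Claims 2 and 3 rest on an approximate Stein identity (`abs_stein_le`): if `g` has increments at most
L, then E[β g(β)] and E[β] E[g(β + 1)] differ by O(L n (np)^k). In the W part, a hollow simplex σ is
independent of the Betti number β' of the points outside σ, and β = 1 + β' unless further points are
near. In the D part, the covariance of D and g(β) is bounded by resampling one point at a time
(`abs_covariance_le`). The Poisson Stein equation has a solution with increments at most 1/λ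
(`exists_stein_solution_of_mem_unit`), so the total variation distance is O(n (np)^k / λ), where λ =
E β. Taking `g` to be the identity bounds |Var β / λ - 1| in the same way.

If `k ≤ d + 1`, there are hollow simplices that survive small perturbations, so λ ≥ c n (n
r^d)^(k-1) (`exists_le_integral_betti`) and both errors are O(n r^d). This is claim 2. In claim 3
moreover λ → ∞, and the Poisson limit is turned into a normal one by characteristic functions. If `k
≥ d + 2`, a Čech complex in ℝ^d has no homology in dimension `k - 2 ≥ d`, by a hyperplane sweep over
the nerve of convex sets (`exists_augBoundary_eq_of_convex`), so β = 0. -/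

open scoped NNReal

noncomputable section

/-! ### Simplicial boundary, its augmented version, and cones -/

section Boundary

variable {ι : Type*} [LinearOrder ι]

/-- The sign `(-1) ^ p`, where `p` is the position of `i` in `σ`. -/
def facetSign (σ : Finset ι) (i : ι) : ℚ := (-1) ^ (σ.filter (· < i)).card

lemma facetSign_ne_zero (σ : Finset ι) (i : ι) : facetSign σ i ≠ 0 :=
  pow_ne_zero _ (by norm_num)

lemma facetSign_erase_of_le {σ : Finset ι} {i j : ι} (h : j ≤ i) :
    facetSign (σ.erase i) j = facetSign σ j := by
  unfold facetSign
  congr 2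
  ext a
  simp only [Finset.mem_filter, Finset.mem_erase]
  constructor
  · rintro ⟨⟨_, h2⟩, h3⟩; exact ⟨h2, h3⟩
  · rintro ⟨h2, h3⟩; exact ⟨⟨(h3.trans_le h).ne, h2⟩, h3⟩

lemma facetSign_insert_of_lt {σ : Finset ι} {i j : ι} (hj : j ∉ σ) (h : j < i) :
    facetSign (insert j σ) i = -facetSign σ i := by
  unfold facetSign
  rw [Finset.filter_insert, if_pos h, Finset.card_insert_of_notMem (by simp [hj]), pow_succ]
  ring

lemma facetSign_erase_of_lt {σ : Finset ι} {i j : ι} (hj : j ∈ σ) (h : j < i) :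
    facetSign (σ.erase j) i = -facetSign σ i := by
  conv_rhs => rw [← Finset.insert_erase hj]
  rw [facetSign_insert_of_lt (Finset.notMem_erase j σ) h, neg_neg]

/-- The augmented simplicial boundary: the empty set counts as a simplex. -/
def augBoundary (ι : Type*) [LinearOrder ι] : (Finset ι →₀ ℚ) →ₗ[ℚ] (Finset ι →₀ ℚ) :=
  Finsupp.linearCombination ℚ fun σ => ∑ i ∈ σ, Finsupp.single (σ.erase i) (facetSign σ i)

lemma augBoundary_single (σ : Finset ι) (c : ℚ) :
    augBoundary ι (Finsupp.single σ c) =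
      ∑ i ∈ σ, Finsupp.single (σ.erase i) (c * facetSign σ i) := by
  simp [augBoundary, Finsupp.linearCombination_single, Finset.smul_sum]

/-- Deleting `i` then `j` gives the same set as deleting `j` then `i`, with the opposite sign; the
swap is a fixed-point-free involution on the terms. -/
lemma augBoundary_augBoundary (z : Finset ι →₀ ℚ) : augBoundary ι (augBoundary ι z) = 0 := by
  induction z using Finsupp.induction_linear with
  | zero => simp
  | add f g hf hg => rw [map_add, map_add, hf, hg, add_zero]
  | single σ c =>
    rw [augBoundary_single, map_sum]
    simp_rw [augBoundary_single]
    rw [Finset.sum_sigma']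
    refine Finset.sum_involution (fun a _ => ⟨a.2, a.1⟩) ?_ ?_ ?_ ?_
    · rintro ⟨i, j⟩ h
      simp only [Finset.mem_sigma, Finset.mem_erase] at h
      obtain ⟨hi, hji, hj⟩ := h
      rw [Finset.erase_right_comm, ← Finsupp.single_add]
      rcases lt_or_gt_of_ne hji with hlt | hlt
      · rw [facetSign_erase_of_le hlt.le, facetSign_erase_of_lt hj hlt]
        rw [Finsupp.single_eq_zero]; ring
      · rw [facetSign_erase_of_le hlt.le, facetSign_erase_of_lt hi hlt]
        rw [Finsupp.single_eq_zero]; ring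
    · rintro ⟨i, j⟩ h _ heq
      simp only [Finset.mem_sigma, Finset.mem_erase] at h
      simp only [Sigma.mk.injEq, heq_eq_eq] at heq
      exact h.2.1 heq.1
    · rintro ⟨i, j⟩ h
      simp only [Finset.mem_sigma, Finset.mem_erase] at h ⊢
      exact ⟨h.2.2, h.2.1.symm, h.1⟩
    · rintro ⟨i, j⟩ _; rfl

lemma simplicialBoundary_single (σ : Finset ι) (c : ℚ) :
    simplicialBoundary ι (Finsupp.single σ c) =
      ∑ i ∈ σ with (σ.erase i).Nonempty, Finsupp.single (σ.erase i) (c * facetSign σ i) := by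
  simp [simplicialBoundary, Finsupp.linearCombination_single, Finset.smul_sum, facetSign]

lemma simplicialBoundary_single_eq_aug {σ : Finset ι} (h : 2 ≤ σ.card) (c : ℚ) :
    simplicialBoundary ι (Finsupp.single σ c) = augBoundary ι (Finsupp.single σ c) := by
  rw [simplicialBoundary_single, augBoundary_single, Finset.filter_true_of_mem]
  intro i hi
  rw [← Finset.card_pos, Finset.card_erase_of_mem hi]
  omega

lemma simplicialBoundary_single_of_card_le_one {σ : Finset ι} (h : σ.card ≤ 1) (c : ℚ) :
    simplicialBoundary ι (Finsupp.single σ c) = 0 := by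
  rw [simplicialBoundary_single, Finset.filter_false_of_mem, Finset.sum_empty]
  intro i hi
  rw [← Finset.card_pos, Finset.card_erase_of_mem hi]
  omega

/-- The two operators differ only on single vertices, whose sole facet is the empty set. The
augmented one obeys the cone formula without exceptions, so the homological arguments use it. -/
lemma simplicialBoundary_eq_aug {S : Set (Finset ι)} (hS : ∀ σ ∈ S, 2 ≤ σ.card)
    {z : Finset ι →₀ ℚ} (hz : z ∈ Finsupp.supported ℚ ℚ S) :
    simplicialBoundary ι z = augBoundary ι z := by
  rw [Finsupp.supported_eq_span_single] at hz
  induction hz using Submodule.span_induction with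
  | mem x hx =>
    obtain ⟨σ, hσ, rfl⟩ := hx
    exact simplicialBoundary_single_eq_aug (hS σ hσ) 1
  | zero => simp
  | add x y _ _ hx hy => rw [map_add, map_add, hx, hy]
  | smul a x _ hx => rw [map_smul, map_smul, hx]

lemma simplicialBoundary_simplicialBoundary (z : Finset ι →₀ ℚ) :
    simplicialBoundary ι (simplicialBoundary ι z) = 0 := by
  induction z using Finsupp.induction_linear with
  | zero => simp
  | add f g hf hg => rw [map_add, map_add, hf, hg, add_zero]
  | single σ c =>
    rcases le_or_gt σ.card 1 with h | h
    · rw [simplicialBoundary_single_of_card_le_one h, map_zero]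
    · rw [simplicialBoundary_single_eq_aug h]
      rcases le_or_gt σ.card 2 with h2 | h2
      · rw [augBoundary_single, map_sum]
        refine Finset.sum_eq_zero fun i hi => simplicialBoundary_single_of_card_le_one ?_ _
        rw [Finset.card_erase_of_mem hi]; omega
      · rw [← augBoundary_augBoundary (Finsupp.single σ c), augBoundary_single, map_sum, map_sum]
        refine Finset.sum_congr rfl fun i hi => simplicialBoundary_single_eq_aug ?_ _
        rw [Finset.card_erase_of_mem hi]; omega

/-- If all facets of the members of `S` are in `T`, the boundary maps chains on `S` to chains
on `T`. -/
lemma augBoundary_mem_supported {S T : Set (Finset ι)}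
    (h : ∀ σ ∈ S, ∀ i ∈ σ, σ.erase i ∈ T) {z : Finset ι →₀ ℚ}
    (hz : z ∈ Finsupp.supported ℚ ℚ S) : augBoundary ι z ∈ Finsupp.supported ℚ ℚ T := by
  have : Finsupp.supported ℚ ℚ S ≤ (Finsupp.supported ℚ ℚ T).comap (augBoundary ι) := by
    rw [Finsupp.supported_eq_span_single, Submodule.span_le]
    rintro _ ⟨σ, hσ, rfl⟩
    simp only [Submodule.comap_coe, Set.mem_preimage, SetLike.mem_coe, augBoundary_single]
    exact Submodule.sum_mem _ fun i hi => Finsupp.single_mem_supported _ _ (h σ hσ i hi)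
  exact this hz

lemma simplicialBoundary_mem_supported {S T : Set (Finset ι)}
    (h : ∀ σ ∈ S, ∀ i ∈ σ, (σ.erase i).Nonempty → σ.erase i ∈ T) {z : Finset ι →₀ ℚ}
    (hz : z ∈ Finsupp.supported ℚ ℚ S) : simplicialBoundary ι z ∈ Finsupp.supported ℚ ℚ T := by
  have : Finsupp.supported ℚ ℚ S ≤ (Finsupp.supported ℚ ℚ T).comap (simplicialBoundary ι) := by
    rw [Finsupp.supported_eq_span_single, Submodule.span_le]
    rintro _ ⟨σ, hσ, rfl⟩
    simp only [Submodule.comap_coe, Set.mem_preimage, SetLike.mem_coe, simplicialBoundary_single]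
    refine Submodule.sum_mem _ fun i hi => Finsupp.single_mem_supported _ _ ?_
    rw [Finset.mem_filter] at hi
    exact h σ hσ i hi.1 hi.2
  exact this hz

/-- The cone operator with apex `v`. -/
def coneMap (v : ι) : (Finset ι →₀ ℚ) →ₗ[ℚ] (Finset ι →₀ ℚ) :=
  Finsupp.linearCombination ℚ fun σ => if v ∈ σ then 0 else Finsupp.single (insert v σ) 1

lemma coneMap_single (v : ι) (σ : Finset ι) (c : ℚ) :
    coneMap v (Finsupp.single σ c) = if v ∈ σ then 0 else Finsupp.single (insert v σ) c := by
  rw [coneMap, Finsupp.linearCombination_single]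
  split_ifs <;> simp

lemma coneMap_mem_supported {S T : Set (Finset ι)} {v : ι}
    (h : ∀ σ ∈ S, v ∉ σ → insert v σ ∈ T) {z : Finset ι →₀ ℚ}
    (hz : z ∈ Finsupp.supported ℚ ℚ S) : coneMap v z ∈ Finsupp.supported ℚ ℚ T := by
  have : Finsupp.supported ℚ ℚ S ≤ (Finsupp.supported ℚ ℚ T).comap (coneMap v) := by
    rw [Finsupp.supported_eq_span_single, Submodule.span_le]
    rintro _ ⟨σ, hσ, rfl⟩
    simp only [Submodule.comap_coe, Set.mem_preimage, SetLike.mem_coe, coneMap_single]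
    split_ifs with hv
    · exact Submodule.zero_mem _
    · exact Finsupp.single_mem_supported _ _ (h σ hσ hv)
  exact this hz

/-- The apex is the smallest vertex, so its own sign is `+1`, and adding it shifts the position of
every other vertex by one. The facets through the apex therefore cancel in pairs. -/
lemma augBoundary_coneMap_single {v : ι} {σ : Finset ι} (h : ∀ i ∈ σ, v ≤ i) (c : ℚ) :
    augBoundary ι (coneMap v (Finsupp.single σ c)) + coneMap v (augBoundary ι (Finsupp.single σ c))
      = Finsupp.single σ c := by
  have hs : ∀ τ : Finset ι, (∀ i ∈ τ, v ≤ i) → facetSign τ v = 1 := by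
    intro τ hτ
    rw [facetSign, Finset.filter_false_of_mem (fun i hi => (hτ i hi).not_gt)]
    simp
  rw [coneMap_single, augBoundary_single, map_sum]
  simp_rw [coneMap_single]
  by_cases hv : v ∈ σ
  · rw [if_pos hv, map_zero, zero_add, Finset.sum_eq_single v]
    · simp [hs σ h, Finset.insert_erase hv]
    · intro i _ hi
      rw [if_pos (Finset.mem_erase.2 ⟨hi.symm, hv⟩)]
    · exact fun h => absurd hv h
  · rw [if_neg hv, augBoundary_single, Finset.sum_insert hv, Finset.erase_insert hv,
      hs _ (by simpa using h), mul_one, add_assoc, ← Finset.sum_add_distrib, Finset.sum_eq_zero,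
      add_zero]
    intro i hi
    have hvi : v ≠ i := fun e => hv (e ▸ hi)
    rw [if_neg (fun hm => hv (Finset.mem_of_mem_erase hm)),
      facetSign_insert_of_lt hv (lt_of_le_of_ne (h i hi) hvi), Finset.erase_insert_of_ne hvi,
      ← Finsupp.single_add, Finsupp.single_eq_zero]
    ring

/-- Cycles on sets all of whose elements are at least `v` bound their cones. -/
lemma augBoundary_coneMap_of_cycle {v : ι} {S : Set (Finset ι)} (h : ∀ σ ∈ S, ∀ i ∈ σ, v ≤ i)
    {z : Finset ι →₀ ℚ} (hz : z ∈ Finsupp.supported ℚ ℚ S) (hc : augBoundary ι z = 0) :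
    augBoundary ι (coneMap v z) = z := by
  have : augBoundary ι (coneMap v z) + coneMap v (augBoundary ι z) = z := by
    rw [Finsupp.supported_eq_span_single] at hz
    clear hc
    induction hz using Submodule.span_induction with
    | mem x hx =>
      obtain ⟨σ, hσ, rfl⟩ := hx
      exact augBoundary_coneMap_single (h σ hσ) 1
    | zero => simp
    | add x y _ _ hx hy =>
      simp only [map_add]
      rw [add_add_add_comm, hx, hy]
    | smul a x _ hx =>
      simp only [map_smul]
      rw [← smul_add, hx]
  rwa [hc, map_zero, add_zero] at this

end Boundary

/-! ### Betti numbers: stability, additivity, and complexes with few vertices -/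

namespace PreAbstractSimplicialComplex

variable {ι : Type*}

lemma nonempty_of_mem {K : PreAbstractSimplicialComplex ι} {σ : Finset ι} (h : σ ∈ K) :
    σ.Nonempty := (K.isRelLowerSet_faces h).1

lemma mem_of_subset {K : PreAbstractSimplicialComplex ι} {σ τ : Finset ι} (h : σ ∈ K)
    (hτ : τ ⊆ σ) (hn : τ.Nonempty) : τ ∈ K := (K.isRelLowerSet_faces h).2 hτ hn

lemma chains_mono {K L : PreAbstractSimplicialComplex ι} (h : L ≤ K) (j : ℕ) :
    L.chains j ≤ K.chains j :=
  Finsupp.supported_mono fun _ hσ => ⟨h hσ.1, hσ.2⟩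

/-- The full subcomplex on a set of vertices. -/
def induce (K : PreAbstractSimplicialComplex ι) (I : Finset ι) :
    PreAbstractSimplicialComplex ι where
  faces := {σ | σ ∈ K ∧ σ ⊆ I}
  isRelLowerSet_faces := fun _ hσ =>
    ⟨nonempty_of_mem hσ.1, fun _ hτσ hτ => ⟨mem_of_subset hσ.1 hτσ hτ, hτσ.trans hσ.2⟩⟩

@[simp]
lemma mem_induce {K : PreAbstractSimplicialComplex ι} {I σ : Finset ι} :
    σ ∈ K.induce I ↔ σ ∈ K ∧ σ ⊆ I := Iff.rfl

lemma induce_univ [Fintype ι] (K : PreAbstractSimplicialComplex ι) :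
    K.induce Finset.univ = K := by
  apply SetLike.ext
  simp

variable [LinearOrder ι]

lemma simplicialBoundary_mem_chains_support {K : PreAbstractSimplicialComplex ι} {j : ℕ}
    {z : Finset ι →₀ ℚ} (hz : z ∈ K.chains j) :
    simplicialBoundary ι z ∈ Finsupp.supported ℚ ℚ {σ | σ ∈ K} :=
  simplicialBoundary_mem_supported
    (fun _ hσ _ _ hn => mem_of_subset hσ.1 (Finset.erase_subset _ _) hn) hz

lemma boundaries_le_cycles (K : PreAbstractSimplicialComplex ι) (j : ℕ) :
    K.boundaries j ≤ K.cycles j := by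
  rintro _ ⟨z, hz, rfl⟩
  refine ⟨?_, simplicialBoundary_simplicialBoundary z⟩
  refine simplicialBoundary_mem_supported (S := {σ | σ ∈ K ∧ σ.card = j + 1 + 1}) ?_ hz
  rintro σ ⟨hσ, hc⟩ i hi hn
  refine ⟨mem_of_subset hσ (Finset.erase_subset _ _) hn, ?_⟩
  rw [Finset.card_erase_of_mem hi, hc]; omega

variable [Finite ι]

lemma finrank_boundaries_add_betti (K : PreAbstractSimplicialComplex ι) (j : ℕ) :
    Module.finrank ℚ (K.boundaries j) + K.betti j = Module.finrank ℚ (K.cycles j) := by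
  rw [betti, ← Submodule.finrank_quotient_add_finrank ((K.boundaries j).submoduleOf (K.cycles j)),
    (Submodule.submoduleOfEquivOfLe (K.boundaries_le_cycles j)).finrank_eq, add_comm]

lemma betti_eq_zero_of_cycles_le {K : PreAbstractSimplicialComplex ι} {j : ℕ}
    (h : K.cycles j ≤ K.boundaries j) : K.betti j = 0 := by
  have h1 := K.finrank_boundaries_add_betti j
  have h2 := Submodule.finrank_mono h
  omega

/-- The coefficients at the faces in `T` are `T.card` linear functionals on the cycles of `K`, and
their common kernel consists of cycles of `L`. -/
lemma finrank_cycles_le {K L : PreAbstractSimplicialComplex ι} {j : ℕ}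
    {T : Finset (Finset ι)} (hT : ∀ σ ∈ K, σ ∉ L → σ.card = j + 1 → σ ∈ T) :
    Module.finrank ℚ (K.cycles j) ≤ Module.finrank ℚ (L.cycles j) + T.card := by
  let φ : (Finset ι →₀ ℚ) →ₗ[ℚ] (T → ℚ) := LinearMap.pi fun σ => Finsupp.lapply σ.1
  have h1 := LinearMap.finrank_range_add_finrank_ker (φ.domRestrict (K.cycles j))
  have h2 : Module.finrank ℚ (LinearMap.range (φ.domRestrict (K.cycles j))) ≤ T.card := by
    refine (Submodule.finrank_le _).trans ?_
    simp
  have h3 : Module.finrank ℚ (LinearMap.ker (φ.domRestrict (K.cycles j)))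
      ≤ Module.finrank ℚ (L.cycles j) := by
    rw [(Submodule.equivMapOfInjective (K.cycles j).subtype (Submodule.subtype_injective _)
      (LinearMap.ker (φ.domRestrict (K.cycles j)))).finrank_eq]
    refine Submodule.finrank_mono ?_
    rintro _ ⟨⟨z, hz⟩, hk, rfl⟩
    refine ⟨?_, hz.2⟩
    refine (Finsupp.mem_supported _ _).2 ?_
    intro σ hσ
    have hK := (Finsupp.mem_supported _ _).1 hz.1 hσ
    refine ⟨?_, hK.2⟩
    by_contra hL
    have hσT := hT σ hK.1 hL hK.2
    have : φ z ⟨σ, hσT⟩ = 0 := by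
      have hk' : φ z = 0 := hk
      rw [hk']; rfl
    exact (Finsupp.mem_support_iff.1 hσ) this
  omega

lemma finrank_boundaries_le {K L : PreAbstractSimplicialComplex ι} {j : ℕ}
    {T : Finset (Finset ι)} (hT : ∀ σ ∈ K, σ ∉ L → σ.card = j + 2 → σ ∈ T) :
    Module.finrank ℚ (K.boundaries j) ≤ Module.finrank ℚ (L.boundaries j) + T.card := by
  have h1 : K.chains (j + 1) ≤ L.chains (j + 1) ⊔ Finsupp.supported ℚ ℚ (T : Set (Finset ι)) := by
    rw [chains, chains, ← Finsupp.supported_union]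
    refine Finsupp.supported_mono fun σ hσ => ?_
    by_cases hL : σ ∈ L
    · exact Or.inl ⟨hL, hσ.2⟩
    · exact Or.inr (hT σ hσ.1 hL hσ.2)
  have h2 : K.boundaries j ≤ L.boundaries j ⊔
      (Finsupp.supported ℚ ℚ (T : Set (Finset ι))).map (simplicialBoundary ι) := by
    rw [boundaries, boundaries, ← Submodule.map_sup]
    exact Submodule.map_mono h1
  have h3 := (Submodule.finrank_mono h2).trans (Submodule.finrank_add_le_finrank_add_finrank _ _)
  have h4 := Submodule.finrank_map_le (simplicialBoundary ι)
    (Finsupp.supported ℚ ℚ (T : Set (Finset ι)))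
  have h5 : Module.finrank ℚ (Finsupp.supported ℚ ℚ (T : Set (Finset ι))) = T.card := by
    rw [(Finsupp.supportedEquivFinsupp (M := ℚ) (R := ℚ) (T : Set (Finset ι))).finrank_eq]
    simp
  omega

/-- The Betti number changes at most by the number of faces added in two dimensions. -/
lemma abs_betti_sub_betti_le {K L : PreAbstractSimplicialComplex ι} (hLK : L ≤ K) {j : ℕ}
    {T : Finset (Finset ι)}
    (hT : ∀ σ ∈ K, σ ∉ L → σ.card = j + 1 ∨ σ.card = j + 2 → σ ∈ T) :
    |(K.betti j : ℝ) - L.betti j| ≤ T.card := by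
  have h1 := K.finrank_boundaries_add_betti j
  have h2 := L.finrank_boundaries_add_betti j
  have h3 := finrank_cycles_le (K := K) (L := L) fun σ hK hL hc => hT σ hK hL (Or.inl hc)
  have h4 := finrank_boundaries_le (K := K) (L := L) fun σ hK hL hc => hT σ hK hL (Or.inr hc)
  have h5 : Module.finrank ℚ (L.cycles j) ≤ Module.finrank ℚ (K.cycles j) :=
    Submodule.finrank_mono (inf_le_inf_right _ (chains_mono hLK j))
  have h6 : Module.finrank ℚ (L.boundaries j) ≤ Module.finrank ℚ (K.boundaries j) :=
    Submodule.finrank_mono (Submodule.map_mono (chains_mono hLK _))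
  rw [abs_le]
  constructor
  · have : L.betti j ≤ K.betti j + T.card := by omega
    have : (L.betti j : ℝ) ≤ K.betti j + T.card := by exact_mod_cast this
    linarith
  · have : K.betti j ≤ L.betti j + T.card := by omega
    have : (K.betti j : ℝ) ≤ L.betti j + T.card := by exact_mod_cast this
    linarith

/-- Betti numbers are additive over a partition of the faces into two subcomplexes. -/
lemma betti_add {K L₁ L₂ : PreAbstractSimplicialComplex ι}
    (hK : ∀ σ, σ ∈ K ↔ σ ∈ L₁ ∨ σ ∈ L₂) (hd : ∀ σ, σ ∈ L₁ → σ ∉ L₂) (j : ℕ) :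
    K.betti j = L₁.betti j + L₂.betti j := by
  have hsup : ∀ m, K.chains m = L₁.chains m ⊔ L₂.chains m := by
    intro m
    rw [chains, chains, chains, ← Finsupp.supported_union]
    congr 1
    ext σ
    simp only [hK, Set.mem_ofPred_eq, Set.mem_union]
    tauto
  have hdis : Disjoint (Finsupp.supported ℚ ℚ {σ | σ ∈ L₁})
      (Finsupp.supported ℚ ℚ {σ | σ ∈ L₂}) := by
    rw [Finsupp.disjoint_supported_supported_iff]
    exact Set.disjoint_left.2 hd
  have hch : ∀ (L : PreAbstractSimplicialComplex ι) m,
      L.chains m ≤ Finsupp.supported ℚ ℚ {σ | σ ∈ L} :=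
    fun L m => Finsupp.supported_mono fun _ hσ => hσ.1
  have hZ : K.cycles j = L₁.cycles j ⊔ L₂.cycles j := by
    apply le_antisymm
    · rintro z ⟨hz, hzc⟩
      rw [hsup] at hz
      obtain ⟨z₁, h₁, z₂, h₂, rfl⟩ := Submodule.mem_sup.1 hz
      have hsum : simplicialBoundary ι z₁ + simplicialBoundary ι z₂ = 0 := by
        rw [← map_add]; exact hzc
      -- The boundary of `z₁` is minus that of `z₂`, hence is supported on both subcomplexes, which
      -- share no face.
      have e₁ : simplicialBoundary ι z₁ = 0 := by
        refine Submodule.disjoint_def.1 hdis _ (simplicialBoundary_mem_chains_support h₁) ?_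
        rw [eq_neg_of_add_eq_zero_left hsum]
        exact Submodule.neg_mem _ (simplicialBoundary_mem_chains_support h₂)
      rw [e₁, zero_add] at hsum
      exact Submodule.add_mem_sup ⟨h₁, e₁⟩ ⟨h₂, hsum⟩
    · rw [cycles, cycles, cycles, hsup]
      exact sup_le (inf_le_inf_right _ le_sup_left) (inf_le_inf_right _ le_sup_right)
  have hB : K.boundaries j = L₁.boundaries j ⊔ L₂.boundaries j := by
    rw [boundaries, boundaries, boundaries, hsup, Submodule.map_sup]
  have hfin : ∀ {A₁ A₂ : Submodule ℚ (Finset ι →₀ ℚ)}, A₁ ≤ L₁.cycles j → A₂ ≤ L₂.cycles j →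
      Module.finrank ℚ ↥(A₁ ⊔ A₂) = Module.finrank ℚ A₁ + Module.finrank ℚ A₂ := by
    intro A₁ A₂ h₁ h₂
    have := Submodule.finrank_sup_add_finrank_inf_eq A₁ A₂
    rwa [(hdis.mono (h₁.trans (inf_le_left.trans (hch L₁ j)))
      (h₂.trans (inf_le_left.trans (hch L₂ j)))).eq_bot, finrank_bot, add_zero] at this
  have h0 := K.finrank_boundaries_add_betti j
  have h1 := L₁.finrank_boundaries_add_betti j
  have h2 := L₂.finrank_boundaries_add_betti j
  have h3 := hfin (L₁.boundaries_le_cycles j) (L₂.boundaries_le_cycles j)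
  have h4 := hfin (le_refl (L₁.cycles j)) (le_refl (L₂.cycles j))
  rw [← hB] at h3
  rw [← hZ] at h4
  omega

/-- `σ` is an empty simplex of `K`: not a face, but all its facets are faces. -/
def IsHole (K : PreAbstractSimplicialComplex ι) (σ : Finset ι) : Prop :=
  σ ∉ K ∧ ∀ i ∈ σ, σ.erase i ∈ K

/-- On at most `j + 2` vertices, only the hollow simplex on all `j + 2` vertices has nonzero `j`-th
homology. -/
lemma betti_of_card_le {K : PreAbstractSimplicialComplex ι} {A : Finset ι} {j : ℕ} (hj : 1 ≤ j)
    (hA : A.card ≤ j + 2) (hK : ∀ σ ∈ K, σ ⊆ A) [Decidable (A.card = j + 2 ∧ K.IsHole A)] :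
    K.betti j = if A.card = j + 2 ∧ K.IsHole A then 1 else 0 := by
  have hzero : (K.cycles j ≤ ⊥) → K.betti j = 0 := fun h =>
    betti_eq_zero_of_cycles_le (h.trans bot_le)
  rcases A.eq_empty_or_nonempty with rfl | hAn
  · rw [if_neg (by simp)]
    apply hzero
    rintro z ⟨hz, -⟩
    replace hz := (Finsupp.mem_supported _ _).1 hz
    rw [Submodule.mem_bot, ← Finsupp.support_eq_empty, Finset.eq_empty_iff_forall_notMem]
    intro σ hσ
    have h1 := hz hσ
    have h2 := Finset.subset_empty.1 (hK σ h1.1)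
    have := h1.2
    rw [h2] at this
    simp at this
  set v := A.min' hAn with hv
  -- Coning off from the smallest vertex of `A` fills every cycle inside the full simplex on `A`,
  -- possibly with simplices outside `K`. Since `1 ≤ j`, cycles for the plain boundary are cycles
  -- for the augmented one.
  have hcyc : ∀ z ∈ K.cycles j, ∃ w ∈ Finsupp.supported ℚ ℚ {σ : Finset ι | σ ⊆ A ∧ σ.card = j + 2},
      augBoundary ι w = z := by
    rintro z ⟨hz, hzc⟩
    have hz' : augBoundary ι z = 0 := by
      rw [← simplicialBoundary_eq_aug (S := {σ | σ ∈ K ∧ σ.card = j + 1}) _ hz]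
      · exact hzc
      · rintro σ ⟨_, hc⟩; omega
    refine ⟨coneMap v z, coneMap_mem_supported ?_ hz, augBoundary_coneMap_of_cycle ?_ hz hz'⟩
    · rintro σ ⟨hσ, hc⟩ hvσ
      refine ⟨Finset.insert_subset (A.min'_mem hAn) (hK σ hσ), ?_⟩
      rw [Finset.card_insert_of_notMem hvσ, hc]
    · rintro σ ⟨hσ, _⟩ i hi
      exact A.min'_le i (hK σ hσ hi)
  rcases hA.lt_or_eq with hlt | hcard
  · rw [if_neg (by omega)]
    apply hzero
    intro z hz
    obtain ⟨w, hw, rfl⟩ := hcyc z hz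
    have : w = 0 := by
      rw [Finsupp.mem_supported] at hw
      rw [← Finsupp.support_eq_empty, Finset.eq_empty_iff_forall_notMem]
      intro σ hσ
      have h1 := hw hσ
      have := Finset.card_le_card h1.1
      have := h1.2
      omega
    rw [this, map_zero]; exact Submodule.zero_mem _
  -- Now `A` is the only subset of `A` with `j + 2` elements, so every cycle is a multiple of the
  -- boundary `b` of the full simplex. As `b` has nonzero coefficients on all facets, a missing
  -- facet kills all cycles.
  set b := augBoundary ι (Finsupp.single A 1) with hb
  have hcyc' : ∀ z ∈ K.cycles j, ∃ c : ℚ, z = c • b := by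
    intro z hz
    obtain ⟨w, hw, rfl⟩ := hcyc z hz
    refine ⟨w A, ?_⟩
    rw [hb, ← map_smul]
    congr 1
    ext σ
    rw [Finsupp.smul_apply, Finsupp.single_apply]
    split_ifs with h
    · rw [← h]; simp
    · simp only [smul_zero]
      by_contra hne
      have h1 := (Finsupp.mem_supported _ _).1 hw (Finsupp.mem_support_iff.2 hne)
      exact h (Finset.eq_of_subset_of_card_le h1.1 (by rw [h1.2, hcard])).symm
  have hcoef : ∀ i ∈ A, b (A.erase i) ≠ 0 := by
    intro i hi
    rw [hb, augBoundary_single, Finsupp.finsetSum_apply, Finset.sum_eq_single i]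
    · rw [Finsupp.single_eq_same, one_mul]; exact facetSign_ne_zero _ _
    · intro m hm hmi
      rw [Finsupp.single_apply, if_neg]
      intro e
      exact hmi (Finset.erase_injOn A hm hi e)
    · exact fun h => absurd hi h
  have hbb : simplicialBoundary ι (Finsupp.single A 1) = b :=
    simplicialBoundary_single_eq_aug (by omega) 1
  by_cases hfac : ∀ i ∈ A, A.erase i ∈ K
  · have hbZ : b ∈ K.cycles j := by
      refine ⟨?_, ?_⟩
      · refine augBoundary_mem_supported (S := {A}) ?_ (Finsupp.single_mem_supported _ _ rfl)
        rintro σ rfl i hi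
        refine ⟨hfac i hi, ?_⟩
        rw [Finset.card_erase_of_mem hi]; omega
      · rw [← hbb]; exact simplicialBoundary_simplicialBoundary _
    by_cases hAK : A ∈ K
    · rw [if_neg (fun h => h.2.1 hAK)]
      apply betti_eq_zero_of_cycles_le
      intro z hz
      obtain ⟨c, rfl⟩ := hcyc' z hz
      refine Submodule.smul_mem _ _ ?_
      rw [← hbb]
      exact Submodule.mem_map_of_mem (Finsupp.single_mem_supported _ _ ⟨hAK, hcard⟩)
    · rw [if_pos ⟨hcard, hAK, hfac⟩]
      have hZ : K.cycles j = Submodule.span ℚ {b} := by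
        apply le_antisymm
        · intro z hz
          obtain ⟨c, rfl⟩ := hcyc' z hz
          exact Submodule.smul_mem _ _ (Submodule.mem_span_singleton_self b)
        · rw [Submodule.span_singleton_le_iff_mem]; exact hbZ
      have hB : K.boundaries j = ⊥ := by
        have : K.chains (j + 1) = ⊥ := by
          rw [chains, show {σ | σ ∈ K ∧ σ.card = j + 1 + 1} = ∅ from ?_, Finsupp.supported_empty]
          rw [Set.eq_empty_iff_forall_notMem]
          rintro σ ⟨hσ, hc⟩
          exact hAK (Finset.eq_of_subset_of_card_le (hK σ hσ) (by rw [hc, hcard]) ▸ hσ)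
        rw [boundaries, this, Submodule.map_bot]
      have hb0 : b ≠ 0 := by
        intro h
        have := hcoef v (A.min'_mem hAn)
        rw [h] at this
        exact this rfl
      have := K.finrank_boundaries_add_betti j
      rw [hZ, hB, finrank_bot, zero_add, finrank_span_singleton hb0] at this
      exact this
  · rw [if_neg (fun h => hfac h.2.2)]
    apply hzero
    push Not at hfac
    obtain ⟨i, hi, hiK⟩ := hfac
    intro z hz
    obtain ⟨c, rfl⟩ := hcyc' z hz
    have : (c • b) (A.erase i) = 0 := by
      by_contra hne
      exact hiK ((Finsupp.mem_supported _ _).1 hz.1 (Finsupp.mem_support_iff.2 hne)).1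
    rw [Finsupp.smul_apply, smul_eq_mul, mul_eq_zero] at this
    rcases this with h | h
    · rw [h, zero_smul]; exact Submodule.zero_mem _
    · exact absurd h (hcoef i hi)

end PreAbstractSimplicialComplex

/-! ### Vanishing of the homology of nerves of convex sets in high dimension -/

section Leray

variable {ι : Type*}

/-- The slice of a set of vectors at height `t` of the zeroth coordinate. -/
def slice {m : ℕ} (t : ℝ) (C : Set (Fin (m + 1) → ℝ)) : Set (Fin m → ℝ) :=
  {y | (Fin.cons t y : Fin (m + 1) → ℝ) ∈ C}

lemma slice_eq_image {m : ℕ} (t : ℝ) (C : Set (Fin (m + 1) → ℝ)) :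
    slice t C = LinearMap.funLeft ℝ ℝ Fin.succ '' (C ∩ {x | x 0 = t}) := by
  ext y
  constructor
  · intro hy
    exact ⟨Fin.cons t y, ⟨hy, rfl⟩, by ext i; simp [LinearMap.funLeft_apply]⟩
  · rintro ⟨x, ⟨hx, rfl⟩, rfl⟩
    have : (Fin.cons (x 0) (LinearMap.funLeft ℝ ℝ Fin.succ x) : Fin (m + 1) → ℝ) = x := by
      ext i
      refine Fin.cases ?_ (fun i => ?_) i <;> simp [LinearMap.funLeft_apply]
    change (Fin.cons (x 0) (LinearMap.funLeft ℝ ℝ Fin.succ x) : Fin (m + 1) → ℝ) ∈ C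
    rwa [this]

lemma isLinearMap_apply_zero (m : ℕ) : IsLinearMap ℝ (fun x : Fin (m + 1) → ℝ => x 0) :=
  ⟨fun _ _ => rfl, fun _ _ => rfl⟩

lemma convex_slice {m : ℕ} (t : ℝ) {C : Set (Fin (m + 1) → ℝ)} (hC : Convex ℝ C) :
    Convex ℝ (slice t C) := by
  rw [slice_eq_image]
  exact (hC.inter (convex_hyperplane (isLinearMap_apply_zero m) t)).linear_image _

lemma isCompact_slice {m : ℕ} (t : ℝ) {C : Set (Fin (m + 1) → ℝ)} (hC : IsCompact C) :
    IsCompact (slice t C) := by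
  rw [slice_eq_image]
  refine (hC.inter_right (isClosed_eq (continuous_apply 0) continuous_const)).image ?_
  exact continuous_pi fun i => continuous_apply _

lemma exists_height_of_slice {m : ℕ} {C : ι → Set (Fin (m + 1) → ℝ)} {t : ℝ} {σ : Finset ι} :
    (⋂ i ∈ σ, slice t (C i)).Nonempty ↔ t ∈ (fun x : Fin (m + 1) → ℝ => x 0) '' ⋂ i ∈ σ, C i := by
  constructor
  · rintro ⟨y, hy⟩
    refine ⟨Fin.cons t y, ?_, rfl⟩
    simpa [slice] using hy
  · rintro ⟨x, hx, rfl⟩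
    refine ⟨fun i => x i.succ, ?_⟩
    have : (Fin.cons (x 0) (fun i => x i.succ) : Fin (m + 1) → ℝ) = x := Fin.cons_self_tail x
    simp only [Set.mem_iInter, slice] at hx ⊢
    intro i hi
    change (Fin.cons (x 0) (fun i => x i.succ) : Fin (m + 1) → ℝ) ∈ C i
    rw [this]; exact hx i hi

lemma eq_zero_of_mem_supported_of_forall_notMem {S : Set (Finset ι)} (hS : ∀ σ, σ ∉ S)
    {z : Finset ι →₀ ℚ} (hz : z ∈ Finsupp.supported ℚ ℚ S) : z = 0 := by
  rw [← Finsupp.support_eq_empty, Finset.eq_empty_iff_forall_notMem]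
  exact fun σ hσ => hS σ ((Finsupp.mem_supported _ _).1 hz hσ)

variable [LinearOrder ι] [Finite ι]

/-- The nerve of compact convex sets in dimension `m` has no homology in dimensions `≥ m`. -/
theorem exists_augBoundary_eq_of_convex (m : ℕ) : ∀ (C : ι → Set (Fin m → ℝ)),
    (∀ i, Convex ℝ (C i)) → (∀ i, IsCompact (C i)) → ∀ j, m ≤ j → ∀ z : Finset ι →₀ ℚ,
    z ∈ Finsupp.supported ℚ ℚ {σ : Finset ι | σ.card = j + 1 ∧ (⋂ i ∈ σ, C i).Nonempty} →
    augBoundary ι z = 0 →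
    ∃ w ∈ Finsupp.supported ℚ ℚ {σ : Finset ι | σ.card = j + 2 ∧ (⋂ i ∈ σ, C i).Nonempty},
      augBoundary ι w = z := by
  induction m with
  | zero =>
    intro C _ _ j _ z hz hc
    classical
    -- Space is a single point, so the nerve is the full simplex on the indices of the nonempty
    -- sets, and a cone fills every cycle.
    have hmeet : ∀ σ : Finset ι, (⋂ i ∈ σ, C i).Nonempty ↔ ∀ i ∈ σ, (C i).Nonempty := by
      intro σ
      constructor
      · rintro ⟨x, hx⟩ i hi
        exact ⟨x, Set.mem_iInter₂.1 hx i hi⟩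
      · intro h
        refine ⟨0, Set.mem_iInter₂.2 fun i hi => ?_⟩
        obtain ⟨x, hx⟩ := h i hi
        rwa [Subsingleton.elim x 0] at hx
    simp only [hmeet] at hz ⊢
    cases nonempty_fintype ι
    let V : Finset ι := Finset.univ.filter fun i => (C i).Nonempty
    rcases V.eq_empty_or_nonempty with hV | hV
    · refine ⟨0, Submodule.zero_mem _, ?_⟩
      rw [map_zero]
      symm
      refine eq_zero_of_mem_supported_of_forall_notMem ?_ hz
      rintro σ ⟨hcard, hσ⟩
      have hn : σ.Nonempty := Finset.card_pos.1 (by omega)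
      obtain ⟨i, hi⟩ := hn
      have : i ∈ V := Finset.mem_filter.2 ⟨Finset.mem_univ _, hσ i hi⟩
      rw [hV] at this
      simp at this
    · refine ⟨coneMap (V.min' hV) z, coneMap_mem_supported ?_ hz,
        augBoundary_coneMap_of_cycle ?_ hz hc⟩
      · rintro σ ⟨hcard, hσ⟩ hv
        refine ⟨by rw [Finset.card_insert_of_notMem hv, hcard], ?_⟩
        intro i hi
        rcases Finset.mem_insert.1 hi with rfl | hi
        · exact (Finset.mem_filter.1 (V.min'_mem hV)).2
        · exact hσ i hi
      · rintro σ ⟨_, hσ⟩ i hi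
        exact V.min'_le i (Finset.mem_filter.2 ⟨Finset.mem_univ _, hσ i hi⟩)
  | succ m ihm =>
    intro C hconv hcomp j hj
    obtain ⟨j, rfl⟩ : ∃ j', j = j' + 1 := ⟨j - 1, by omega⟩
    -- Inner induction on the number of faces of the nerve: the sweep cuts off the faces whose
    -- intersection lies highest.
    induction hN : Set.ncard {σ : Finset ι | σ.Nonempty ∧ (⋂ i ∈ σ, C i).Nonempty}
      using Nat.strong_induction_on generalizing C with
    | _ N ih =>
    intro z hz hc
    set 𝓕 : Set (Finset ι) := {σ : Finset ι | σ.Nonempty ∧ (⋂ i ∈ σ, C i).Nonempty} with h𝓕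
    have hfin : 𝓕.Finite := Set.toFinite _
    rcases 𝓕.eq_empty_or_nonempty with h0 | hne
    · refine ⟨0, Submodule.zero_mem _, ?_⟩
      rw [map_zero]
      symm
      refine eq_zero_of_mem_supported_of_forall_notMem ?_ hz
      rintro σ ⟨hcard, hσ⟩
      have : σ ∈ 𝓕 := ⟨Finset.card_pos.1 (by omega), hσ⟩
      rw [h0] at this
      exact this
    let S : Finset ι → Set ℝ := fun σ => (fun x : Fin (m + 1) → ℝ => x 0) '' ⋂ i ∈ σ, C i
    let a : Finset ι → ℝ := fun σ => sInf (S σ)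
    let b : Finset ι → ℝ := fun σ => sSup (S σ)
    have hS : ∀ σ ∈ 𝓕, S σ = Set.Icc (a σ) (b σ) := by
      rintro σ ⟨⟨i₀, hi₀⟩, hσ⟩
      have hconv' : Convex ℝ (⋂ i ∈ σ, C i) := convex_iInter₂ fun i _ => hconv i
      have hcomp' : IsCompact (⋂ i ∈ σ, C i) :=
        (hcomp i₀).of_isClosed_subset (isClosed_biInter fun i _ => (hcomp i).isClosed)
          (Set.biInter_subset_of_mem hi₀)
      refine eq_Icc_of_connected_compact ?_ (hcomp'.image (continuous_apply 0))
      exact ⟨hσ.image _, (hconv'.isPreconnected.image _ (continuous_apply 0).continuousOn)⟩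
    have hab : ∀ σ ∈ 𝓕, a σ ≤ b σ := by
      intro σ hσ
      rw [← Set.nonempty_Icc, ← hS σ hσ]
      exact hσ.2.image _
    obtain ⟨σ₀, hσ₀, hmax⟩ := Set.exists_max_image 𝓕 a hfin hne
    -- The largest of the lowest heights: every face starts at height at most `t`, so a face meets
    -- the slice at `t` exactly when it reaches up to `t`.
    set t := a σ₀ with ht
    -- The height `s` is just below `t`: no face starts strictly between them or ends in `[s, t)`.
    -- So the faces meeting the slice at `s` are those common to the slice at `t` and to the part
    -- below `s`, and these two nerves cover all faces, as in a Mayer–Vietoris argument.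
    obtain ⟨s, hst, hs⟩ : ∃ s < t, ∀ σ ∈ 𝓕, (a σ < t → a σ ≤ s) ∧ (b σ < t → b σ < s) := by
      have h1 : ∀ᶠ s in 𝓝[<] t, ∀ σ ∈ 𝓕, (a σ < t → a σ ≤ s) ∧ (b σ < t → b σ < s) := by
        rw [hfin.eventually_all]
        intro σ _
        have hx : ∀ c : ℝ, ∀ᶠ s in 𝓝[<] t, c < t → c < s := by
          intro c
          by_cases hc : c < t
          · filter_upwards [Ioo_mem_nhdsLT hc] with s hs _ using hs.1
          · exact Filter.Eventually.of_forall fun s h => absurd h hc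
        filter_upwards [hx (a σ), hx (b σ)] with s h1 h2
        exact ⟨fun h => (h1 h).le, h2⟩
      obtain ⟨s, h2, h3⟩ := (h1.and self_mem_nhdsWithin).exists
      exact ⟨s, h3, h2⟩
    let C' : ι → Set (Fin (m + 1) → ℝ) := fun i => C i ∩ {x | x 0 ≤ s}
    have hC' : ∀ σ : Finset ι, σ.Nonempty →
        ((⋂ i ∈ σ, C' i).Nonempty ↔ σ ∈ 𝓕 ∧ a σ ≤ s) := by
      intro σ hσn
      constructor
      · rintro ⟨x, hx⟩
        simp only [C', Set.mem_iInter, Set.mem_inter_iff] at hx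
        have hxC : x ∈ ⋂ i ∈ σ, C i := Set.mem_iInter₂.2 fun i hi => (hx i hi).1
        have hσ : σ ∈ 𝓕 := ⟨hσn, x, hxC⟩
        refine ⟨hσ, ?_⟩
        have : x 0 ∈ S σ := ⟨x, hxC, rfl⟩
        rw [hS σ hσ] at this
        obtain ⟨i, hi⟩ := hσn
        exact this.1.trans (hx i hi).2
      · rintro ⟨hσ, has⟩
        have : a σ ∈ S σ := by rw [hS σ hσ]; exact ⟨le_rfl, hab σ hσ⟩
        obtain ⟨x, hx, hxa⟩ := this
        refine ⟨x, Set.mem_iInter₂.2 fun i hi => ⟨Set.mem_iInter₂.1 hx i hi, ?_⟩⟩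
        exact le_of_eq_of_le hxa has
    have hslice : ∀ (u : ℝ) (σ : Finset ι), σ.Nonempty →
        ((⋂ i ∈ σ, slice u (C i)).Nonempty ↔ σ ∈ 𝓕 ∧ a σ ≤ u ∧ u ≤ b σ) := by
      intro u σ hσn
      rw [exists_height_of_slice]
      constructor
      · intro h
        have hσ : σ ∈ 𝓕 := ⟨hσn, Set.Nonempty.of_image ⟨u, h⟩⟩
        refine ⟨hσ, ?_⟩
        have h' : u ∈ S σ := h
        rwa [hS σ hσ] at h'
      · rintro ⟨hσ, h⟩
        change u ∈ S σ
        rw [hS σ hσ]; exact h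
    -- split `z` into its parts inside and outside of the slice at height `t`
    classical
    set zF := z.filter fun σ => (⋂ i ∈ σ, slice t (C i)).Nonempty with hzF
    set z' := z.filter fun σ => ¬ (⋂ i ∈ σ, slice t (C i)).Nonempty with hz'
    have hsplit : zF + z' = z := Finsupp.filter_add_filter_not z _
    have hzFs : zF ∈ Finsupp.supported ℚ ℚ
        {σ : Finset ι | σ.card = j + 2 ∧ (⋂ i ∈ σ, slice t (C i)).Nonempty} := by
      rw [Finsupp.mem_supported]
      intro σ hσ
      rw [hzF, Finset.mem_coe, Finsupp.support_filter, Finset.mem_filter] at hσ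
      exact ⟨((Finsupp.mem_supported _ _).1 hz hσ.1).1, hσ.2⟩
    have hz's : z' ∈ Finsupp.supported ℚ ℚ
        {σ : Finset ι | σ.card = j + 2 ∧ (⋂ i ∈ σ, C' i).Nonempty} := by
      rw [Finsupp.mem_supported]
      intro σ hσ
      rw [hz', Finset.mem_coe, Finsupp.support_filter, Finset.mem_filter] at hσ
      have h1 := (Finsupp.mem_supported _ _).1 hz hσ.1
      have hn : σ.Nonempty := Finset.card_pos.1 (by rw [h1.1]; omega)
      have hσ𝓕 : σ ∈ 𝓕 := ⟨hn, h1.2⟩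
      refine ⟨h1.1, (hC' σ hn).2 ⟨hσ𝓕, ?_⟩⟩
      refine (hs σ hσ𝓕).1 (lt_of_le_of_ne (hmax σ hσ𝓕) fun e => hσ.2 ?_)
      exact (hslice t σ hn).2 ⟨hσ𝓕, e.le, e ▸ hab σ hσ𝓕⟩
    have hbd : augBoundary ι zF = -augBoundary ι z' := by
      rw [eq_neg_iff_add_eq_zero, ← map_add, hsplit, hc]
    have herase : ∀ (D : ι → Set (Fin m → ℝ)), ∀ σ : Finset ι,
        σ ∈ {σ : Finset ι | σ.card = j + 2 ∧ (⋂ i ∈ σ, D i).Nonempty} → ∀ i ∈ σ,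
        σ.erase i ∈ {σ : Finset ι | σ.card = j + 1 ∧ (⋂ i ∈ σ, D i).Nonempty} := by
      rintro D σ ⟨hcard, hσ⟩ i hi
      refine ⟨by rw [Finset.card_erase_of_mem hi]; omega, hσ.mono ?_⟩
      exact Set.biInter_subset_biInter_left (Finset.erase_subset _ _)
    have herase' : ∀ σ : Finset ι,
        σ ∈ {σ : Finset ι | σ.card = j + 2 ∧ (⋂ i ∈ σ, C' i).Nonempty} → ∀ i ∈ σ,
        σ.erase i ∈ {σ : Finset ι | σ.card = j + 1 ∧ (⋂ i ∈ σ, C' i).Nonempty} := by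
      rintro σ ⟨hcard, hσ⟩ i hi
      refine ⟨by rw [Finset.card_erase_of_mem hi]; omega, hσ.mono ?_⟩
      exact Set.biInter_subset_biInter_left (Finset.erase_subset _ _)
    -- The boundary of `zF` equals minus that of `z'`, so it lives in the intersection of the two
    -- nerves.
    have hG : augBoundary ι zF ∈ Finsupp.supported ℚ ℚ
        {σ : Finset ι | σ.card = j + 1 ∧ (⋂ i ∈ σ, slice s (C i)).Nonempty} := by
      have h1 := augBoundary_mem_supported (herase _) hzFs
      have h2 := augBoundary_mem_supported herase' hz's
      rw [← neg_mem_iff, ← hbd] at h2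
      rw [Finsupp.mem_supported] at h1 h2 ⊢
      intro σ hσ
      have hn : σ.Nonempty := Finset.card_pos.1 (by rw [(h1 hσ).1]; omega)
      obtain ⟨hσ𝓕, -, h4⟩ := (hslice t σ hn).1 (h1 hσ).2
      exact ⟨(h1 hσ).1,
        (hslice s σ hn).2 ⟨hσ𝓕, ((hC' σ hn).1 (h2 hσ).2).2, hst.le.trans h4⟩⟩
    -- One dimension lower, the common boundary is filled by `w` in the slice at `s`. Then `zF - w`
    -- and `w + z'` are cycles in the two pieces: the first is filled by the induction on dimension,
    -- the second by that on the number of faces.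
    obtain ⟨w, hw, hwb⟩ := ihm (fun i => slice s (C i)) (fun i => convex_slice s (hconv i))
      (fun i => isCompact_slice s (hcomp i)) j (by omega) _ hG (augBoundary_augBoundary _)
    have hwF : w ∈ Finsupp.supported ℚ ℚ
        {σ : Finset ι | σ.card = j + 2 ∧ (⋂ i ∈ σ, slice t (C i)).Nonempty} := by
      refine Finsupp.supported_mono ?_ hw
      rintro σ ⟨hcard, hσ⟩
      have hn : σ.Nonempty := Finset.card_pos.1 (by omega)
      obtain ⟨hσ𝓕, h3, h4⟩ := (hslice s σ hn).1 hσ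
      refine ⟨hcard, (hslice t σ hn).2 ⟨hσ𝓕, hmax σ hσ𝓕, ?_⟩⟩
      by_contra hlt
      exact absurd ((hs σ hσ𝓕).2 (not_le.1 hlt)) (not_lt.2 h4)
    have hwC' : w ∈ Finsupp.supported ℚ ℚ
        {σ : Finset ι | σ.card = j + 2 ∧ (⋂ i ∈ σ, C' i).Nonempty} := by
      refine Finsupp.supported_mono ?_ hw
      rintro σ ⟨hcard, hσ⟩
      have hn : σ.Nonempty := Finset.card_pos.1 (by omega)
      obtain ⟨hσ𝓕, h3, h4⟩ := (hslice s σ hn).1 hσ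
      exact ⟨hcard, (hC' σ hn).2 ⟨hσ𝓕, h3⟩⟩
    obtain ⟨u, hu, hub⟩ := ihm (fun i => slice t (C i)) (fun i => convex_slice t (hconv i))
      (fun i => isCompact_slice t (hcomp i)) (j + 1) (by omega) (zF - w)
      (Submodule.sub_mem _ hzFs hwF) (by rw [map_sub, hwb, sub_self])
    -- The face `σ₀` starts at height `t > s`, so it is lost below `s`.
    have hlt : Set.ncard {σ : Finset ι | σ.Nonempty ∧ (⋂ i ∈ σ, C' i).Nonempty} < N := by
      rw [← hN]
      refine Set.ncard_lt_ncard ?_ hfin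
      rw [Set.ssubset_iff_of_subset]
      · refine ⟨σ₀, hσ₀, fun h => ?_⟩
        exact absurd ((hC' σ₀ h.1).1 h.2).2 (not_le.2 hst)
      · rintro σ ⟨hn, hσ⟩
        exact ((hC' σ hn).1 hσ).1
    obtain ⟨u', hu', hub'⟩ := ih _ hlt C'
      (fun i => (hconv i).inter (convex_halfSpace_le (isLinearMap_apply_zero m) s))
      (fun i => (hcomp i).inter_right (isClosed_le (continuous_apply 0) continuous_const)) rfl
      (w + z') (Submodule.add_mem _ hwC' hz's)
      (by rw [map_add, hwb, ← map_add, hsplit, hc])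
    refine ⟨u + u', Submodule.add_mem _ (Finsupp.supported_mono ?_ hu)
      (Finsupp.supported_mono ?_ hu'), ?_⟩
    · rintro σ ⟨hcard, hσ⟩
      have hn : σ.Nonempty := Finset.card_pos.1 (by omega)
      exact ⟨hcard, ((hslice t σ hn).1 hσ).1.2⟩
    · rintro σ ⟨hcard, hσ⟩
      have hn : σ.Nonempty := Finset.card_pos.1 (by omega)
      exact ⟨hcard, ((hC' σ hn).1 hσ).1.2⟩
    · rw [map_add, hub, hub', ← hsplit]
      abel

/-- The Čech complex of points in `ℝ^d` has no homology in dimensions `≥ d`. -/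
theorem betti_cechComplex_eq_zero {d : ℕ} (x : ι → EuclideanSpace ℝ (Fin d)) (r : ℝ) {j : ℕ}
    (hj : 1 ≤ j) (hd : d ≤ j) : (cechComplex x r).betti j = 0 := by
  apply PreAbstractSimplicialComplex.betti_eq_zero_of_cycles_le
  rintro z ⟨hz, hc⟩
  let e := EuclideanSpace.equiv (Fin d) ℝ
  let C : ι → Set (Fin d → ℝ) := fun i => e '' Metric.closedBall (x i) r
  have hC : ∀ σ : Finset ι, (⋂ i ∈ σ, C i).Nonempty ↔
      (⋂ i ∈ σ, Metric.closedBall (x i) r).Nonempty := by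
    intro σ
    have : (⋂ i ∈ σ, C i) = e '' ⋂ i ∈ σ, Metric.closedBall (x i) r := by
      simp only [C]
      rw [Set.image_iInter e.bijective]
      refine Set.iInter_congr fun i => ?_
      rw [Set.image_iInter e.bijective]
    rw [this, Set.image_nonempty]
  have hz2 : z ∈ Finsupp.supported ℚ ℚ
      {σ : Finset ι | σ.card = j + 1 ∧ (⋂ i ∈ σ, C i).Nonempty} := by
    refine Finsupp.supported_mono ?_ hz
    rintro σ ⟨hσ, hcard⟩
    exact ⟨hcard, (hC σ).2 hσ.2⟩
  obtain ⟨w, hw, rfl⟩ := exists_augBoundary_eq_of_convex d C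
    (fun i => (convex_closedBall (x i) r).linear_image e.toLinearMap)
    (fun i => (isCompact_closedBall (x i) r).image e.continuous) j hd z hz2 (by
      rw [← simplicialBoundary_eq_aug (fun σ hσ => ?_) hz2]
      · exact hc
      · rw [hσ.1]; omega)
  refine ⟨w, Finsupp.supported_mono ?_ hw, simplicialBoundary_eq_aug (fun σ hσ => ?_) hw⟩
  · rintro σ ⟨hcard, hσ⟩
    exact ⟨⟨Finset.card_pos.1 (by omega), (hC σ).1 hσ⟩, hcard⟩
  · rw [hσ.1]; omega

end Leray

/-! ### Truncated powers of neighbour counts -/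

section ThresholdPow

/-- The function `N ↦ (1 + N) ^ a` cut off below `b`. -/
def thresholdPow (a b N : ℕ) : ℝ := if b ≤ N then (1 + N : ℝ) ^ a else 0

lemma thresholdPow_nonneg (a b N : ℕ) : 0 ≤ thresholdPow a b N := by
  unfold thresholdPow; split_ifs <;> positivity

lemma thresholdPow_mono (a b : ℕ) {N M : ℕ} (h : N ≤ M) :
    thresholdPow a b N ≤ thresholdPow a b M := by
  unfold thresholdPow
  split_ifs with h1 h2 h2
  · have : (N : ℝ) ≤ M := by exact_mod_cast h
    gcongr
  · omega
  · positivity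
  · exact le_rfl

lemma thresholdPow_zero (a N : ℕ) : thresholdPow a 0 N = (1 + N : ℝ) ^ a := by
  simp [thresholdPow]

lemma thresholdPow_mul (a a' b N : ℕ) :
    thresholdPow a b N * (1 + N : ℝ) ^ a' = thresholdPow (a + a') b N := by
  unfold thresholdPow
  split_ifs
  · rw [pow_add]
  · simp

lemma thresholdPow_le_of_le (a : ℕ) {b b' : ℕ} (h : b ≤ b') (N : ℕ) :
    thresholdPow a b' N ≤ thresholdPow a b N := by
  unfold thresholdPow
  split_ifs
  · exact le_rfl
  · omega
  · positivity
  · exact le_rfl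

lemma choose_le_thresholdPow (N b : ℕ) {a : ℕ} (h : b ≤ a) :
    (N.choose b : ℝ) ≤ thresholdPow a b N := by
  unfold thresholdPow
  split_ifs with h1
  · calc (N.choose b : ℝ) ≤ (N : ℝ) ^ b := by exact_mod_cast Nat.choose_le_pow N b
      _ ≤ (1 + N : ℝ) ^ b := by gcongr; linarith
      _ ≤ (1 + N : ℝ) ^ a := by
          gcongr
          linarith [(Nat.cast_nonneg N : (0 : ℝ) ≤ N)]
  · rw [Nat.choose_eq_zero_of_lt (by omega)]; simp

end ThresholdPow

/-! ### Local changes of Betti numbers and of hollow simplices in Čech complexes -/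

section Cech

open PreAbstractSimplicialComplex

variable {ι E : Type*} [PseudoMetricSpace E] {x : ι → E} {r : ℝ} {k : ℕ}

lemma dist_le_of_mem_cechComplex {σ : Finset ι} (h : σ ∈ cechComplex x r) {u v : ι}
    (hu : u ∈ σ) (hv : v ∈ σ) : dist (x u) (x v) ≤ 2 * r := by
  obtain ⟨-, p, hp⟩ := h
  have h1 := Metric.mem_closedBall.1 (Set.mem_iInter₂.1 hp u hu)
  have h2 := Metric.mem_closedBall.1 (Set.mem_iInter₂.1 hp v hv)
  linarith [dist_triangle_left (x u) (x v) p]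

lemma induce_congr {x' : ι → E} {I : Finset ι} (h : ∀ i ∈ I, x i = x' i) :
    (cechComplex x r).induce I = (cechComplex x' r).induce I := by
  apply SetLike.ext
  intro σ
  simp only [mem_induce]
  refine and_congr_left fun hσ => and_congr_right fun _ => ?_
  rw [Set.iInter₂_congr fun i hi => by rw [h i (hσ hi)]]

variable [LinearOrder ι]

/-- The number of points of index in `I`, other than the one of index `v`, at distance at most `R`
from it. -/
def nearCount (x : ι → E) (R : ℝ) (v : ι) (I : Finset ι) : ℕ :=
  ((I.erase v).filter fun u => dist (x u) (x v) ≤ R).card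

/-- The Betti number in dimension `k - 2` of the Čech complex on the points of index in `I`. -/
def inducedBetti (x : ι → E) (r : ℝ) (k : ℕ) (I : Finset ι) : ℝ :=
  ((cechComplex x r).induce I).betti (k - 2)

/-- The hollow simplices with `k` vertices in `I`. -/
def holes (x : ι → E) (r : ℝ) (k : ℕ) (I : Finset ι) : Finset (Finset ι) :=
  open Classical in (I.powersetCard k).filter fun σ => (cechComplex x r).IsHole σ

/-- The difference of the Betti number and the number of hollow simplices. -/
def bettiExcess (x : ι → E) (r : ℝ) (k : ℕ) (I : Finset ι) : ℝ :=
  inducedBetti x r k I - (holes x r k I).card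

lemma mem_holes {I σ : Finset ι} :
    σ ∈ holes x r k I ↔ σ ⊆ I ∧ σ.card = k ∧ (cechComplex x r).IsHole σ := by
  simp [holes, Finset.mem_powersetCard, and_assoc]

lemma nearCount_mono (x : ι → E) (R : ℝ) (v : ι) {I J : Finset ι} (h : I ⊆ J) :
    nearCount x R v I ≤ nearCount x R v J :=
  Finset.card_le_card (Finset.filter_subset_filter _ (Finset.erase_subset_erase _ h))

/-- With three or more vertices, any two of them lie in the facet opposite to a third, and that
facet is a face. -/
lemma dist_le_of_isHole {σ : Finset ι} (h : (cechComplex x r).IsHole σ) (hc : 3 ≤ σ.card)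
    {u v : ι} (hu : u ∈ σ) (hv : v ∈ σ) : dist (x u) (x v) ≤ 2 * r := by
  have : ∃ w ∈ σ, w ∉ ({u, v} : Finset ι) := by
    by_contra hcon
    push Not at hcon
    have h1 := Finset.card_le_card (show σ ⊆ {u, v} from hcon)
    have h2 := Finset.card_le_two (a := u) (b := v)
    omega
  obtain ⟨w, hw, hwn⟩ := this
  simp only [Finset.mem_insert, Finset.mem_singleton, not_or] at hwn
  exact dist_le_of_mem_cechComplex (h.2 w hw) (Finset.mem_erase.2 ⟨Ne.symm hwn.1, hu⟩)
    (Finset.mem_erase.2 ⟨Ne.symm hwn.2, hv⟩)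

lemma isHole_induce_iff {K : PreAbstractSimplicialComplex ι} {I σ : Finset ι} (h : σ ⊆ I) :
    (K.induce I).IsHole σ ↔ K.IsHole σ := by
  simp only [IsHole, mem_induce, h, and_true, (Finset.erase_subset _ σ).trans h]

lemma inducedBetti_congr {x' : ι → E} {I : Finset ι} (h : ∀ i ∈ I, x i = x' i) :
    inducedBetti x r k I = inducedBetti x' r k I := by
  rw [inducedBetti, inducedBetti, induce_congr h]

lemma isHole_congr {x' : ι → E} {σ : Finset ι} (h : ∀ i ∈ σ, x i = x' i) :
    (cechComplex x r).IsHole σ ↔ (cechComplex x' r).IsHole σ := by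
  rw [← isHole_induce_iff subset_rfl, ← isHole_induce_iff (K := cechComplex x' r) subset_rfl,
    induce_congr h]

lemma holes_congr {x' : ι → E} {I : Finset ι} (h : ∀ i ∈ I, x i = x' i) :
    holes x r k I = holes x' r k I := by
  ext σ
  rw [mem_holes, mem_holes]
  exact and_congr_right fun hσ => and_congr_right fun _ => isHole_congr fun i hi => h i (hσ hi)

lemma bettiExcess_congr {x' : ι → E} {I : Finset ι} (h : ∀ i ∈ I, x i = x' i) :
    bettiExcess x r k I = bettiExcess x' r k I := by
  rw [bettiExcess, bettiExcess, inducedBetti_congr h, holes_congr h]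

/-- A face containing `v` consists of `v` and near points. -/
lemma subset_near {R : ℝ} {I σ : Finset ι} {v : ι} (hσ : σ ⊆ I)
    (h : ∀ u ∈ σ, dist (x u) (x v) ≤ R) :
    σ.erase v ⊆ (I.erase v).filter fun u => dist (x u) (x v) ≤ R := by
  intro u hu
  obtain ⟨h1, h2⟩ := Finset.mem_erase.1 hu
  exact Finset.mem_filter.2 ⟨Finset.mem_erase.2 ⟨h1, hσ h2⟩, h u h2⟩

/-- A hollow simplex through `v` is determined by its other `k - 1` vertices, all of them near `v`.
-/
lemma card_holes_mem_le (hk : 3 ≤ k) {R : ℝ} (hR : 2 * r ≤ R) (v : ι) (I : Finset ι) :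
    (((holes x r k I).filter fun σ => v ∈ σ).card : ℝ)
      ≤ thresholdPow k (k - 1) (nearCount x R v I) := by
  refine le_trans ?_ (choose_le_thresholdPow (nearCount x R v I) (k - 1) (Nat.sub_le k 1))
  rw [nearCount, ← Finset.card_powersetCard]
  norm_cast
  refine Finset.card_le_card_of_injOn (fun σ => σ.erase v) ?_ ?_
  · intro σ hσ
    obtain ⟨h1, h2⟩ := Finset.mem_filter.1 hσ
    obtain ⟨h3, h4, h5⟩ := mem_holes.1 h1
    refine Finset.mem_powersetCard.2 ⟨subset_near h3 fun u hu => ?_, ?_⟩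
    · exact (dist_le_of_isHole h5 (by omega) hu h2).trans hR
    · rw [Finset.card_erase_of_mem h2, h4]
  · intro σ hσ τ hτ e
    rw [← Finset.insert_erase (Finset.mem_filter.1 hσ).2,
      ← Finset.insert_erase (Finset.mem_filter.1 hτ).2]
    simp only at e
    rw [e]

lemma sum_holes_le_sum_sum (hk : 0 < k) {I : Finset ι} {F : Finset ι → ℝ} (hF : ∀ σ, 0 ≤ F σ) :
    ∑ σ ∈ holes x r k I, F σ ≤ ∑ v ∈ I, ∑ σ ∈ (holes x r k I).filter (fun σ => v ∈ σ), F σ := by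
  simp_rw [Finset.sum_filter]
  rw [Finset.sum_comm]
  refine Finset.sum_le_sum fun σ hσ => ?_
  obtain ⟨h1, h2, -⟩ := mem_holes.1 hσ
  obtain ⟨v, hv⟩ : σ.Nonempty := Finset.card_pos.1 (by omega)
  refine le_trans (le_of_eq (if_pos hv).symm)
    (Finset.single_le_sum (f := fun v => if v ∈ σ then F σ else 0) (fun u _ => ?_) (h1 hv))
  split_ifs
  · exact hF σ
  · exact le_rfl

lemma card_holes_le (hk : 3 ≤ k) {R : ℝ} (hR : 2 * r ≤ R) (I : Finset ι) :
    ((holes x r k I).card : ℝ) ≤ ∑ v ∈ I, thresholdPow k (k - 1) (nearCount x R v I) := by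
  refine le_trans ?_ (Finset.sum_le_sum fun v _ => card_holes_mem_le hk hR v I)
  have := sum_holes_le_sum_sum (x := x) (r := r) (by omega : 0 < k) (I := I) (F := fun _ => 1)
    (fun _ => zero_le_one)
  simpa using this

/-- A hollow simplex has diameter at most `2 * r`, so it cannot straddle the two sets. -/
lemma card_holes_add (hk : 3 ≤ k) {A I : Finset ι} (hA : A ⊆ I)
    (h : ∀ u ∈ A, ∀ w ∈ I \ A, 2 * r < dist (x u) (x w)) :
    (holes x r k I).card = (holes x r k A).card + (holes x r k (I \ A)).card := by
  rw [← Finset.card_union_of_disjoint]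
  · congr 1
    ext σ
    rw [Finset.mem_union, mem_holes, mem_holes, mem_holes]
    constructor
    · rintro ⟨hI, hc, hσ⟩
      by_cases hsub : σ ⊆ A
      · exact Or.inl ⟨hsub, hc, hσ⟩
      · refine Or.inr ⟨fun w hw => Finset.mem_sdiff.2 ⟨hI hw, fun hwA => ?_⟩, hc, hσ⟩
        obtain ⟨u, hu, huA⟩ := Finset.not_subset.1 hsub
        exact absurd (dist_le_of_isHole hσ (by omega) hw hu)
          (not_le.2 (h w hwA u (Finset.mem_sdiff.2 ⟨hI hu, huA⟩)))
    · rintro (⟨h1, h2⟩ | ⟨h1, h2⟩)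
      · exact ⟨h1.trans hA, h2⟩
      · exact ⟨h1.trans Finset.sdiff_subset, h2⟩
  · rw [Finset.disjoint_left]
    intro σ h1 h2
    rw [mem_holes] at h1 h2
    obtain ⟨u, hu⟩ : σ.Nonempty := Finset.card_pos.1 (by omega)
    exact (Finset.mem_sdiff.1 (h2.1 hu)).2 (h1.1 hu)

/-- If fewer than `k` other points are within `2 * r * k` of a point, then its component has at
most `k` points. -/
lemma exists_separated_set (hr : 0 ≤ r) {I : Finset ι} {v : ι} (hv : v ∈ I)
    (hN : nearCount x (2 * r * k) v I < k) :
    ∃ A ⊆ I, v ∈ A ∧ A.card ≤ k ∧ ∀ u ∈ A, ∀ w ∈ I \ A, 2 * r < dist (x u) (x w) := by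
  -- The sets of points within `2 * r * j` of `v` increase with `j`, the first contains `v` and the
  -- `k`-th has at most `k` points. So they fail to grow at some step `j < k`, and `A j` then has no
  -- edge to the outside.
  let A : ℕ → Finset ι := fun j => I.filter fun u => dist (x u) (x v) ≤ 2 * r * j
  have hvA : ∀ j, v ∈ A j := fun j => Finset.mem_filter.2 ⟨hv, by rw [dist_self]; positivity⟩
  have hmono : ∀ i j, i ≤ j → A i ⊆ A j := by
    intro i j hij u hu
    rw [Finset.mem_filter] at hu ⊢
    refine ⟨hu.1, hu.2.trans ?_⟩
    have : (i : ℝ) ≤ j := by exact_mod_cast hij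
    gcongr
  have hcard : (A k).card ≤ k := by
    have : A k = insert v ((I.erase v).filter fun u => dist (x u) (x v) ≤ 2 * r * k) := by
      ext u
      simp only [A, Finset.mem_filter, Finset.mem_insert, Finset.mem_erase]
      constructor
      · rintro ⟨h1, h2⟩
        by_cases e : u = v
        · exact Or.inl e
        · exact Or.inr ⟨⟨e, h1⟩, h2⟩
      · rintro (rfl | ⟨⟨_, h1⟩, h2⟩)
        · exact Finset.mem_filter.1 (hvA k)
        · exact ⟨h1, h2⟩
    rw [this]
    refine (Finset.card_insert_le _ _).trans ?_
    exact hN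
  obtain ⟨j, hj, hjA⟩ : ∃ j < k, A (j + 1) ⊆ A j := by
    by_contra hcon
    push Not at hcon
    have : ∀ j ≤ k, j + 1 ≤ (A j).card := by
      intro j
      induction j with
      | zero => intro _; exact Finset.card_pos.2 ⟨v, hvA 0⟩
      | succ j ih =>
        intro hj
        have h1 := Finset.card_lt_card
          (Finset.ssubset_iff_subset_ne.2 ⟨hmono j (j + 1) (Nat.le_succ j), fun e =>
            hcon j hj (e ▸ subset_rfl)⟩)
        have := ih (by omega)
        omega
    have := this k le_rfl
    omega
  refine ⟨A j, Finset.filter_subset _ _, hvA j,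
    (Finset.card_le_card (hmono j k hj.le)).trans hcard, fun u hu w hw => ?_⟩
  by_contra hle
  push Not at hle
  rw [Finset.mem_sdiff] at hw
  refine hw.2 (hjA (Finset.mem_filter.2 ⟨hw.1, ?_⟩))
  have h1 := (Finset.mem_filter.1 hu).2
  have h2 := dist_triangle_left (x w) (x v) (x u)
  push_cast
  linarith

variable [Finite ι]

/-- The faces lost in the two relevant dimensions contain `v` and otherwise only near points. By
Pascal's rule their number is at most `(N + 1).choose (k - 1)`, where N is the neighbour count; this
vanishes for N = 0 because `k ≥ 3`. -/
lemma abs_inducedBetti_sub_erase_le (hk : 3 ≤ k) {R : ℝ} (hR : 2 * r ≤ R) (v : ι)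
    (I : Finset ι) :
    |inducedBetti x r k I - inducedBetti x r k (I.erase v)|
      ≤ thresholdPow k 1 (nearCount x R v I) := by
  set S := (I.erase v).filter fun u => dist (x u) (x v) ≤ R with hS
  have hT := abs_betti_sub_betti_le (K := (cechComplex x r).induce I)
    (L := (cechComplex x r).induce (I.erase v)) (j := k - 2)
    (fun σ hσ => ⟨hσ.1, hσ.2.trans (Finset.erase_subset _ _)⟩)
    (T := (S.powersetCard (k - 2)).image (insert v) ∪ (S.powersetCard (k - 1)).image (insert v)) (by
      rintro σ ⟨hσ, hσI⟩ hσn hcard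
      have hvσ : v ∈ σ := by
        by_contra hv
        exact hσn ⟨hσ, Finset.subset_erase.2 ⟨hσI, hv⟩⟩
      have hsub : σ.erase v ⊆ S := subset_near hσI fun u hu =>
        (dist_le_of_mem_cechComplex hσ hu hvσ).trans hR
      have hce := Finset.card_erase_of_mem hvσ
      rw [Finset.mem_union, Finset.mem_image, Finset.mem_image]
      rcases hcard with hc | hc
      · exact Or.inl ⟨σ.erase v, Finset.mem_powersetCard.2 ⟨hsub, by omega⟩,
          Finset.insert_erase hvσ⟩
      · exact Or.inr ⟨σ.erase v, Finset.mem_powersetCard.2 ⟨hsub, by omega⟩,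
          Finset.insert_erase hvσ⟩)
  refine hT.trans ?_
  have h1 : (((S.powersetCard (k - 2)).image (insert v) ∪
      (S.powersetCard (k - 1)).image (insert v)).card : ℝ) ≤
      ((nearCount x R v I + 1).choose (k - 1) : ℕ) := by
    norm_cast
    refine (Finset.card_union_le _ _).trans ?_
    refine (Nat.add_le_add Finset.card_image_le Finset.card_image_le).trans ?_
    rw [Finset.card_powersetCard, Finset.card_powersetCard, nearCount, ← hS,
      show k - 1 = k - 2 + 1 by omega, Nat.choose_succ_succ]
  refine h1.trans ?_
  unfold thresholdPow
  split_ifs with hN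
  · calc (((nearCount x R v I + 1).choose (k - 1) : ℕ) : ℝ)
        ≤ ((nearCount x R v I + 1 : ℕ) : ℝ) ^ (k - 1) := by exact_mod_cast Nat.choose_le_pow _ _
      _ = (1 + nearCount x R v I : ℝ) ^ (k - 1) := by push_cast; ring
      _ ≤ _ := by
          gcongr
          · linarith [(Nat.cast_nonneg (nearCount x R v I) : (0 : ℝ) ≤ _)]
          · omega
  · rw [Nat.choose_eq_zero_of_lt (by omega)]; simp

/-- Betti numbers add up over two sets of points with no edge in between. -/
lemma inducedBetti_add {A I : Finset ι} (hA : A ⊆ I)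
    (h : ∀ u ∈ A, ∀ w ∈ I \ A, 2 * r < dist (x u) (x w)) :
    inducedBetti x r k I = inducedBetti x r k A + inducedBetti x r k (I \ A) := by
  rw [inducedBetti, betti_add (K := (cechComplex x r).induce I)
    (L₁ := (cechComplex x r).induce A) (L₂ := (cechComplex x r).induce (I \ A))]
  · push_cast; rfl
  · intro σ
    simp only [mem_induce]
    constructor
    · rintro ⟨hσ, hI⟩
      by_cases hsub : σ ⊆ A
      · exact Or.inl ⟨hσ, hsub⟩
      · refine Or.inr ⟨hσ, fun w hw => Finset.mem_sdiff.2 ⟨hI hw, fun hwA => ?_⟩⟩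
        obtain ⟨u, hu, huA⟩ := Finset.not_subset.1 hsub
        exact absurd (dist_le_of_mem_cechComplex hσ hw hu)
          (not_le.2 (h w hwA u (Finset.mem_sdiff.2 ⟨hI hu, huA⟩)))
    · rintro (⟨h1, h2⟩ | ⟨h1, h2⟩)
      · exact ⟨h1, h2.trans hA⟩
      · exact ⟨h1, h2.trans Finset.sdiff_subset⟩
  · rintro σ ⟨h1, h2⟩ ⟨_, h3⟩
    obtain ⟨u, hu⟩ := nonempty_of_mem h1
    exact (Finset.mem_sdiff.1 (h3 hu)).2 (h2 hu)

lemma bettiExcess_add (hk : 3 ≤ k) {A I : Finset ι} (hA : A ⊆ I)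
    (h : ∀ u ∈ A, ∀ w ∈ I \ A, 2 * r < dist (x u) (x w)) :
    bettiExcess x r k I = bettiExcess x r k A + bettiExcess x r k (I \ A) := by
  rw [bettiExcess, bettiExcess, bettiExcess, inducedBetti_add hA h, card_holes_add hk hA h]
  push_cast; ring

/-- Only `A` itself can be a hollow simplex with `k` vertices, and by `betti_of_card_le` it is also
the only possible source of homology. -/
lemma inducedBetti_of_card_le (hk : 3 ≤ k) {A : Finset ι} (hA : A.card ≤ k) :
    inducedBetti x r k A = (holes x r k A).card := by
  classical
  rw [inducedBetti, betti_of_card_le (K := (cechComplex x r).induce A) (A := A) (by omega)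
    (by omega) fun σ hσ => hσ.2,
    isHole_induce_iff subset_rfl, show k - 2 + 2 = k by omega]
  norm_cast
  split_ifs with h
  · symm
    rw [Finset.card_eq_one]
    refine ⟨A, ?_⟩
    ext σ
    rw [mem_holes, Finset.mem_singleton]
    constructor
    · rintro ⟨h1, h2, -⟩
      exact Finset.eq_of_subset_of_card_le h1 (by omega)
    · rintro rfl
      exact ⟨subset_rfl, h⟩
  · symm
    rw [Finset.card_eq_zero, Finset.eq_empty_iff_forall_notMem]
    intro σ hσ
    rw [mem_holes] at hσ
    obtain rfl := Finset.eq_of_subset_of_card_le hσ.1 (by omega)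
    exact h hσ.2

lemma bettiExcess_of_card_le (hk : 3 ≤ k) {A : Finset ι} (hA : A.card ≤ k) :
    bettiExcess x r k A = 0 := by
  rw [bettiExcess, inducedBetti_of_card_le hk hA, sub_self]

/-- A separated set of at most `k` points around `v` has zero excess with or without `v`, and the
rest of the complex is unaffected. This locality makes the excess smaller by a factor `n * p` than
the hole count. -/
lemma bettiExcess_erase (hk : 3 ≤ k) (hr : 0 ≤ r) {I : Finset ι} {v : ι} (hv : v ∈ I)
    (hN : nearCount x (2 * r * k) v I < k) :
    bettiExcess x r k (I.erase v) = bettiExcess x r k I := by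
  obtain ⟨A, hAI, hvA, hcard, hsep⟩ := exists_separated_set hr hv hN
  have hd : I.erase v \ A.erase v = I \ A := by
    ext u
    simp only [Finset.mem_sdiff, Finset.mem_erase]
    constructor
    · rintro ⟨⟨h1, h2⟩, h3⟩; exact ⟨h2, fun h => h3 ⟨h1, h⟩⟩
    · rintro ⟨h1, h2⟩; exact ⟨⟨fun e => h2 (e ▸ hvA), h1⟩, fun h => h2 h.2⟩
  rw [bettiExcess_add hk hAI hsep, bettiExcess_add hk (Finset.erase_subset_erase v hAI)
    (fun u hu w hw => hsep u (Finset.mem_of_mem_erase hu) w (hd ▸ hw)), hd,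
    bettiExcess_of_card_le hk hcard,
    bettiExcess_of_card_le hk ((Finset.card_le_card (Finset.erase_subset _ _)).trans hcard)]

lemma two_mul_le_two_mul_mul (hk : 3 ≤ k) (hr : 0 ≤ r) : 2 * r ≤ 2 * r * k := by
  have : (3 : ℝ) ≤ k := by exact_mod_cast hk
  nlinarith

lemma abs_bettiExcess_sub_erase_le (hk : 3 ≤ k) (hr : 0 ≤ r) (I : Finset ι) (v : ι) :
    |bettiExcess x r k I - bettiExcess x r k (I.erase v)|
      ≤ 2 * thresholdPow k k (nearCount x (2 * r * k) v I) := by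
  by_cases hv : v ∈ I
  swap
  · rw [Finset.erase_eq_of_notMem hv, sub_self, abs_zero]
    exact mul_nonneg zero_le_two (thresholdPow_nonneg _ _ _)
  set N := nearCount x (2 * r * k) v I with hNdef
  rcases lt_or_ge N k with hN | hN
  · rw [bettiExcess_erase hk hr hv hN, sub_self, abs_zero]
    exact mul_nonneg zero_le_two (thresholdPow_nonneg _ _ _)
  · have hR := two_mul_le_two_mul_mul hk hr
    have h1 := abs_inducedBetti_sub_erase_le (x := x) hk hR v I
    have h2 := card_holes_mem_le (x := x) hk hR v I
    have h3 : (holes x r k (I.erase v)) = (holes x r k I).filter fun σ => v ∉ σ := by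
      ext σ
      rw [Finset.mem_filter, mem_holes, mem_holes, Finset.subset_erase]
      tauto
    have h4 := Finset.card_filter_add_card_filter_not (s := holes x r k I) (fun σ => v ∈ σ)
    rw [← h3] at h4
    have h4' : (((holes x r k I).filter fun σ => v ∈ σ).card : ℝ) + (holes x r k (I.erase v)).card
      = (holes x r k I).card := by exact_mod_cast h4
    -- Once `N ≥ k` the cutoffs at `1`, `k - 1` and `k` are all passed, so the three truncated
    -- powers coincide.
    have e1 : thresholdPow k 1 N = thresholdPow k k N := by
      rw [thresholdPow, thresholdPow, if_pos hN, if_pos (by omega)]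
    have e2 : thresholdPow k (k - 1) N = thresholdPow k k N := by
      rw [thresholdPow, thresholdPow, if_pos hN, if_pos (by omega)]
    rw [← hNdef, e1] at h1
    rw [← hNdef, e2] at h2
    have h5 : (0 : ℝ) ≤ (((holes x r k I).filter fun σ => v ∈ σ).card : ℝ) := by positivity
    rw [bettiExcess, bettiExcess]
    rw [abs_le] at h1 ⊢
    constructor <;> linarith [h1.1, h1.2]

/-- Delete the points one by one down to the empty set, whose excess is zero; the neighbour counts
only decrease on the way. -/
lemma abs_bettiExcess_le (hk : 3 ≤ k) (hr : 0 ≤ r) (I : Finset ι) :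
    |bettiExcess x r k I| ≤ ∑ v ∈ I, 2 * thresholdPow k k (nearCount x (2 * r * k) v I) := by
  induction I using Finset.induction_on with
  | empty => rw [bettiExcess_of_card_le hk (by simp)]; simp
  | insert v I hv ih =>
    have h1 := abs_bettiExcess_sub_erase_le (x := x) hk hr (insert v I) v
    rw [Finset.erase_insert hv] at h1
    rw [Finset.sum_insert hv]
    have h2 : ∑ u ∈ I, 2 * thresholdPow k k (nearCount x (2 * r * k) u I) ≤
        ∑ u ∈ I, 2 * thresholdPow k k (nearCount x (2 * r * k) u (insert v I)) := by
      refine Finset.sum_le_sum fun u _ => mul_le_mul_of_nonneg_left ?_ zero_le_two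
      exact thresholdPow_mono _ _ (nearCount_mono x _ u (Finset.subset_insert v I))
    have h3 := abs_sub_abs_le_abs_sub (bettiExcess x r k (insert v I)) (bettiExcess x r k I)
    linarith

lemma abs_inducedBetti_sub_sdiff_le (hk : 3 ≤ k) {R : ℝ} (hR : 2 * r ≤ R) (I σ : Finset ι) :
    |inducedBetti x r k I - inducedBetti x r k (I \ σ)|
      ≤ ∑ v ∈ σ, thresholdPow k 1 (nearCount x R v I) := by
  induction σ using Finset.induction_on with
  | empty => simp
  | insert v σ hv ih =>
    have h1 := abs_inducedBetti_sub_erase_le (x := x) hk hR v (I \ σ)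
    rw [← Finset.sdiff_insert] at h1
    have h2 := thresholdPow_mono k 1 (nearCount_mono x R v (Finset.sdiff_subset : I \ σ ⊆ I))
    rw [Finset.sum_insert hv]
    have h3 := abs_sub_le (inducedBetti x r k I) (inducedBetti x r k (I \ σ))
      (inducedBetti x r k (I \ insert v σ))
    linarith

/-- Removing the vertices of a hollow simplex lowers the Betti number by one, unless other points
are near. -/
lemma abs_inducedBetti_sub_hole_le (hk : 3 ≤ k) {R : ℝ} (hr : 0 ≤ r) (hR : 4 * r ≤ R)
    {I σ : Finset ι} (hσ : σ ∈ holes x r k I) {v : ι} (hv : v ∈ σ) :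
    |inducedBetti x r k I - (1 + inducedBetti x r k (I \ σ))|
      ≤ 2 ^ (k + 1) * thresholdPow k k (nearCount x R v I) := by
  obtain ⟨hσI, hcard, hhole⟩ := mem_holes.1 hσ
  set S := (I.erase v).filter fun u => dist (x u) (x v) ≤ R with hS
  have hSc : nearCount x R v I = S.card := rfl
  have hd : ∀ u ∈ σ, dist (x u) (x v) ≤ 2 * r := fun u hu =>
    dist_le_of_isHole hhole (by omega) hu hv
  have hsub : σ.erase v ⊆ S := subset_near hσI fun u hu => (hd u hu).trans (by linarith)
  have hce : (σ.erase v).card = k - 1 := by rw [Finset.card_erase_of_mem hv, hcard]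
  -- With fewer than `k` near points these are exactly the other vertices of `σ`. Anything within `2
  -- * r` of `σ` would be within `4 * r ≤ R` of `v`, so `σ` is a component with Betti number one.
  rcases lt_or_ge S.card k with hN | hN
  · have hS' : S = σ.erase v :=
      (Finset.eq_of_subset_of_card_le hsub (by omega)).symm
    have hsep : ∀ u ∈ σ, ∀ w ∈ I \ σ, 2 * r < dist (x u) (x w) := by
      intro u hu w hw
      by_contra hle
      push Not at hle
      rw [Finset.mem_sdiff] at hw
      have : w ∈ S := by
        refine Finset.mem_filter.2 ⟨Finset.mem_erase.2 ⟨fun e => hw.2 (e ▸ hv), hw.1⟩, ?_⟩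
        linarith [dist_triangle_left (x w) (x v) (x u), hd u hu]
      rw [hS'] at this
      exact hw.2 (Finset.mem_of_mem_erase this)
    have h1 : (holes x r k σ) = {σ} := by
      ext τ
      rw [mem_holes, Finset.mem_singleton]
      constructor
      · rintro ⟨h1, h2, -⟩
        exact Finset.eq_of_subset_of_card_le h1 (by omega)
      · rintro rfl
        exact ⟨subset_rfl, hcard, hhole⟩
    rw [inducedBetti_add hσI hsep, inducedBetti_of_card_le hk hcard.le, h1,
      Finset.card_singleton, Nat.cast_one, sub_self, abs_zero]
    exact mul_nonneg (by positivity) (thresholdPow_nonneg _ _ _)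
  · have hT := abs_betti_sub_betti_le (K := (cechComplex x r).induce I)
      (L := (cechComplex x r).induce (I \ σ)) (j := k - 2)
      (fun σ hσ => ⟨hσ.1, hσ.2.trans Finset.sdiff_subset⟩)
      (T := ((insert v S).powersetCard (k - 1)) ∪ ((insert v S).powersetCard k)) (by
        rintro τ ⟨hτ, hτI⟩ hτn hcardτ
        obtain ⟨u, hu, huσ⟩ : ∃ u ∈ τ, u ∈ σ := by
          by_contra hcon
          push Not at hcon
          exact hτn ⟨hτ, fun u hu => Finset.mem_sdiff.2 ⟨hτI hu, hcon u hu⟩⟩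
        have hsub : τ ⊆ insert v S := by
          intro w hw
          rw [Finset.mem_insert]
          by_cases e : w = v
          · exact Or.inl e
          · refine Or.inr (Finset.mem_filter.2 ⟨Finset.mem_erase.2 ⟨e, hτI hw⟩, ?_⟩)
            linarith [dist_triangle (x w) (x u) (x v), hd u huσ,
              dist_le_of_mem_cechComplex hτ hw hu]
        rw [Finset.mem_union, Finset.mem_powersetCard, Finset.mem_powersetCard]
        rcases hcardτ with h | h
        · exact Or.inl ⟨hsub, by omega⟩
        · exact Or.inr ⟨hsub, by omega⟩)
    have hins : (insert v S).card = S.card + 1 :=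
      Finset.card_insert_of_notMem (by simp [hS])
    -- The two binomials add up to `(S.card + 2).choose k`. The remaining `1` is absorbed afterwards
    -- by doubling, which accounts for `2 ^ (k + 1)`.
    have hc : ((((insert v S).powersetCard (k - 1)) ∪ ((insert v S).powersetCard k)).card : ℝ)
        ≤ (2 * (1 + S.card : ℝ)) ^ k := by
      have h1 : (((insert v S).powersetCard (k - 1)) ∪ ((insert v S).powersetCard k)).card
          ≤ (S.card + 2) ^ k := by
        refine (Finset.card_union_le _ _).trans ?_
        rw [Finset.card_powersetCard, Finset.card_powersetCard, hins]
        refine le_trans (le_of_eq ?_) (Nat.choose_le_pow (S.card + 2) k)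
        obtain ⟨k', rfl⟩ : ∃ k', k = k' + 1 := ⟨k - 1, by omega⟩
        rw [Nat.add_sub_cancel, ← Nat.choose_succ_succ]
      calc _ ≤ (((S.card + 2) ^ k : ℕ) : ℝ) := by exact_mod_cast h1
        _ = ((S.card : ℝ) + 2) ^ k := by push_cast; rfl
        _ ≤ _ := by
          gcongr
          linarith [(Nat.cast_nonneg S.card : (0 : ℝ) ≤ _)]
    have hT' : |inducedBetti x r k I - inducedBetti x r k (I \ σ)| ≤ (2 * (1 + S.card : ℝ)) ^ k :=
      hT.trans hc
    have h1 : (1 : ℝ) ≤ (2 * (1 + S.card : ℝ)) ^ k := by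
      apply one_le_pow₀
      linarith [(Nat.cast_nonneg S.card : (0 : ℝ) ≤ _)]
    rw [hSc, thresholdPow, if_pos hN, pow_succ, mul_assoc, mul_comm (2 : ℝ), ← mul_assoc, ← mul_pow]
    have h2 := abs_sub_le (inducedBetti x r k I) (inducedBetti x r k (I \ σ))
      (1 + inducedBetti x r k (I \ σ))
    rw [show inducedBetti x r k (I \ σ) - (1 + inducedBetti x r k (I \ σ)) = -1 by ring,
      abs_neg, abs_one] at h2
    linarith

/-- Assign the holes to their vertices: at most `(1 + N) ^ k` of them pass through a given vertex
with neighbour count N, which raises the exponent from `k` to `k + k` and keeps the cutoff. -/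
lemma sum_holes_abs_inducedBetti_sub_le (hk : 3 ≤ k) {R : ℝ} (hr : 0 ≤ r) (hR : 4 * r ≤ R)
    (I : Finset ι) :
    ∑ σ ∈ holes x r k I, |inducedBetti x r k I - (1 + inducedBetti x r k (I \ σ))|
      ≤ ∑ v ∈ I, 2 ^ (k + 1) * thresholdPow (k + k) k (nearCount x R v I) := by
  refine (sum_holes_le_sum_sum (by omega) fun σ => abs_nonneg _).trans ?_
  refine Finset.sum_le_sum fun v _ => ?_
  have h1 : ∀ σ ∈ (holes x r k I).filter (fun σ => v ∈ σ),
      |inducedBetti x r k I - (1 + inducedBetti x r k (I \ σ))|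
        ≤ 2 ^ (k + 1) * thresholdPow k k (nearCount x R v I) := fun σ hσ =>
    abs_inducedBetti_sub_hole_le hk hr hR (Finset.mem_filter.1 hσ).1 (Finset.mem_filter.1 hσ).2
  refine (Finset.sum_le_card_nsmul _ _ _ h1).trans ?_
  rw [nsmul_eq_mul, ← thresholdPow_mul]
  have h2 := card_holes_mem_le (x := x) (r := r) hk (by linarith : 2 * r ≤ R) v I
  have h3 := thresholdPow_le_of_le k (Nat.zero_le (k - 1)) (nearCount x R v I)
  rw [thresholdPow_zero] at h3
  have h4 := thresholdPow_nonneg k k (nearCount x R v I)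
  calc _ ≤ (1 + nearCount x R v I : ℝ) ^ k * (2 ^ (k + 1) * thresholdPow k k (nearCount x R v I)) :=
        mul_le_mul_of_nonneg_right (h2.trans h3) (by positivity)
    _ = _ := by ring

end Cech

/-! ### Measurability of the random complex -/

section Measurability

/-- On a finite vertex set there are finitely many complexes, so every function of the complex is
measurable and bounded. All measurability and integrability questions thus reduce to
`measurable_cechComplex`. -/
instance {ι : Type*} : MeasurableSpace (PreAbstractSimplicialComplex ι) := ⊤

instance {ι : Type*} : DiscreteMeasurableSpace (PreAbstractSimplicialComplex ι) :=
  ⟨fun _ => trivial⟩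

instance {ι : Type*} [Finite ι] : Finite (PreAbstractSimplicialComplex ι) :=
  have : Finite (Set (Finset ι)) := inferInstance
  Finite.of_injective (fun K : PreAbstractSimplicialComplex ι => K.faces)
    fun _ _ h => PreAbstractSimplicialComplex.ext h

lemma integrable_comp_of_finite {Ω T : Type*} [MeasurableSpace Ω] [Finite T] [MeasurableSpace T]
    [DiscreteMeasurableSpace T] {P : Measure Ω} [IsFiniteMeasure P] {h : Ω → T}
    (hh : Measurable h) (F : T → ℝ) : Integrable (fun ω => F (h ω)) P := by
  obtain ⟨C, hC⟩ := (Set.finite_range fun t => ‖F t‖).bddAbove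
  refine Integrable.of_bound ((Measurable.of_discrete (f := F)).comp hh).aestronglyMeasurable C ?_
  exact Filter.Eventually.of_forall fun ω => hC ⟨h ω, rfl⟩

variable {ι E : Type*}

/-- If the balls have no common point, the total excess distance `F` is positive everywhere and, by
compactness, bounded below where a common point could appear. A small displacement of the centers
cannot create one. -/
lemma isClosed_setOf_mem_cechComplex [PseudoMetricSpace E] [ProperSpace E] (r : ℝ) (σ : Finset ι) :
    IsClosed {x : ι → E | σ ∈ cechComplex x r} := by
  rcases σ.eq_empty_or_nonempty with rfl | ⟨i₀, hi₀⟩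
  · convert isClosed_empty
    ext x
    simp only [Set.mem_ofPred_eq, Set.mem_empty_iff_false, iff_false]
    exact fun h => absurd h.1 (by simp)
  have hset : {x : ι → E | σ ∈ cechComplex x r} =
      {x : ι → E | ∃ p, ∀ i ∈ σ, dist p (x i) ≤ r} := by
    ext x
    constructor
    · rintro ⟨-, p, hp⟩
      exact ⟨p, fun i hi => Set.mem_iInter₂.1 hp i hi⟩
    · rintro ⟨p, hp⟩
      exact ⟨⟨i₀, hi₀⟩, p, Set.mem_iInter₂.2 fun i hi => hp i hi⟩
  rw [hset, ← isOpen_compl_iff, isOpen_iff_mem_nhds]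
  intro x hx
  have hx' : ∀ p : E, ∃ i ∈ σ, r < dist p (x i) := by
    intro p
    by_contra hcon
    push Not at hcon
    exact hx ⟨p, hcon⟩
  let F : E → ℝ := fun p => ∑ i ∈ σ, max (dist p (x i) - r) 0
  have hF : ∀ p, 0 < F p := by
    intro p
    obtain ⟨i, hi, h⟩ := hx' p
    refine Finset.sum_pos' (fun i _ => le_max_right _ _) ⟨i, hi, ?_⟩
    exact lt_max_of_lt_left (by linarith)
  have hFc : Continuous F := by fun_prop
  -- As `ε ≤ 1`, common points after displacement stay within `r + 1` of `x i₀`; the maximum with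
  -- `0` keeps the ball nonempty for negative `r`.
  obtain ⟨p₀, -, hp₀⟩ := (isCompact_closedBall (x i₀) (max (r + 1) 0)).exists_isMinOn
    ⟨x i₀, Metric.mem_closedBall_self (le_max_right _ _)⟩ hFc.continuousOn
  have hcpos : (0 : ℝ) < σ.card := by exact_mod_cast Finset.card_pos.2 ⟨i₀, hi₀⟩
  set ε := min 1 (F p₀ / (2 * σ.card)) with hε
  have hεpos : 0 < ε := lt_min one_pos (div_pos (hF p₀) (by positivity))
  have hnear : ∀ᶠ y in 𝓝 x, ∀ i ∈ σ, dist (y i) (x i) < ε := by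
    rw [σ.eventually_all]
    intro i _
    exact (continuous_apply i).continuousAt.eventually (Metric.ball_mem_nhds (x i) hεpos)
  filter_upwards [hnear] with y hy
  rintro ⟨p, hp⟩
  have hdist : ∀ i ∈ σ, dist p (x i) ≤ r + ε := fun i hi =>
    (dist_triangle p (y i) (x i)).trans (add_le_add (hp i hi) (hy i hi).le)
  have hpin : p ∈ Metric.closedBall (x i₀) (max (r + 1) 0) := by
    refine Metric.mem_closedBall.2 (le_trans (hdist i₀ hi₀) ?_)
    refine le_trans ?_ (le_max_left _ _)
    linarith [min_le_left 1 (F p₀ / (2 * σ.card))]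
  have h1 : F p₀ ≤ F p := hp₀ hpin
  have h2 : F p ≤ ∑ _i ∈ σ, ε := by
    refine Finset.sum_le_sum fun i hi => max_le ?_ hεpos.le
    linarith [hdist i hi]
  rw [Finset.sum_const, nsmul_eq_mul] at h2
  have h3 : (σ.card : ℝ) * ε ≤ F p₀ / 2 := by
    calc (σ.card : ℝ) * ε ≤ σ.card * (F p₀ / (2 * σ.card)) := by
          gcongr; exact min_le_right _ _
      _ = F p₀ / 2 := by field_simp
  linarith [hF p₀]

lemma measurable_cechComplex [Finite ι] [PseudoMetricSpace E] [ProperSpace E]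
    [SecondCountableTopology E] [MeasurableSpace E] [BorelSpace E] (r : ℝ) :
    Measurable fun x : ι → E => cechComplex x r := by
  have h1 : Measurable fun (x : ι → E) (σ : Finset ι) => σ ∈ cechComplex x r :=
    measurable_pi_lambda _ fun σ => measurableSet_setOfPred.1
      (isClosed_setOf_mem_cechComplex r σ).measurableSet
  intro S _
  have : (fun x : ι → E => cechComplex x r) ⁻¹' S =
      (fun (x : ι → E) (σ : Finset ι) => σ ∈ cechComplex x r) ⁻¹'
        ((fun (K : PreAbstractSimplicialComplex ι) (σ : Finset ι) => σ ∈ K) '' S) := by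
    ext x
    constructor
    · exact fun hx => ⟨_, hx, rfl⟩
    · rintro ⟨K, hK, e⟩
      have : K = cechComplex x r := SetLike.ext fun σ => iff_of_eq (congrFun e σ)
      rw [this] at hK
      exact hK
  rw [this]
  exact h1 (Set.toFinite _).measurableSet

end Measurability

/-! ### Moments of neighbour counts -/

section Moments

/-- Binomial coefficients of a count have easily bounded expectations. For `N ≤ 2 * (a + b)` the
first one is at least `1`, which suffices; for larger `N` the second has order `N ^ (a + b)`. -/
lemma thresholdPow_le_choose (a b N : ℕ) :
    thresholdPow a b N ≤ ((1 + 2 * (a + b) : ℝ) ^ a + 2 ^ (a + b) * (a + b).factorial) *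
      (N.choose b + N.choose (a + b)) := by
  have hc1 : (0 : ℝ) ≤ N.choose b := by positivity
  have hc2 : (0 : ℝ) ≤ N.choose (a + b) := by positivity
  have hA : (0 : ℝ) ≤ (1 + 2 * (a + b) : ℝ) ^ a := by positivity
  have hB : (0 : ℝ) ≤ 2 ^ (a + b) * ((a + b).factorial : ℝ) := by positivity
  unfold thresholdPow
  split_ifs with hN
  · rcases le_or_gt N (2 * (a + b)) with h | h
    · have h1 : (1 : ℝ) ≤ N.choose b := by exact_mod_cast Nat.choose_pos hN
      have h2 : (1 + N : ℝ) ^ a ≤ (1 + 2 * (a + b) : ℝ) ^ a := by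
        have : (N : ℝ) ≤ 2 * (a + b) := by exact_mod_cast h
        gcongr
      nlinarith [mul_nonneg hB hc1, mul_nonneg hB hc2, mul_nonneg hA hc2]
    · have h1 := Nat.pow_le_choose (α := ℝ) (a + b) N
      rw [div_le_iff₀ (by positivity), mul_comm] at h1
      have h2 : (1 + N : ℝ) ≤ 2 * ((N + 1 - (a + b) : ℕ) : ℝ) := by
        have : 1 + N ≤ 2 * (N + 1 - (a + b)) := by omega
        exact_mod_cast this
      have h3 : (1 + N : ℝ) ^ a ≤ 2 ^ (a + b) * ((a + b).factorial * N.choose (a + b)) := by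
        calc (1 + N : ℝ) ^ a ≤ (1 + N : ℝ) ^ (a + b) := by
              gcongr
              · linarith [(Nat.cast_nonneg N : (0 : ℝ) ≤ N)]
              · omega
          _ ≤ (2 * ((N + 1 - (a + b) : ℕ) : ℝ)) ^ (a + b) := by gcongr
          _ = 2 ^ (a + b) * ((N + 1 - (a + b) : ℕ) : ℝ) ^ (a + b) := by rw [mul_pow]
          _ ≤ _ := by gcongr
      nlinarith [mul_nonneg hB hc1, mul_nonneg hA hc1, mul_nonneg hA hc2]
  · positivity

variable {ι E : Type*} [PseudoMetricSpace E]

/-- The number of points of index in `J` at distance at most `R` from one of two centers. -/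
def pairCount (x : ι → E) (R : ℝ) (i i' : ι) (J : Finset ι) : ℕ :=
  (J.filter fun j => dist (x j) (x i) ≤ R ∨ dist (x j) (x i') ≤ R).card

lemma choose_pairCount (x : ι → E) (R : ℝ) (i i' : ι) (J : Finset ι) (s : ℕ) :
    ((pairCount x R i i' J).choose s : ℝ) = ∑ S ∈ J.powersetCard s,
      Set.indicator {x : ι → E | ∀ j ∈ S, dist (x j) (x i) ≤ R ∨ dist (x j) (x i') ≤ R}
        (fun _ => (1 : ℝ)) x := by
  classical
  simp_rw [Set.indicator_apply]
  rw [Finset.sum_boole, pairCount, ← Finset.card_powersetCard]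
  congr 2
  ext S
  simp only [Finset.mem_powersetCard, Finset.mem_filter, Set.mem_ofPred_eq]
  constructor
  · rintro ⟨h1, h2⟩
    exact ⟨⟨fun j hj => (Finset.mem_filter.1 (h1 hj)).1, h2⟩,
      fun j hj => (Finset.mem_filter.1 (h1 hj)).2⟩
  · rintro ⟨⟨h1, h2⟩, h3⟩
    exact ⟨fun j hj => Finset.mem_filter.2 ⟨h1 hj, h3 j hj⟩, h2⟩

variable [SecondCountableTopology E] [MeasurableSpace E] [BorelSpace E]

lemma measurableSet_near (R : ℝ) (i i' : ι) (S : Finset ι) :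
    MeasurableSet {x : ι → E | ∀ j ∈ S, dist (x j) (x i) ≤ R ∨ dist (x j) (x i') ≤ R} := by
  have : {x : ι → E | ∀ j ∈ S, dist (x j) (x i) ≤ R ∨ dist (x j) (x i') ≤ R} =
      ⋂ j ∈ S, ({x | dist (x j) (x i) ≤ R} ∪ {x | dist (x j) (x i') ≤ R}) := by
    ext x; simp
  rw [this]
  refine Finset.measurableSet_biInter S fun j _ => MeasurableSet.union ?_ ?_
  · exact measurableSet_le (by fun_prop) measurable_const
  · exact measurableSet_le (by fun_prop) measurable_const

lemma measurable_nearRelation (R : ℝ) :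
    Measurable fun (x : ι → E) (p : ι × ι) => dist (x p.1) (x p.2) ≤ R :=
  measurable_pi_lambda _ fun _ => measurableSet_setOfPred.1
    (measurableSet_le (by fun_prop) measurable_const)

variable [Fintype ι]

/-- Given the coordinates outside `q`, which include both centers, the others are independent and
each falls into a union of two balls of mass at most `2 * p`. -/
lemma measure_forall_near_le {μ : Measure E} [IsProbabilityMeasure μ] {R : ℝ} {p : ENNReal}
    (hp : ∀ y, μ (Metric.closedBall y R) ≤ p) {i i' : ι} {q : ι → Prop} [DecidablePred q]
    (hi : ¬ q i) (hi' : ¬ q i') :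
    Measure.pi (fun _ : ι => μ)
      {x : ι → E | ∀ j, q j → dist (x j) (x i) ≤ R ∨ dist (x j) (x i') ≤ R}
        ≤ (2 * p) ^ Fintype.card {j // q j} := by
  have hmp := measurePreserving_piEquivPiSubtypeProd (fun _ : ι => μ) q
  let T : Set (({j // q j} → E) × ({j // ¬ q j} → E)) :=
    {z | ∀ j, dist (z.1 j) (z.2 ⟨i, hi⟩) ≤ R ∨ dist (z.1 j) (z.2 ⟨i', hi'⟩) ≤ R}
  have hT : MeasurableSet T := by
    have : T = ⋂ j, ({z | dist (z.1 j) (z.2 ⟨i, hi⟩) ≤ R} ∪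
        {z | dist (z.1 j) (z.2 ⟨i', hi'⟩) ≤ R}) := by
      ext x; simp [T]
    rw [this]
    refine MeasurableSet.iInter fun j => MeasurableSet.union ?_ ?_
    · exact measurableSet_le (by fun_prop) measurable_const
    · exact measurableSet_le (by fun_prop) measurable_const
  have hpre : {x : ι → E | ∀ j, q j → dist (x j) (x i) ≤ R ∨ dist (x j) (x i') ≤ R} =
      MeasurableEquiv.piEquivPiSubtypeProd (fun _ : ι => E) q ⁻¹' T := by
    ext x
    simp [T, MeasurableEquiv.piEquivPiSubtypeProd, Equiv.piEquivPiSubtypeProd]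
  rw [hpre, hmp.measure_preimage hT.nullMeasurableSet, Measure.prod_apply_symm hT]
  refine (lintegral_mono (g := fun _ => (2 * p) ^ Fintype.card {j // q j}) fun y => ?_).trans
    (by simp)
  have : (fun z : {j // q j} → E => (z, y)) ⁻¹' T = Set.univ.pi fun _ =>
      (Metric.closedBall (y ⟨i, hi⟩) R ∪ Metric.closedBall (y ⟨i', hi'⟩) R) := by
    ext z; simp [T]
  rw [this, Measure.pi_pi, Finset.prod_const, Finset.card_univ]
  refine pow_le_pow_left' ?_ _
  refine (measure_union_le _ _).trans ?_
  rw [two_mul]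
  exact add_le_add (hp _) (hp _)

lemma measure_near_le {μ : Measure E} [IsProbabilityMeasure μ] {R : ℝ} {p : ENNReal}
    (hp : ∀ y, μ (Metric.closedBall y R) ≤ p) {i i' : ι} {S : Finset ι}
    (hi : i ∉ S) (hi' : i' ∉ S) :
    Measure.pi (fun _ : ι => μ)
      {x : ι → E | ∀ j ∈ S, dist (x j) (x i) ≤ R ∨ dist (x j) (x i') ≤ R} ≤ (2 * p) ^ S.card := by
  classical
  refine (measure_forall_near_le (q := fun j => j ∈ S) hp hi hi').trans ?_
  refine le_of_eq (congrArg _ ?_)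
  convert Fintype.card_coe S

lemma integrable_pairCount {P : Measure (ι → E)} [IsFiniteMeasure P] (F : ℕ → ℝ) (R : ℝ)
    (i i' : ι) (J : Finset ι) : Integrable (fun x => F (pairCount x R i i' J)) P := by
  classical
  have := integrable_comp_of_finite (P := P) (measurable_nearRelation (ι := ι) (E := E) R)
    (fun A => F (J.filter fun j => A (j, i) ∨ A (j, i')).card)
  convert this using 3
  unfold pairCount
  congr!

/-- The constant of the moment bound `integral_thresholdPow_le`. -/
def momentConst (a b : ℕ) : ℝ :=
  ((1 + 2 * (a + b) : ℝ) ^ a + 2 ^ (a + b) * (a + b).factorial) * (4 ^ b + 4 ^ (a + b))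

lemma momentConst_nonneg (a b : ℕ) : 0 ≤ momentConst a b := by
  unfold momentConst; positivity

lemma integral_choose_pairCount_le {μ : Measure E} [IsProbabilityMeasure μ] {R p : ℝ} (hp0 : 0 ≤ p)
    (hp : ∀ y, μ (Metric.closedBall y R) ≤ ENNReal.ofReal p) {i i' : ι} {J : Finset ι}
    (hi : i ∉ J) (hi' : i' ∉ J) (s : ℕ) :
    ∫ x, ((pairCount x R i i' J).choose s : ℝ) ∂(Measure.pi fun _ : ι => μ)
      ≤ (J.card * (2 * p)) ^ s := by
  simp_rw [choose_pairCount]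
  rw [integral_finsetSum _ fun S _ =>
    (integrable_const (1 : ℝ)).indicator (measurableSet_near R i i' S)]
  have h1 : ∀ S ∈ J.powersetCard s, ∫ x, Set.indicator
      {x : ι → E | ∀ j ∈ S, dist (x j) (x i) ≤ R ∨ dist (x j) (x i') ≤ R}
        (fun _ => (1 : ℝ)) x ∂(Measure.pi fun _ : ι => μ) ≤ (2 * p) ^ s := by
    intro S hS
    obtain ⟨hSJ, hc⟩ := Finset.mem_powersetCard.1 hS
    rw [integral_indicator_const _ (measurableSet_near R i i' S), smul_eq_mul, mul_one,
      measureReal_def]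
    refine ENNReal.toReal_le_of_le_ofReal (by positivity) ?_
    refine (measure_near_le hp (fun h => hi (hSJ h)) (fun h => hi' (hSJ h))).trans ?_
    rw [hc, ENNReal.ofReal_pow (by positivity), ENNReal.ofReal_mul zero_le_two]
    simp
  refine (Finset.sum_le_card_nsmul _ _ _ h1).trans ?_
  rw [Finset.card_powersetCard, nsmul_eq_mul, mul_pow (J.card : ℝ)]
  gcongr
  exact_mod_cast Nat.choose_le_pow _ _

/-- The allowance `2 * n` for `J` covers families in which every point has two copies. Together with
the two centers it gives the factor `4`; higher powers of `n * p ≤ 1` are absorbed into the `b`-th.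
-/
lemma integral_thresholdPow_le {μ : Measure E} [IsProbabilityMeasure μ] {R p : ℝ} (hp0 : 0 ≤ p)
    (hp : ∀ y, μ (Metric.closedBall y R) ≤ ENNReal.ofReal p) {i i' : ι} {J : Finset ι}
    (hi : i ∉ J) (hi' : i' ∉ J) {n : ℕ} (hJ : J.card ≤ 2 * n) (hn : n * p ≤ 1) (a b : ℕ) :
    ∫ x, thresholdPow a b (pairCount x R i i' J) ∂(Measure.pi fun _ : ι => μ)
      ≤ momentConst a b * (n * p) ^ b := by
  have hq : (J.card : ℝ) * (2 * p) ≤ 4 * (n * p) := by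
    have : (J.card : ℝ) ≤ 2 * n := by exact_mod_cast hJ
    nlinarith
  have hq0 : (0 : ℝ) ≤ (J.card : ℝ) * (2 * p) := by positivity
  have hnp : (0 : ℝ) ≤ n * p := by positivity
  have hs : ∀ s, b ≤ s → ∫ x, ((pairCount x R i i' J).choose s : ℝ) ∂(Measure.pi fun _ : ι => μ)
      ≤ 4 ^ s * (n * p) ^ b := by
    intro s hbs
    calc _ ≤ (J.card * (2 * p)) ^ s := integral_choose_pairCount_le hp0 hp hi hi' s
      _ ≤ (4 * (n * p)) ^ s := by gcongr
      _ = 4 ^ s * (n * p) ^ s := mul_pow _ _ _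
      _ ≤ 4 ^ s * (n * p) ^ b := by
          gcongr ?_ * ?_
          exact pow_le_pow_of_le_one hnp hn hbs
  have hI : ∀ s, Integrable (fun x : ι → E => ((pairCount x R i i' J).choose s : ℝ))
      (Measure.pi fun _ : ι => μ) := fun s =>
    integrable_pairCount (fun N => (N.choose s : ℝ)) R i i' J
  calc _ ≤ ∫ x, ((1 + 2 * (a + b) : ℝ) ^ a + 2 ^ (a + b) * (a + b).factorial) *
      ((pairCount x R i i' J).choose b + (pairCount x R i i' J).choose (a + b))
        ∂(Measure.pi fun _ : ι => μ) := by
        refine integral_mono (integrable_pairCount _ R i i' J)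
          (((hI b).add (hI (a + b))).const_mul _) fun x => thresholdPow_le_choose a b _
    _ ≤ _ := by
        rw [integral_const_mul, integral_add (hI b) (hI (a + b)), momentConst, mul_assoc]
        refine mul_le_mul_of_nonneg_left ?_ (by positivity)
        rw [add_mul]
        exact add_le_add (hs b le_rfl) (hs (a + b) (by omega))

end Moments

/-! ### Independence and resampling in product measures -/

section Product

variable {ι κ E : Type*} [Fintype ι] [Fintype κ] [MeasurableSpace E]

lemma measurePreserving_comp_injective (μ : Measure E) [IsProbabilityMeasure μ] {e : κ → ι}
    (he : e.Injective) :
    MeasurePreserving (fun (Y : ι → E) j => Y (e j)) (Measure.pi fun _ : ι => μ)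
      (Measure.pi fun _ : κ => μ) := by
  refine ⟨by fun_prop, ?_⟩
  have h1 : iIndepFun (fun (i : ι) (Y : ι → E) => Y i) (Measure.pi fun _ : ι => μ) :=
    iIndepFun_pi (X := fun _ x => x) fun _ => aemeasurable_id
  have h2 := h1.precomp he
  rw [iIndepFun_iff_map_fun_eq_pi_map fun j => (measurable_pi_apply (e j)).aemeasurable] at h2
  rw [h2]
  congr 1
  ext1 j
  exact (measurePreserving_eval (fun _ : ι => μ) (e j)).map_eq

lemma integral_comp_of_measurePreserving {α β : Type*} [MeasurableSpace α] [MeasurableSpace β]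
    {μ : Measure α} {ν : Measure β} {f : α → β} (hf : MeasurePreserving f μ ν) {g : β → ℝ}
    (hg : Measurable g) : ∫ x, g (f x) ∂μ = ∫ y, g y ∂ν := by
  rw [← hf.map_eq, integral_map hf.aemeasurable hg.aestronglyMeasurable]

/-- Functions of disjoint sets of coordinates are independent. -/
lemma integral_mul_of_disjoint (μ : Measure E) [IsProbabilityMeasure μ] {S T : Finset ι}
    (hST : Disjoint S T) {F G : (ι → E) → ℝ} (hF : Measurable F) (hG : Measurable G)
    (hFS : ∀ x x', (∀ i ∈ S, x i = x' i) → F x = F x')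
    (hGT : ∀ x x', (∀ i ∈ T, x i = x' i) → G x = G x') :
    ∫ x, F x * G x ∂(Measure.pi fun _ : ι => μ) =
      (∫ x, F x ∂(Measure.pi fun _ : ι => μ)) * ∫ x, G x ∂(Measure.pi fun _ : ι => μ) := by
  classical
  obtain ⟨e₀⟩ : Nonempty E := nonempty_of_isProbabilityMeasure μ
  have h1 : iIndepFun (fun (i : ι) (Y : ι → E) => Y i) (Measure.pi fun _ : ι => μ) :=
    iIndepFun_pi (X := fun _ x => x) fun _ => aemeasurable_id
  have h2 := h1.indepFun_finset S T hST fun i => measurable_pi_apply i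
  -- Filling the missing coordinates with a fixed point `e₀` exhibits `F` and `G` as functions of
  -- the restricted tuples.
  let ext : (U : Finset ι) → (U → E) → ι → E := fun U y i => if h : i ∈ U then y ⟨i, h⟩ else e₀
  have hext : ∀ U, Measurable (ext U) := by
    intro U
    refine measurable_pi_lambda _ fun i => ?_
    by_cases h : i ∈ U
    · simp only [ext, h, dite_true]; exact measurable_pi_apply _
    · simp only [ext, h, dite_false]; exact measurable_const
  have h3 := h2.comp (hF.comp (hext S)) (hG.comp (hext T))
  have e1 : (F ∘ ext S) ∘ (fun (x : ι → E) (i : S) => x i) = F := by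
    ext x
    refine hFS _ _ fun i hi => ?_
    simp [ext, hi]
  have e2 : (G ∘ ext T) ∘ (fun (x : ι → E) (i : T) => x i) = G := by
    ext x
    refine hGT _ _ fun i hi => ?_
    simp [ext, hi]
  rw [e1, e2] at h3
  exact h3.integral_fun_mul_eq_mul_integral hF.aestronglyMeasurable hG.aestronglyMeasurable

/-- The selection `s` of coordinates from a doubled family. -/
def select {n : ℕ} (s : Fin n → Bool) (Y : Fin n × Bool → E) (j : Fin n) : E := Y (j, s j)

lemma measurePreserving_select {n : ℕ} (μ : Measure E) [IsProbabilityMeasure μ]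
    (s : Fin n → Bool) :
    MeasurePreserving (select s) (Measure.pi fun _ : Fin n × Bool => μ)
      (Measure.pi fun _ : Fin n => μ) :=
  measurePreserving_comp_injective μ (e := fun j => (j, s j)) fun _ _ h => (Prod.ext_iff.1 h).1

/-- A covariance bound by resampling one coordinate at a time. -/
theorem abs_covariance_le {n : ℕ} (μ : Measure E) [IsProbabilityMeasure μ]
    {F G : (Fin n → E) → ℝ} (hF : Measurable F) (hG : Measurable G) {CF CG : ℝ}
    (hCF : ∀ x, |F x| ≤ CF) (hCG : ∀ x, |G x| ≤ CG) {B : Fin n → (Fin n × Bool → E) → ℝ}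
    (hBi : ∀ m, Integrable (B m) (Measure.pi fun _ => μ))
    (hB : ∀ m Y s s' t t', (∀ j ≠ m, s j = t j) → (∀ j ≠ m, s' j = t' j) →
      |F (select s Y) - F (select t Y)| * |G (select s' Y) - G (select t' Y)| ≤ B m Y) :
    |∫ x, F x * G x ∂(Measure.pi fun _ => μ) -
      (∫ x, F x ∂(Measure.pi fun _ => μ)) * ∫ x, G x ∂(Measure.pi fun _ => μ)|
      ≤ ∑ m, ∫ Y, B m Y ∂(Measure.pi fun _ => μ) := by
  set Q : Measure (Fin n × Bool → E) := Measure.pi fun _ => μ with hQ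
  have hms : ∀ s : Fin n → Bool, Measurable (select (E := E) s) := fun s =>
    (measurePreserving_select μ s).measurable
  have hFi : ∀ s s', Integrable (fun Y => F (select s Y) * G (select s' Y)) Q := by
    intro s s'
    refine Integrable.of_bound
      ((hF.comp (hms s)).mul (hG.comp (hms s'))).aestronglyMeasurable (CF * CG) ?_
    refine Filter.Eventually.of_forall fun Y => ?_
    rw [Real.norm_eq_abs, abs_mul]
    exact mul_le_mul (hCF _) (hCG _) (abs_nonneg _) ((abs_nonneg _).trans (hCF (select s Y)))
  let f₀ : Fin n → Bool := fun _ => false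
  let f₁ : Fin n → Bool := fun _ => true
  -- Coordinates below `m` come from the second copy. The selection moves from the copy used by `G`,
  -- giving E[FG], to an independent copy, giving E[F] E[G].
  let sel : ℕ → Fin n → Bool := fun m j => decide ((j : ℕ) < m)
  have hsel0 : sel 0 = f₀ := by ext j; simp [sel, f₀]
  have hseln : sel n = f₁ := by ext j; simp [sel, f₁]
  have hFG : ∫ x, F x * G x ∂(Measure.pi fun _ => μ) =
      ∫ Y, F (select (sel 0) Y) * G (select f₀ Y) ∂Q := by
    rw [hsel0]
    exact (integral_comp_of_measurePreserving (measurePreserving_select μ f₀) (hF.mul hG)).symm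
  have hFG' : (∫ x, F x ∂(Measure.pi fun _ => μ)) * ∫ x, G x ∂(Measure.pi fun _ => μ) =
      ∫ Y, F (select (sel n) Y) * G (select f₀ Y) ∂Q := by
    rw [hseln, ← integral_comp_of_measurePreserving (measurePreserving_select μ f₀) hG,
      ← integral_comp_of_measurePreserving (measurePreserving_select μ f₁) hF]
    symm
    refine integral_mul_of_disjoint μ (F := fun Y => F (select f₁ Y))
      (G := fun Y => G (select f₀ Y))
      (S := Finset.univ.filter fun q : Fin n × Bool => q.2 = true)
      (T := Finset.univ.filter fun q : Fin n × Bool => q.2 = false) ?_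
      (hF.comp (hms f₁)) (hG.comp (hms f₀)) ?_ ?_
    · rw [Finset.disjoint_left]
      intro q h1 h2
      rw [Finset.mem_filter] at h1 h2
      rw [h1.2] at h2
      simp at h2
    · intro x x' h
      refine congrArg F (funext fun j => h _ ?_)
      simp [f₁]
    · intro x x' h
      refine congrArg G (funext fun j => h _ ?_)
      simp [f₀]
  have htel : ∀ Y, F (select (sel 0) Y) * G (select f₀ Y) - F (select (sel n) Y) * G (select f₀ Y)
      = ∑ m : Fin n, (F (select (sel m) Y) - F (select (sel (m + 1)) Y)) * G (select f₀ Y) := by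
    intro Y
    rw [Fin.sum_univ_eq_sum_range
      (fun m => (F (select (sel m) Y) - F (select (sel (m + 1)) Y)) * G (select f₀ Y)),
      ← Finset.sum_mul, Finset.sum_range_sub' (fun m => F (select (sel m) Y)), sub_mul]
  have hsub : ∀ s t s', Integrable
      (fun Y => (F (select s Y) - F (select t Y)) * G (select s' Y)) Q := by
    intro s t s'
    simp only [sub_mul]
    exact (hFi s s').sub (hFi t s')
  rw [hFG, hFG', ← integral_sub (hFi _ _) (hFi _ _)]
  simp_rw [htel]
  rw [integral_finsetSum _ fun m _ => hsub _ _ _]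
  refine (Finset.abs_sum_le_sum_abs _ _).trans (Finset.sum_le_sum fun m _ => ?_)
  -- Swapping the two copies of coordinate `m` preserves the measure, reverses the increment of `F`
  -- and resamples that coordinate in `G`. Averaging both forms turns `G` into an increment too,
  -- with a factor one half.
  let π : Equiv.Perm (Fin n × Bool) := Equiv.swap (m, false) (m, true)
  let e₁ : Fin n → Bool := Function.update f₀ m true
  have hπ : MeasurePreserving (fun (Y : Fin n × Bool → E) q => Y (π q)) Q Q :=
    measurePreserving_comp_injective μ π.injective
  have hπne : ∀ (j : Fin n) (b : Bool), j ≠ m → π (j, b) = (j, b) := by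
    intro j b hj
    refine Equiv.swap_apply_of_ne_of_ne ?_ ?_ <;>
    · intro h; exact hj (Prod.ext_iff.1 h).1
  have hs1 : ∀ Y : Fin n × Bool → E,
      select (sel m) (fun q => Y (π q)) = select (sel (m + 1)) Y := by
    intro Y
    ext j
    simp only [select]
    by_cases hj : j = m
    · subst hj
      simp [sel, π]
    · rw [hπne _ _ hj]
      have : (j : ℕ) < m ↔ (j : ℕ) < m + 1 := by
        have : (j : ℕ) ≠ m := fun h => hj (Fin.ext h)
        omega
      simp [sel, this]
  have hs2 : ∀ Y : Fin n × Bool → E,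
      select (sel (m + 1)) (fun q => Y (π q)) = select (sel m) Y := by
    intro Y
    have := hs1 fun q => Y (π q)
    rw [← this]
    simp [π]
  have hs3 : ∀ Y : Fin n × Bool → E, select f₀ (fun q => Y (π q)) = select e₁ Y := by
    intro Y
    ext j
    simp only [select]
    by_cases hj : j = m
    · subst hj
      simp [f₀, e₁, π]
    · rw [hπne _ _ hj]
      simp [f₀, e₁, hj]
  have hkey : ∫ Y, (F (select (sel m) Y) - F (select (sel (m + 1)) Y)) * G (select f₀ Y) ∂Q =
      -∫ Y, (F (select (sel m) Y) - F (select (sel (m + 1)) Y)) * G (select e₁ Y) ∂Q := by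
    have hm : Measurable fun Y : Fin n × Bool → E =>
        (F (select (sel m) Y) - F (select (sel (m + 1)) Y)) * G (select f₀ Y) :=
      ((hF.comp (hms _)).sub (hF.comp (hms _))).mul (hG.comp (hms _))
    rw [← integral_comp_of_measurePreserving hπ hm, ← integral_neg]
    congr 1
    ext Y
    rw [hs1, hs2, hs3]
    ring
  have hdbl : 2 * ∫ Y, (F (select (sel m) Y) - F (select (sel (m + 1)) Y)) * G (select f₀ Y) ∂Q =
      ∫ Y, (F (select (sel m) Y) - F (select (sel (m + 1)) Y)) *
        (G (select f₀ Y) - G (select e₁ Y)) ∂Q := by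
    simp_rw [mul_sub]
    rw [integral_sub (hsub _ _ _) (hsub _ _ _), two_mul]
    nth_rewrite 2 [hkey]
    ring
  have hle : |∫ Y, (F (select (sel m) Y) - F (select (sel (m + 1)) Y)) *
        (G (select f₀ Y) - G (select e₁ Y)) ∂Q| ≤ ∫ Y, B m Y ∂Q := by
    refine abs_integral_le_integral_abs.trans (integral_mono ?_ (hBi m) fun Y => ?_)
    · simp_rw [mul_sub]
      exact ((hsub _ _ _).sub (hsub _ _ _)).abs
    · simp only [abs_mul]
      refine hB m Y _ _ _ _ (fun j hj => ?_) fun j hj => ?_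
      · have : (j : ℕ) < m ↔ (j : ℕ) < m + 1 := by
          have : (j : ℕ) ≠ m := fun h => hj (Fin.ext h)
          omega
        simp [sel, this]
      · simp [f₀, e₁, hj]
  rw [← hdbl, abs_mul, abs_two] at hle
  linarith [abs_nonneg (∫ Y, (F (select (sel m) Y) - F (select (sel (m + 1)) Y)) *
    G (select f₀ Y) ∂Q)]

end Product

/-! ### The approximate Stein identity for the Betti number -/

section Key

lemma abs_sub_le_of_increments {g : ℕ → ℝ} {L : ℝ} (hL : ∀ m, |g (m + 1) - g m| ≤ L) (a b : ℕ) :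
    |g a - g b| ≤ L * |(a : ℝ) - b| := by
  have key : ∀ a t : ℕ, |g (a + t) - g a| ≤ L * t := by
    intro a t
    induction t with
    | zero => simp
    | succ t ih =>
      have h1 := abs_sub_le (g (a + (t + 1))) (g (a + t)) (g a)
      have h2 := hL (a + t)
      push_cast
      rw [← add_assoc] at h1 ⊢
      linarith
  rcases le_total a b with h | h
  · obtain ⟨t, rfl⟩ := Nat.exists_eq_add_of_le h
    rw [abs_sub_comm, abs_sub_comm (a : ℝ)]
    push_cast
    rw [add_sub_cancel_left, abs_of_nonneg (Nat.cast_nonneg t : (0 : ℝ) ≤ t)]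
    exact key a t
  · obtain ⟨t, rfl⟩ := Nat.exists_eq_add_of_le h
    push_cast
    rw [add_sub_cancel_left, abs_of_nonneg (Nat.cast_nonneg t : (0 : ℝ) ≤ t)]
    exact key b t

variable {E : Type*} [PseudoMetricSpace E]

lemma nearCount_eq_pairCount {ι : Type*} [LinearOrder ι] (x : ι → E) (R : ℝ) (v : ι)
    (I : Finset ι) : nearCount x R v I = pairCount x R v v (I.erase v) := by
  simp [nearCount, pairCount]

/-- Whichever copy of point `m` is selected, it is one of the two centers, so the bound does not
depend on the selection. -/
lemma nearCount_select_le {n : ℕ} (s : Fin n → Bool) (Y : Fin n × Bool → E) (R : ℝ) (m : Fin n) :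
    nearCount (select s Y) R m Finset.univ ≤
      pairCount Y R (m, false) (m, true) (Finset.univ.filter fun q => q.1 ≠ m) := by
  refine Finset.card_le_card_of_injOn (fun j => (j, s j)) ?_ fun _ _ _ _ h => (Prod.ext_iff.1 h).1
  intro j hj
  rw [Finset.mem_coe, Finset.mem_filter, Finset.mem_erase] at hj
  simp only [Finset.coe_filter, Finset.mem_filter, Finset.mem_univ, true_and, Set.mem_ofPred_eq]
  refine ⟨hj.1.1, ?_⟩
  have h := hj.2
  simp only [select] at h
  cases hs : s m
  · rw [hs] at h; exact Or.inl h
  · rw [hs] at h; exact Or.inr h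

/-- The two configurations agree once point `m` is deleted; comparing each with that common
remainder gives the factor `2`. -/
lemma abs_sub_of_eq_off {n : ℕ} {Φ : (Fin n → E) → Finset (Fin n) → ℝ}
    (hΦ : ∀ x x' I, (∀ i ∈ I, x i = x' i) → Φ x I = Φ x' I) {τ : ℕ → ℝ} {R : ℝ}
    (hτ : Monotone τ)
    (hb : ∀ x v, |Φ x Finset.univ - Φ x (Finset.univ.erase v)| ≤ τ (nearCount x R v Finset.univ))
    {s t : Fin n → Bool} {m : Fin n} (h : ∀ j ≠ m, s j = t j) (Y : Fin n × Bool → E) :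
    |Φ (select s Y) Finset.univ - Φ (select t Y) Finset.univ| ≤
      2 * τ (pairCount Y R (m, false) (m, true) (Finset.univ.filter fun q => q.1 ≠ m)) := by
  have h1 := (hb (select s Y) m).trans (hτ (nearCount_select_le s Y R m))
  have h2 := (hb (select t Y) m).trans (hτ (nearCount_select_le t Y R m))
  rw [hΦ (select s Y) (select t Y) (Finset.univ.erase m) fun j hj => by
    simp only [select]
    rw [h j (Finset.mem_erase.1 hj).1]] at h1
  rw [abs_le] at *
  constructor <;> linarith [h1.1, h1.2, h2.1, h2.2]

lemma inducedBetti_univ {n : ℕ} (x : Fin n → E) (r : ℝ) (k : ℕ) :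
    inducedBetti x r k Finset.univ = (cechComplex x r).betti (k - 2) := by
  rw [inducedBetti, PreAbstractSimplicialComplex.induce_univ]

variable [SecondCountableTopology E] [MeasurableSpace E] [BorelSpace E]
  {μ : Measure E} [IsProbabilityMeasure μ] {n k : ℕ} {r p : ℝ}

lemma integrable_near (a b : ℕ) (R : ℝ) (v : Fin n) (I : Finset (Fin n)) :
    Integrable (fun x : Fin n → E => thresholdPow a b (nearCount x R v I))
      (Measure.pi fun _ => μ) := by
  simp_rw [nearCount_eq_pairCount]
  exact integrable_pairCount _ _ _ _ _

lemma integral_near_le (hp0 : 0 ≤ p) {R : ℝ}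
    (hp : ∀ y, μ (Metric.closedBall y R) ≤ ENNReal.ofReal p) (hn : n * p ≤ 1) (a b : ℕ)
    (v : Fin n) :
    ∫ x : Fin n → E, thresholdPow a b (nearCount x R v Finset.univ) ∂(Measure.pi fun _ => μ)
      ≤ momentConst a b * (n * p) ^ b := by
  simp_rw [nearCount_eq_pairCount]
  refine integral_thresholdPow_le hp0 hp (Finset.notMem_erase _ _) (Finset.notMem_erase _ _) ?_ hn
    a b
  refine (Finset.card_le_card (Finset.erase_subset _ _)).trans ?_
  simp
  omega

lemma integral_sum_near_le (hp0 : 0 ≤ p) {R : ℝ}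
    (hp : ∀ y, μ (Metric.closedBall y R) ≤ ENNReal.ofReal p) (hn : n * p ≤ 1) (a b : ℕ)
    (σ : Finset (Fin n)) :
    ∫ x : Fin n → E, ∑ v ∈ σ, thresholdPow a b (nearCount x R v Finset.univ)
      ∂(Measure.pi fun _ => μ) ≤ σ.card * (momentConst a b * (n * p) ^ b) := by
  rw [integral_finsetSum _ fun v _ => integrable_near a b R v _, ← nsmul_eq_mul]
  exact Finset.sum_le_card_nsmul _ _ _ fun v _ => integral_near_le hp0 hp hn a b v

variable [ProperSpace E]

lemma integrable_cech (F : PreAbstractSimplicialComplex (Fin n) → ℝ) :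
    Integrable (fun x : Fin n → E => F (cechComplex x r)) (Measure.pi fun _ => μ) :=
  integrable_comp_of_finite (measurable_cechComplex r) F

lemma measurable_cech (F : PreAbstractSimplicialComplex (Fin n) → ℝ) :
    Measurable (fun x : Fin n → E => F (cechComplex x r)) :=
  (Measurable.of_discrete (f := F)).comp (measurable_cechComplex r)

lemma integrable_inducedBetti (I : Finset (Fin n)) :
    Integrable (fun x : Fin n → E => inducedBetti x r k I) (Measure.pi fun _ => μ) :=
  integrable_cech fun K => ((K.induce I).betti (k - 2) : ℝ)

lemma integrable_card_holes (I : Finset (Fin n)) :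
    Integrable (fun x : Fin n → E => ((holes x r k I).card : ℝ)) (Measure.pi fun _ => μ) := by
  classical
  exact integrable_cech fun K => (((I.powersetCard k).filter fun σ => K.IsHole σ).card : ℝ)

lemma integrable_bettiExcess (I : Finset (Fin n)) :
    Integrable (fun x : Fin n → E => bettiExcess x r k I) (Measure.pi fun _ => μ) :=
  (integrable_inducedBetti I).sub (integrable_card_holes I)

/-- The expected number of hollow simplices is of order at most `n (n p) ^ (k - 1)`. -/
lemma integral_card_holes_le (hk : 3 ≤ k) (hr : 0 ≤ r) (hp0 : 0 ≤ p)
    (hp : ∀ y, μ (Metric.closedBall y (2 * r * k)) ≤ ENNReal.ofReal p) (hn : n * p ≤ 1) :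
    ∫ x : Fin n → E, ((holes x r k Finset.univ).card : ℝ) ∂(Measure.pi fun _ => μ)
      ≤ n * (momentConst k (k - 1) * (n * p) ^ (k - 1)) := by
  refine le_trans (integral_mono (integrable_card_holes _)
    (integrable_finsetSum _ fun v _ => integrable_near k (k - 1) (2 * r * k) v Finset.univ)
    fun x => card_holes_le hk (two_mul_le_two_mul_mul hk hr) Finset.univ) ?_
  refine (integral_sum_near_le hp0 hp hn k (k - 1) Finset.univ).trans ?_
  simp

lemma integral_abs_bettiExcess_le (hk : 3 ≤ k) (hr : 0 ≤ r) (hp0 : 0 ≤ p)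
    (hp : ∀ y, μ (Metric.closedBall y (2 * r * k)) ≤ ENNReal.ofReal p) (hn : n * p ≤ 1) :
    ∫ x : Fin n → E, |bettiExcess x r k Finset.univ| ∂(Measure.pi fun _ => μ)
      ≤ n * (2 * momentConst k k * (n * p) ^ k) := by
  refine le_trans (integral_mono (integrable_bettiExcess _).abs
    (integrable_finsetSum _ fun v _ =>
      (integrable_near k k (2 * r * k) v Finset.univ).const_mul 2)
    fun x => abs_bettiExcess_le hk hr Finset.univ) ?_
  simp_rw [← Finset.mul_sum]
  rw [integral_const_mul]
  have := integral_sum_near_le (μ := μ) hp0 hp hn k k Finset.univ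
  rw [Finset.card_univ, Fintype.card_fin] at this
  linarith

/-- The hollow simplices are nearly independent of the Betti number of the rest. -/
lemma abs_integral_holes_mul_sub_le (hk : 3 ≤ k) (hr : 0 ≤ r) (hp0 : 0 ≤ p)
    (hp : ∀ y, μ (Metric.closedBall y (2 * r * k)) ≤ ENNReal.ofReal p) (hn : n * p ≤ 1)
    {g : ℕ → ℝ} {L : ℝ} (hL : ∀ m, |g (m + 1) - g m| ≤ L) :
    |∫ x : Fin n → E, ((holes x r k Finset.univ).card : ℝ) * g ((cechComplex x r).betti (k - 2))
        ∂(Measure.pi fun _ => μ) -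
      (∫ x : Fin n → E, ((holes x r k Finset.univ).card : ℝ) ∂(Measure.pi fun _ => μ)) *
        ∫ x : Fin n → E, g ((cechComplex x r).betti (k - 2) + 1) ∂(Measure.pi fun _ => μ)|
      ≤ (2 ^ (k + 1) * momentConst (k + k) k + momentConst k (k - 1) * k * momentConst k 1) * L *
        (n * (n * p) ^ k) := by
  classical
  have hL0 : 0 ≤ L := (abs_nonneg _).trans (hL 0)
  set ν : Measure (Fin n → E) := Measure.pi fun _ => μ with hν
  have hR : 2 * r ≤ 2 * r * k := two_mul_le_two_mul_mul hk hr
  have hR4 : 4 * r ≤ 2 * r * k := by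
    have : (3 : ℝ) ≤ k := by exact_mod_cast hk
    nlinarith
  let N : (Fin n → E) → ℕ := fun x => (cechComplex x r).betti (k - 2)
  let Nσ : Finset (Fin n) → (Fin n → E) → ℕ := fun σ x =>
    ((cechComplex x r).induce (Finset.univ \ σ)).betti (k - 2)
  let ξ : Finset (Fin n) → (Fin n → E) → ℝ := fun σ x =>
    if (cechComplex x r).IsHole σ then 1 else 0
  let S : Finset (Finset (Fin n)) := Finset.univ.powersetCard k
  have hξ0 : ∀ σ x, 0 ≤ ξ σ x := fun σ x => by
    simp only [ξ]; split_ifs <;> norm_num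
  have hsum : ∀ (F : Finset (Fin n) → ℝ) x,
      ∑ σ ∈ S, ξ σ x * F σ = ∑ σ ∈ holes x r k Finset.univ, F σ := by
    intro F x
    simp only [ξ, ite_mul, one_mul, zero_mul, holes, Finset.sum_filter, S]
  have hW : ∀ x, ((holes x r k Finset.univ).card : ℝ) = ∑ σ ∈ S, ξ σ x := by
    intro x
    have := hsum (fun _ => 1) x
    simpa using this.symm
  have hiξ : ∀ σ, Integrable (ξ σ) ν := fun σ =>
    integrable_cech fun K => if K.IsHole σ then 1 else 0
  have hiξg : ∀ σ, Integrable (fun x => ξ σ x * g (N x)) ν := fun σ =>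
    integrable_cech fun K => (if K.IsHole σ then 1 else 0) * g (K.betti (k - 2))
  have hiξgσ : ∀ σ, Integrable (fun x => ξ σ x * g (Nσ σ x + 1)) ν := fun σ =>
    integrable_cech fun K =>
      (if K.IsHole σ then 1 else 0) * g ((K.induce (Finset.univ \ σ)).betti (k - 2) + 1)
  have hig : Integrable (fun x => g (N x + 1)) ν := integrable_cech fun K => g (K.betti (k - 2) + 1)
  have higσ : ∀ σ, Integrable (fun x => g (Nσ σ x + 1)) ν := fun σ =>
    integrable_cech fun K => g ((K.induce (Finset.univ \ σ)).betti (k - 2) + 1)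
  have hid : ∀ σ, Integrable (fun x => ξ σ x *
      |inducedBetti x r k Finset.univ - (1 + inducedBetti x r k (Finset.univ \ σ))|) ν := fun σ =>
    integrable_cech fun K => (if K.IsHole σ then 1 else 0) *
      |((K.induce Finset.univ).betti (k - 2) : ℝ) -
        (1 + ((K.induce (Finset.univ \ σ)).betti (k - 2) : ℝ))|
  -- Whether `σ` is hollow depends on the points in `σ`, the reduced Betti number on the others.
  have hind : ∀ σ, ∫ x, ξ σ x * g (Nσ σ x + 1) ∂ν = (∫ x, ξ σ x ∂ν) * ∫ x, g (Nσ σ x + 1) ∂ν := by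
    intro σ
    refine integral_mul_of_disjoint μ (S := σ) (T := Finset.univ \ σ) Finset.disjoint_sdiff
      (measurable_cech fun K => if K.IsHole σ then 1 else 0)
      (measurable_cech fun K => g ((K.induce (Finset.univ \ σ)).betti (k - 2) + 1)) ?_ ?_
    · intro x x' h
      simp only [ξ, isHole_congr h]
    · intro x x' h
      simp only [Nσ, induce_congr h]
  have h1 : ∀ σ, |∫ x, ξ σ x * g (N x) ∂ν - ∫ x, ξ σ x * g (Nσ σ x + 1) ∂ν| ≤
      L * ∫ x, ξ σ x *
        |inducedBetti x r k Finset.univ - (1 + inducedBetti x r k (Finset.univ \ σ))| ∂ν := by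
    intro σ
    rw [← integral_sub (hiξg σ) (hiξgσ σ), ← integral_const_mul]
    refine abs_integral_le_integral_abs.trans
      (integral_mono ((hiξg σ).sub (hiξgσ σ)).abs ((hid σ).const_mul L) fun x => ?_)
    dsimp only
    rw [← mul_sub, abs_mul, abs_of_nonneg (hξ0 σ x), mul_left_comm]
    refine mul_le_mul_of_nonneg_left ?_ (hξ0 σ x)
    refine (abs_sub_le_of_increments hL _ _).trans (le_of_eq ?_)
    rw [inducedBetti_univ]
    congr 2
    push_cast
    rw [add_comm]
    rfl
  -- Putting the `k` points of `σ` back changes the Betti number only where some point is near,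
  -- which costs one factor `n * p`.
  have h2 : ∀ σ ∈ S, |∫ x, g (Nσ σ x + 1) ∂ν - ∫ x, g (N x + 1) ∂ν| ≤
      L * (k * (momentConst k 1 * (n * p))) := by
    intro σ hσ
    have hc : σ.card = k := (Finset.mem_powersetCard.1 hσ).2
    rw [← integral_sub (higσ σ) hig]
    have h3 := integral_sum_near_le (μ := μ) hp0 hp hn k 1 σ
    rw [hc, pow_one] at h3
    refine le_trans ?_ (mul_le_mul_of_nonneg_left h3 hL0)
    rw [← integral_const_mul]
    refine abs_integral_le_integral_abs.trans (integral_mono ((higσ σ).sub hig).abs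
      ((integrable_finsetSum _ fun v _ => integrable_near k 1 _ v _).const_mul L) fun x => ?_)
    refine (abs_sub_le_of_increments hL _ _).trans (mul_le_mul_of_nonneg_left ?_ hL0)
    refine le_trans (le_of_eq ?_)
      (abs_inducedBetti_sub_sdiff_le (x := x) hk hR Finset.univ σ)
    rw [inducedBetti_univ, abs_sub_comm]
    push_cast
    rw [add_sub_add_right_eq_sub]
    rfl
  have e1 : ∫ x, ((holes x r k Finset.univ).card : ℝ) * g (N x) ∂ν =
      ∑ σ ∈ S, ∫ x, ξ σ x * g (N x) ∂ν := by
    rw [← integral_finsetSum _ fun σ _ => hiξg σ]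
    congr 1
    ext x
    rw [hW, Finset.sum_mul]
  have e2 : ∫ x, ((holes x r k Finset.univ).card : ℝ) ∂ν = ∑ σ ∈ S, ∫ x, ξ σ x ∂ν := by
    rw [← integral_finsetSum _ fun σ _ => hiξ σ]
    congr 1
    ext x
    rw [hW]
  have e3 : ∑ σ ∈ S, ∫ x, ξ σ x *
      |inducedBetti x r k Finset.univ - (1 + inducedBetti x r k (Finset.univ \ σ))| ∂ν ≤
      n * (2 ^ (k + 1) * momentConst (k + k) k * (n * p) ^ k) := by
    rw [← integral_finsetSum _ fun σ _ => hid σ]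
    refine le_trans (integral_mono (integrable_finsetSum _ fun σ _ => hid σ)
      (integrable_finsetSum Finset.univ fun v _ =>
        (integrable_near (k + k) k (2 * r * k) v Finset.univ).const_mul (2 ^ (k + 1)))
      fun x => ?_) ?_
    · exact (hsum (fun σ => |inducedBetti x r k Finset.univ -
        (1 + inducedBetti x r k (Finset.univ \ σ))|) x).le.trans
        (sum_holes_abs_inducedBetti_sub_le hk hr hR4 Finset.univ)
    · simp_rw [← Finset.mul_sum]
      rw [integral_const_mul]
      have := integral_sum_near_le (μ := μ) hp0 hp hn (k + k) k Finset.univ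
      rw [Finset.card_univ, Fintype.card_fin] at this
      have h2k : (0 : ℝ) ≤ 2 ^ (k + 1) := by positivity
      calc _ ≤ 2 ^ (k + 1) * (n * (momentConst (k + k) k * (n * p) ^ k)) :=
            mul_le_mul_of_nonneg_left this h2k
        _ = _ := by ring
  have e4 := integral_card_holes_le (μ := μ) hk hr hp0 hp hn
  rw [← hν] at e4
  have hWnn : 0 ≤ ∫ x, ((holes x r k Finset.univ).card : ℝ) ∂ν :=
    integral_nonneg fun x => by positivity
  change |∫ x, ((holes x r k Finset.univ).card : ℝ) * g (N x) ∂ν -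
      (∫ x, ((holes x r k Finset.univ).card : ℝ) ∂ν) * ∫ x, g (N x + 1) ∂ν| ≤ _
  -- Termwise, `β` is first replaced by `1 + β'` on the hole event, then independence applies, and
  -- finally `β'` is replaced by `β` in the second factor.
  have hmain : |∫ x, ((holes x r k Finset.univ).card : ℝ) * g (N x) ∂ν -
      (∫ x, ((holes x r k Finset.univ).card : ℝ) ∂ν) * ∫ x, g (N x + 1) ∂ν| ≤
      L * ∑ σ ∈ S, (∫ x, ξ σ x *
        |inducedBetti x r k Finset.univ - (1 + inducedBetti x r k (Finset.univ \ σ))| ∂ν) +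
      (∫ x, ((holes x r k Finset.univ).card : ℝ) ∂ν) *
        (L * (k * (momentConst k 1 * (n * p)))) := by
    rw [e1, e2, Finset.sum_mul, ← Finset.sum_sub_distrib, Finset.mul_sum, Finset.sum_mul,
      ← Finset.sum_add_distrib]
    refine (Finset.abs_sum_le_sum_abs _ _).trans (Finset.sum_le_sum fun σ hσ => ?_)
    have hξi : 0 ≤ ∫ x, ξ σ x ∂ν := integral_nonneg (hξ0 σ)
    calc |∫ x, ξ σ x * g (N x) ∂ν - (∫ x, ξ σ x ∂ν) * ∫ x, g (N x + 1) ∂ν|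
        = |(∫ x, ξ σ x * g (N x) ∂ν - ∫ x, ξ σ x * g (Nσ σ x + 1) ∂ν) +
          (∫ x, ξ σ x ∂ν) * (∫ x, g (Nσ σ x + 1) ∂ν - ∫ x, g (N x + 1) ∂ν)| := by
          rw [hind]; congr 1; ring
      _ ≤ _ := (abs_add_le _ _).trans (add_le_add (h1 σ) ?_)
    rw [abs_mul, abs_of_nonneg hξi]
    exact mul_le_mul_of_nonneg_left (h2 σ hσ) hξi
  refine hmain.trans ?_
  have hnp : (0 : ℝ) ≤ n * p := by positivity
  have hc1 := momentConst_nonneg k 1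
  have b1 := mul_le_mul_of_nonneg_left e3 hL0
  have b2 := mul_le_mul_of_nonneg_right e4
    (show 0 ≤ L * (k * (momentConst k 1 * (n * p))) by positivity)
  refine (add_le_add b1 b2).trans (le_of_eq ?_)
  have hpow : ((n : ℝ) * p) ^ k = (n * p) ^ (k - 1) * (n * p) := by
    rw [← pow_succ]; congr 1; omega
  rw [hpow]
  ring

/-- The excess is nearly uncorrelated with the Betti number. -/
lemma abs_integral_excess_mul_sub_le (hk : 3 ≤ k) (hr : 0 ≤ r) (hp0 : 0 ≤ p)
    (hp : ∀ y, μ (Metric.closedBall y (2 * r * k)) ≤ ENNReal.ofReal p) (hn : n * p ≤ 1)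
    {g : ℕ → ℝ} {L : ℝ} (hL : ∀ m, |g (m + 1) - g m| ≤ L) :
    |∫ x : Fin n → E, bettiExcess x r k Finset.univ * g ((cechComplex x r).betti (k - 2))
        ∂(Measure.pi fun _ => μ) -
      (∫ x : Fin n → E, bettiExcess x r k Finset.univ ∂(Measure.pi fun _ => μ)) *
        ∫ x : Fin n → E, g ((cechComplex x r).betti (k - 2) + 1) ∂(Measure.pi fun _ => μ)|
      ≤ (8 * momentConst (k + k) k + 2 * momentConst k k) * L * (n * (n * p) ^ k) := by
  classical
  have hL0 : 0 ≤ L := (abs_nonneg _).trans (hL 0)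
  set ν : Measure (Fin n → E) := Measure.pi fun _ => μ with hν
  have hR : 2 * r ≤ 2 * r * k := two_mul_le_two_mul_mul hk hr
  let N : (Fin n → E) → ℕ := fun x => (cechComplex x r).betti (k - 2)
  let D : (Fin n → E) → ℝ := fun x => bettiExcess x r k Finset.univ
  let ΦD : PreAbstractSimplicialComplex (Fin n) → ℝ := fun K =>
    ((K.induce Finset.univ).betti (k - 2) : ℝ) -
      (((Finset.univ.powersetCard k).filter fun σ => K.IsHole σ).card : ℝ)
  have hDΦ : ∀ x, D x = ΦD (cechComplex x r) := fun x => by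
    simp only [D, ΦD, bettiExcess, inducedBetti, holes]
  have hDm : Measurable D := by
    have : D = fun x => ΦD (cechComplex x r) := funext hDΦ
    rw [this]; exact measurable_cech ΦD
  have hGm : Measurable fun x => g (N x) := measurable_cech fun K => g (K.betti (k - 2))
  obtain ⟨CF, hCF⟩ := (Set.finite_range fun K => |ΦD K|).bddAbove
  obtain ⟨CG, hCG⟩ := (Set.finite_range
    fun K : PreAbstractSimplicialComplex (Fin n) => |g (K.betti (k - 2))|).bddAbove
  let M : Fin n → (Fin n × Bool → E) → ℕ := fun m Y =>
    pairCount Y (2 * r * k) (m, false) (m, true) (Finset.univ.filter fun q => q.1 ≠ m)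
  -- The factor `8` is `4 * 2`: resampling a point changes the excess by at most four truncated
  -- powers and `β` by at most twice the `k`-th power. Only the excess carries the cutoff at `k`.
  have hcov := abs_covariance_le μ hDm hGm (CF := CF) (CG := CG)
    (fun x => by rw [hDΦ]; exact hCF ⟨_, rfl⟩) (fun x => hCG ⟨_, rfl⟩)
    (B := fun m Y => 8 * L * thresholdPow (k + k) k (M m Y))
    (fun m => (integrable_pairCount _ _ _ _ _).const_mul _) (by
      intro m Y s s' t t' hst hst'
      have h1 := abs_sub_of_eq_off (Φ := fun x I => bettiExcess x r k I)
        (fun x x' I h => bettiExcess_congr h) (τ := fun N => 2 * thresholdPow k k N)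
        (R := 2 * r * k) (fun a b h => mul_le_mul_of_nonneg_left (thresholdPow_mono _ _ h)
          zero_le_two)
        (fun x v => abs_bettiExcess_sub_erase_le hk hr Finset.univ v) hst Y
      have h2 := abs_sub_of_eq_off (Φ := fun x I => inducedBetti x r k I)
        (fun x x' I h => inducedBetti_congr h) (τ := fun N => thresholdPow k 1 N)
        (R := 2 * r * k) (fun a b h => thresholdPow_mono _ _ h)
        (fun x v => abs_inducedBetti_sub_erase_le hk hR v Finset.univ) hst' Y
      have h3 : |g (N (select s' Y)) - g (N (select t' Y))| ≤ L * (2 * (1 + M m Y : ℝ) ^ k) := by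
        refine (abs_sub_le_of_increments hL _ _).trans (mul_le_mul_of_nonneg_left ?_ hL0)
        simp only [inducedBetti_univ] at h2
        refine h2.trans (mul_le_mul_of_nonneg_left ?_ zero_le_two)
        rw [← thresholdPow_zero]
        exact thresholdPow_le_of_le k (Nat.zero_le 1) _
      have h4 := thresholdPow_nonneg k k (M m Y)
      refine (mul_le_mul h1 h3 (abs_nonneg _) (by positivity)).trans (le_of_eq ?_)
      rw [← thresholdPow_mul]
      ring)
  have hBsum : ∑ m : Fin n, ∫ Y, 8 * L * thresholdPow (k + k) k (M m Y) ∂(Measure.pi fun _ => μ) ≤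
      n * (8 * L * (momentConst (k + k) k * (n * p) ^ k)) := by
    have : ∀ m ∈ (Finset.univ : Finset (Fin n)),
        ∫ Y, 8 * L * thresholdPow (k + k) k (M m Y) ∂(Measure.pi fun _ => μ) ≤
        8 * L * (momentConst (k + k) k * (n * p) ^ k) := by
      intro m _
      rw [integral_const_mul]
      refine mul_le_mul_of_nonneg_left ?_ (by positivity)
      refine integral_thresholdPow_le hp0 hp (by simp) (by simp) ?_ hn (k + k) k
      refine (Finset.card_le_univ _).trans ?_
      simp
      omega
    refine (Finset.sum_le_card_nsmul _ _ _ this).trans ?_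
    simp
  have higN : Integrable (fun x => g (N x)) ν := integrable_cech fun K => g (K.betti (k - 2))
  have hig : Integrable (fun x => g (N x + 1)) ν := integrable_cech fun K => g (K.betti (k - 2) + 1)
  -- Passing from `g β` to `g (β + 1)` costs only `L`, since it is multiplied by the small mean of
  -- the excess.
  have hg1 : |∫ x, g (N x) ∂ν - ∫ x, g (N x + 1) ∂ν| ≤ L := by
    rw [← integral_sub higN hig]
    refine abs_integral_le_integral_abs.trans ?_
    refine (integral_mono (higN.sub hig).abs (integrable_const L) fun x => ?_).trans (by simp)
    change |g (N x) - g (N x + 1)| ≤ L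
    rw [abs_sub_comm]
    exact hL _
  have hD1 : |∫ x, D x ∂ν| ≤ n * (2 * momentConst k k * (n * p) ^ k) :=
    abs_integral_le_integral_abs.trans (integral_abs_bettiExcess_le hk hr hp0 hp hn)
  calc _ = |(∫ x, D x * g (N x) ∂ν - (∫ x, D x ∂ν) * ∫ x, g (N x) ∂ν) +
        (∫ x, D x ∂ν) * (∫ x, g (N x) ∂ν - ∫ x, g (N x + 1) ∂ν)| := by
        congr 1; ring
    _ ≤ n * (8 * L * (momentConst (k + k) k * (n * p) ^ k)) +
        n * (2 * momentConst k k * (n * p) ^ k) * L := by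
        refine (abs_add_le _ _).trans (add_le_add (hcov.trans hBsum) ?_)
        rw [abs_mul]
        exact mul_le_mul hD1 hg1 (abs_nonneg _) ((abs_nonneg _).trans hD1)
    _ = _ := by ring

/-- The constant of `abs_stein_le`. -/
def steinConst (k : ℕ) : ℝ :=
  2 ^ (k + 1) * momentConst (k + k) k + momentConst k (k - 1) * k * momentConst k 1 +
    (8 * momentConst (k + k) k + 2 * momentConst k k)

/-- The Betti number nearly satisfies the Stein identity of the Poisson distribution. -/
theorem abs_stein_le (hk : 3 ≤ k) (hr : 0 ≤ r) (hp0 : 0 ≤ p)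
    (hp : ∀ y, μ (Metric.closedBall y (2 * r * k)) ≤ ENNReal.ofReal p) (hn : n * p ≤ 1)
    {g : ℕ → ℝ} {L : ℝ} (hL : ∀ m, |g (m + 1) - g m| ≤ L) :
    |∫ x : Fin n → E, ((cechComplex x r).betti (k - 2) : ℝ) * g ((cechComplex x r).betti (k - 2))
        ∂(Measure.pi fun _ => μ) -
      (∫ x : Fin n → E, ((cechComplex x r).betti (k - 2) : ℝ) ∂(Measure.pi fun _ => μ)) *
        ∫ x : Fin n → E, g ((cechComplex x r).betti (k - 2) + 1) ∂(Measure.pi fun _ => μ)|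
      ≤ steinConst k * L * (n * (n * p) ^ k) := by
  classical
  have h1 := abs_integral_holes_mul_sub_le (μ := μ) hk hr hp0 hp hn hL
  have h2 := abs_integral_excess_mul_sub_le (μ := μ) hk hr hp0 hp hn hL
  have hb : ∀ x : Fin n → E, ((cechComplex x r).betti (k - 2) : ℝ) =
      (holes x r k Finset.univ).card + bettiExcess x r k Finset.univ := by
    intro x
    rw [bettiExcess, inducedBetti_univ]; ring
  have e1 : ∫ x : Fin n → E, ((cechComplex x r).betti (k - 2) : ℝ) *
      g ((cechComplex x r).betti (k - 2)) ∂(Measure.pi fun _ => μ) =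
      ∫ x : Fin n → E, ((holes x r k Finset.univ).card : ℝ) * g ((cechComplex x r).betti (k - 2))
        ∂(Measure.pi fun _ => μ) +
      ∫ x : Fin n → E, bettiExcess x r k Finset.univ * g ((cechComplex x r).betti (k - 2))
        ∂(Measure.pi fun _ => μ) := by
    rw [← integral_add]
    · refine integral_congr_ae (Filter.Eventually.of_forall fun x => ?_)
      dsimp only
      rw [← add_mul, ← hb]
    · exact integrable_cech fun K =>
        (((Finset.univ.powersetCard k).filter fun σ => K.IsHole σ).card : ℝ) * g (K.betti (k - 2))
    · exact integrable_cech fun K => (((K.induce Finset.univ).betti (k - 2) : ℝ) -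
        (((Finset.univ.powersetCard k).filter fun σ => K.IsHole σ).card : ℝ)) *
          g (K.betti (k - 2))
  have e2 : ∫ x : Fin n → E, ((cechComplex x r).betti (k - 2) : ℝ) ∂(Measure.pi fun _ => μ) =
      ∫ x : Fin n → E, ((holes x r k Finset.univ).card : ℝ) ∂(Measure.pi fun _ => μ) +
      ∫ x : Fin n → E, bettiExcess x r k Finset.univ ∂(Measure.pi fun _ => μ) := by
    rw [← integral_add (integrable_card_holes _) (integrable_bettiExcess _)]
    exact integral_congr_ae (Filter.Eventually.of_forall hb)
  rw [e1, e2, steinConst, add_mul, add_mul, add_mul]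
  rw [add_sub_add_comm]
  exact (abs_add_le _ _).trans (add_le_add h1 h2)

end Key

/-! ### The Poisson Stein equation and the total variation bound -/

section PoissonStein

/-- The solution of the Stein equation of the Poisson distribution with bounded increments. -/
theorem exists_stein_solution_of_mem_unit {lam : ℝ≥0} (hlam : 0 < lam) {h : ℕ → ℝ}
    (h0 : ∀ j, 0 ≤ h j) (h1 : ∀ j, h j ≤ 1) :
    ∃ g : ℕ → ℝ, (∀ j, |g (j + 1) - g j| ≤ 1 / lam) ∧
      ∀ j : ℕ, lam * g (j + 1) - j * g j = h j - ∫ i, h i ∂(poissonMeasure lam) := by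
  set w : ℕ → ℝ := fun j => Real.exp (-lam) * lam ^ j / (j.factorial : ℝ) with hw
  have hL : (0 : ℝ) < lam := by exact_mod_cast hlam
  have hwpos : ∀ j, 0 < w j := fun j => by simp only [hw]; positivity
  have hrec : ∀ j : ℕ, ((j : ℝ) + 1) * w (j + 1) = lam * w j := by
    intro j
    simp only [hw, Nat.factorial_succ]
    push_cast
    field_simp
    ring
  have hsum : HasSum w 1 := hasSum_one_poissonMeasure lam
  -- partial sums
  let A : ℕ → ℝ := fun i => ∑ l ∈ Finset.range i, w l
  have hA0 : ∀ i, 0 ≤ A i := fun i => Finset.sum_nonneg fun l _ => (hwpos l).le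
  have hAsucc : ∀ i, A (i + 1) = A i + w i := fun i => Finset.sum_range_succ _ _
  have hlow : ∀ i : ℕ, lam * A i ≤ i * A (i + 1) := by
    intro i
    simp only [A]
    rw [Finset.mul_sum, Finset.sum_range_succ', mul_add, Finset.mul_sum]
    have : ∑ l ∈ Finset.range i, (lam : ℝ) * w l ≤ ∑ l ∈ Finset.range i, (i : ℝ) * w (l + 1) := by
      refine Finset.sum_le_sum fun l hl => ?_
      rw [← hrec]
      have : (l : ℝ) + 1 ≤ i := by exact_mod_cast Finset.mem_range.1 hl
      exact mul_le_mul_of_nonneg_right this (hwpos _).le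
    have h2 : 0 ≤ (i : ℝ) * w 0 := mul_nonneg (Nat.cast_nonneg i) (hwpos 0).le
    linarith
  have htail : ∀ i : ℕ, i * (1 - A (i + 1)) ≤ lam * (1 - A i) := by
    intro i
    have e1 : HasSum (fun l => w (l + i)) (1 - A i) := by
      rw [hasSum_nat_add_iff' i]; exact hsum
    have e2 : HasSum (fun l => w (l + (i + 1))) (1 - A (i + 1)) := by
      rw [hasSum_nat_add_iff' (i + 1)]; exact hsum
    refine hasSum_le (fun l => ?_) (e2.mul_left (i : ℝ)) (e1.mul_left (lam : ℝ))
    rw [← add_assoc, ← hrec]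
    refine mul_le_mul_of_nonneg_right ?_ (hwpos _).le
    push_cast
    linarith [(Nat.cast_nonneg l : (0 : ℝ) ≤ l)]
  have htail0 : ∀ i, 0 ≤ 1 - A i := fun i => by
    have := sum_le_hasSum (Finset.range i) (fun l _ => (hwpos l).le) hsum
    simp only [A]; linarith
  -- the solution for a general function with values in the unit interval
  let U : (ℕ → ℝ) → ℕ → ℝ := fun f i => ∑ l ∈ Finset.range i, w l * f l
  -- This is the forward solution of the recursion: `φ f m j` plays the role of the value at `j +
  -- 1`.
  let φ : (ℕ → ℝ) → ℝ → ℕ → ℝ := fun f m j => (U f (j + 1) - m * A (j + 1)) / (lam * w j)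
  have hup : ∀ (f : ℕ → ℝ) (m : ℝ), (∀ j, 0 ≤ f j) → (∀ j, f j ≤ 1) →
      HasSum (fun l => w l * f l) m → ∀ j, φ f m (j + 1) - φ f m j ≤ 1 / lam := by
    intro f m hf0 hf1 hm j
    have hU0 : 0 ≤ U f (j + 1) :=
      Finset.sum_nonneg fun l _ => mul_nonneg (hwpos l).le (hf0 l)
    have hUs : U f (j + 1 + 1) = U f (j + 1) + w (j + 1) * f (j + 1) := Finset.sum_range_succ _ _
    have hT : 0 ≤ m - U f (j + 1 + 1) := by
      have := sum_le_hasSum (Finset.range (j + 1 + 1))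
        (fun l _ => mul_nonneg (hwpos l).le (hf0 l)) hm
      simp only [U]; linarith
    have q1 := htail (j + 1)
    have q2 := hlow (j + 1)
    have q3 := hrec j
    have hB := hwpos (j + 1)
    have hw0 := hwpos j
    have hC0 := htail0 (j + 1 + 1)
    have hA0' := hA0 (j + 1)
    simp only [φ]
    rw [← hrec j]
    rw [hAsucc (j + 1)] at *
    rw [hUs] at *
    set u := U f (j + 1)
    set B := w (j + 1)
    set a := A (j + 1)
    set v := f (j + 1)
    have hv0 : 0 ≤ v := hf0 _
    have hv1 : v ≤ 1 := hf1 _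
    push_cast at q1 q2
    set i : ℝ := (j : ℝ) + 1
    have hi : 0 < i := by positivity
    have hlB : (0 : ℝ) < lam * B := by positivity
    have hiB : (0 : ℝ) < i * B := by positivity
    rw [div_sub_div _ _ hlB.ne' hiB.ne', div_le_div_iff₀ (by positivity) hL]
    have t1 : 0 ≤ u * (lam * (1 - a) - i * (1 - (a + B))) := mul_nonneg hU0 (by linarith)
    have t2 : 0 ≤ (m - (u + B * v)) * (i * (a + B) - lam * a) := mul_nonneg hT (by linarith)
    have t3 : 0 ≤ B * (1 - v) * (i * (1 - (a + B)) + lam * a) :=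
      mul_nonneg (mul_nonneg hB.le (by linarith)) (by positivity)
    have t4 : 0 ≤ B * (i * (a + B) - lam * a) := mul_nonneg hB.le (by linarith)
    have hlB' : (0 : ℝ) < lam * B := hlB
    -- Write `m` as `u + B * v` plus a nonnegative tail. The parts containing `u` and the tail have
    -- nonpositive coefficients by `htail` and `hlow`; the part containing `v` is largest at `v =
    -- 1`, where `hlow` bounds it by `i * B`.
    have key : ((u + B * v - m * (a + B)) * i - lam * (u - m * a)) ≤ i * B := by
      nlinarith [t1, t2, t3, t4]
    have := mul_le_mul_of_nonneg_left key hlB.le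
    nlinarith [this]
  have hbd : ∀ j, |h j| ≤ 1 := fun j => abs_le.2 ⟨by linarith [h0 j], h1 j⟩
  have hint : Integrable h (poissonMeasure lam) :=
    Integrable.of_bound (Measurable.of_discrete (f := h)).aestronglyMeasurable 1
      (Filter.Eventually.of_forall hbd)
  set m := ∫ i, h i ∂(poissonMeasure lam) with hmdef
  have hm : HasSum (fun l => w l * h l) m := by
    have := hasSum_integral_poissonMeasure hint
    simpa [hw] using this
  have hm' : HasSum (fun l => w l * (1 - h l)) (1 - m) := by
    simp only [mul_sub, mul_one]
    exact hsum.sub hm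
  -- Replacing `h` by `1 - h` negates the solution, so the upper bound on increments also yields the
  -- lower one.
  have hneg : ∀ j, φ (fun l => 1 - h l) (1 - m) j = -φ h m j := by
    intro j
    simp only [φ]
    rw [← neg_div]
    congr 1
    have : U (fun l => 1 - h l) (j + 1) = A (j + 1) - U h (j + 1) := by
      simp only [U, A, mul_sub, mul_one, Finset.sum_sub_distrib]
    rw [this]; ring
  -- Truncated subtraction gives the solution equal values at `0` and `1`, so the first increment
  -- vanishes; the value at `0` is multiplied by `0` in the equation.
  refine ⟨fun j => φ h m (j - 1), fun j => ?_, fun j => ?_⟩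
  · cases j with
    | zero => simp
    | succ j =>
      simp only [Nat.add_sub_cancel]
      have b1 := hup h m h0 h1 hm j
      have b2 := hup (fun l => 1 - h l) (1 - m) (fun j => by linarith [h1 j])
        (fun j => by linarith [h0 j]) hm' j
      rw [hneg, hneg] at b2
      rw [abs_le]
      constructor <;> linarith
  · cases j with
    | zero =>
      simp only [φ, U, A, zero_add, Nat.cast_zero, zero_mul, sub_zero]
      have := hwpos 0
      field_simp
      simp only [Nat.sub_self, zero_add, Finset.sum_range_one]
      ring
    | succ j =>
      simp only [Nat.add_sub_cancel, φ]
      have e1 : U h (j + 1 + 1) = U h (j + 1) + w (j + 1) * h (j + 1) := Finset.sum_range_succ _ _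
      rw [e1, hAsucc (j + 1), ← hrec j]
      have := hwpos (j + 1)
      push_cast
      field_simp
      ring

variable {E : Type*} [PseudoMetricSpace E] [SecondCountableTopology E] [MeasurableSpace E]
  [BorelSpace E] [ProperSpace E] {μ : Measure E} [IsProbabilityMeasure μ] {n k : ℕ} {r p : ℝ}

/-- The distance of the law of the Betti number to the Poisson law. -/
theorem abs_integral_betti_sub_poisson_le (hk : 3 ≤ k) (hr : 0 ≤ r) (hp0 : 0 ≤ p)
    (hp : ∀ y, μ (Metric.closedBall y (2 * r * k)) ≤ ENNReal.ofReal p) (hn : n * p ≤ 1)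
    {h : ℕ → ℝ} (hh : ∀ j, |h j| ≤ 1) {lam : ℝ}
    (hlam : lam = ∫ x : Fin n → E, ((cechComplex x r).betti (k - 2) : ℝ) ∂(Measure.pi fun _ => μ))
    (hpos : 0 < lam) :
    |∫ x : Fin n → E, h ((cechComplex x r).betti (k - 2)) ∂(Measure.pi fun _ => μ) -
      ∫ j, h j ∂(poissonMeasure lam.toNNReal)| ≤ 2 * steinConst k * (n * (n * p) ^ k) / lam := by
  set ν : Measure (Fin n → E) := Measure.pi fun _ => μ with hν
  let N : (Fin n → E) → ℕ := fun x => (cechComplex x r).betti (k - 2)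
  have hc : ((lam.toNNReal : ℝ≥0) : ℝ) = lam := Real.coe_toNNReal _ hpos.le
  -- Rescaling the test function from `[-1, 1]` to `[0, 1]` causes the factor `2` in the bound.
  obtain ⟨g, hg1, hg2⟩ := exists_stein_solution_of_mem_unit (lam := lam.toNNReal)
    (Real.toNNReal_pos.2 hpos) (h := fun j => (h j + 1) / 2)
    (fun j => by linarith [(abs_le.1 (hh j)).1]) (fun j => by linarith [(abs_le.1 (hh j)).2])
  rw [hc] at hg1 hg2
  have hstein := abs_stein_le (μ := μ) hk hr hp0 hp hn hg1
  rw [← hν, ← hlam] at hstein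
  have hinth : Integrable h (poissonMeasure lam.toNNReal) :=
    Integrable.of_bound (Measurable.of_discrete (f := h)).aestronglyMeasurable 1
      (Filter.Eventually.of_forall hh)
  have e1 : ∫ j, (h j + 1) / 2 ∂(poissonMeasure lam.toNNReal) =
      (∫ j, h j ∂(poissonMeasure lam.toNNReal) + 1) / 2 := by
    rw [integral_div, integral_add hinth (integrable_const _)]
    simp
  rw [e1] at hg2
  have i1 : Integrable (fun x => g (N x + 1)) ν := integrable_cech fun K => g (K.betti (k - 2) + 1)
  have i2 : Integrable (fun x => (N x : ℝ) * g (N x)) ν :=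
    integrable_cech fun K => (K.betti (k - 2) : ℝ) * g (K.betti (k - 2))
  have i3 : Integrable (fun x => h (N x)) ν := integrable_cech fun K => h (K.betti (k - 2))
  have e2 : ∫ x, h (N x) ∂ν - ∫ j, h j ∂(poissonMeasure lam.toNNReal) =
      2 * (lam * ∫ x, g (N x + 1) ∂ν - ∫ x, (N x : ℝ) * g (N x) ∂ν) := by
    rw [← integral_const_mul, ← integral_sub (i1.const_mul lam) i2, ← integral_const_mul]
    have : ∀ x, 2 * (lam * g (N x + 1) - (N x : ℝ) * g (N x)) =
        h (N x) - ∫ j, h j ∂(poissonMeasure lam.toNNReal) := by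
      intro x
      rw [hg2]; ring
    simp_rw [this]
    rw [integral_sub i3 (integrable_const _)]
    simp
  change |∫ x, h (N x) ∂ν - ∫ j, h j ∂(poissonMeasure lam.toNNReal)| ≤ _
  rw [e2, abs_mul, abs_two, abs_sub_comm]
  calc 2 * |∫ x, (N x : ℝ) * g (N x) ∂ν - lam * ∫ x, g (N x + 1) ∂ν|
      ≤ 2 * (steinConst k * (1 / lam) * (n * (n * p) ^ k)) :=
        mul_le_mul_of_nonneg_left hstein zero_le_two
    _ = _ := by ring

end PoissonStein

/-! ### Hollow simplices that survive perturbation -/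

section StableHole

/-- The squared distance is `1 - 2 * ε * inner ℝ q y + ε ^ 2 * ‖q‖ ^ 2`, and the linear term wins
for small `ε`. -/
lemma dist_lt_one_of_inner {d : ℕ} {q y : EuclideanSpace ℝ (Fin d)} (hy : ‖y‖ = 1)
    (hq : 0 < inner ℝ q y) : ∀ᶠ ε in 𝓝[>] (0 : ℝ), dist (ε • q) y < 1 := by
  have hlim : Tendsto (fun ε : ℝ => ε * ‖q‖ ^ 2) (𝓝[>] 0) (𝓝 (0 * ‖q‖ ^ 2)) :=
    (tendsto_id.mul_const _).mono_left nhdsWithin_le_nhds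
  rw [zero_mul] at hlim
  filter_upwards [hlim.eventually (gt_mem_nhds (show (0 : ℝ) < 2 * inner ℝ q y by positivity)),
    self_mem_nhdsWithin] with ε h1 h2
  have hε : (0 : ℝ) < ε := h2
  rw [dist_eq_norm, ← sq_lt_one_iff₀ (norm_nonneg _), norm_sub_sq_real, hy, norm_smul,
    real_inner_smul_left, Real.norm_eq_abs, abs_of_pos hε]
  nlinarith

/-- Points at unit distance from the origin, not all within a distance less than one from any point,
but all except one of them are. -/
theorem exists_stable_hole {d m : ℕ} (hm : 2 ≤ m) (hmd : m ≤ d) :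
    ∃ (y : Fin (m + 1) → EuclideanSpace ℝ (Fin d)) (ρ : ℝ), 0 ≤ ρ ∧ ρ < 1 ∧
      (∀ p, ∃ i, 1 ≤ dist p (y i)) ∧ ∀ j, ∃ p, ∀ i, i ≠ j → dist p (y i) ≤ ρ := by
  have hm0 : (0 : ℝ) < m := by exact_mod_cast (by omega : 0 < m)
  let e : Fin m → EuclideanSpace ℝ (Fin d) := fun i => EuclideanSpace.single (Fin.castLE hmd i) 1
  have hinj : Function.Injective (Fin.castLE hmd) := Fin.castLE_injective hmd
  have hein : ∀ i (p : EuclideanSpace ℝ (Fin d)), inner ℝ p (e i) = p (Fin.castLE hmd i) := by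
    intro i p
    simp [e, EuclideanSpace.inner_single_right]
  have hee : ∀ i j, inner ℝ (e i) (e j) = if i = j then (1 : ℝ) else 0 := by
    intro i j
    rw [hein]
    simp only [e, PiLp.single_apply]
    simp [hinj.eq_iff, eq_comm]
  let s : EuclideanSpace ℝ (Fin d) := ∑ i, e i
  have hse : ∀ i, inner ℝ s (e i) = (1 : ℝ) := by
    intro i
    simp only [s]
    rw [sum_inner]
    simp [hee]
  have hss : inner ℝ s s = (m : ℝ) := by
    conv_lhs => rw [show s = ∑ i, e i from rfl]
    rw [inner_sum]
    simp [← show s = ∑ i, e i from rfl, hse]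
  -- Orthonormal vectors together with the negative of their normalized sum: `m + 1` unit vectors
  -- with a positive linear dependence.
  let y₀ : EuclideanSpace ℝ (Fin d) := (-(1 / √m)) • s
  have hsq : (0 : ℝ) < √m := Real.sqrt_pos.2 hm0
  have hy0 : ‖y₀‖ = 1 := by
    rw [← pow_eq_one_iff_of_nonneg (norm_nonneg _) two_ne_zero, ← real_inner_self_eq_norm_sq]
    simp only [y₀]
    rw [real_inner_smul_left, real_inner_smul_right, hss]
    field_simp
    rw [Real.sq_sqrt hm0.le]
  let y : Fin (m + 1) → EuclideanSpace ℝ (Fin d) := Fin.cons y₀ e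
  have hy1 : ∀ i, ‖y i‖ = 1 := by
    intro i
    refine Fin.cases ?_ (fun i => ?_) i
    · simpa [y] using hy0
    · simp [y, e]
  -- A point closer than one to every `y i` would have positive inner product with all of them,
  -- contradicting the dependence.
  have hfar : ∀ p, ∃ i, 1 ≤ dist p (y i) := by
    intro p
    by_contra hcon
    push Not at hcon
    have hpos : ∀ i, 0 < inner ℝ p (y i) := by
      intro i
      have := hcon i
      rw [dist_eq_norm, ← sq_lt_one_iff₀ (norm_nonneg _), norm_sub_sq_real, hy1] at this
      nlinarith [sq_nonneg ‖p‖]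
    have h0 := hpos 0
    have h1 : inner ℝ p y₀ = -(1 / √m) * ∑ i, inner ℝ p (e i) := by
      simp only [y₀, s]
      rw [real_inner_smul_right, inner_sum]
    have h2 : 0 < ∑ i : Fin m, inner ℝ p (e i) := by
      have hne : (Finset.univ : Finset (Fin m)).Nonempty := ⟨⟨0, by omega⟩, Finset.mem_univ _⟩
      exact Finset.sum_pos (fun i _ => by simpa [y] using hpos i.succ) hne
    have h3 : (0 : ℝ) < 1 / √m := by positivity
    simp only [y, Fin.cons_zero] at h0
    rw [h1] at h0
    nlinarith
  have hdir : ∀ j, ∃ q : EuclideanSpace ℝ (Fin d), ∀ i, i ≠ j → 0 < inner ℝ q (y i) := by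
    intro j
    refine Fin.cases ?_ (fun j => ?_) j
    · refine ⟨s, fun i => ?_⟩
      refine Fin.cases (fun h => absurd rfl h) (fun i _ => ?_) i
      simp only [y, Fin.cons_succ, hse]
      norm_num
    -- This vector has inner product `1` with every other `e i` and `-1` with `s`, hence `1 / √m`
    -- with `y₀`.
    · refine ⟨s - ((m : ℝ) + 1) • e j, fun i => ?_⟩
      refine Fin.cases (fun _ => ?_) (fun i hi => ?_) i
      · simp only [y, Fin.cons_zero, y₀]
        rw [real_inner_smul_right, inner_sub_left, real_inner_smul_left, hss,
          real_inner_comm, hse]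
        have : (0 : ℝ) < 1 / √m := by positivity
        nlinarith
      · have hij : j ≠ i := fun h => hi (h ▸ rfl)
        simp only [y, Fin.cons_succ]
        rw [inner_sub_left, real_inner_smul_left, hse, hee, if_neg hij]
        norm_num
  have hnear : ∀ j, ∃ p, ∀ i, i ≠ j → dist p (y i) < 1 := by
    intro j
    obtain ⟨q, hq⟩ := hdir j
    have : ∀ᶠ ε in 𝓝[>] (0 : ℝ), ∀ i, i ≠ j → dist (ε • q) (y i) < 1 := by
      rw [Filter.eventually_all]
      intro i
      by_cases h : i = j
      · exact Filter.Eventually.of_forall fun _ hne => absurd h hne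
      · filter_upwards [dist_lt_one_of_inner (hy1 i) (hq i h)] with ε hε _ using hε
    obtain ⟨ε, hε⟩ := this.exists
    exact ⟨_, hε⟩
  choose p hp using hnear
  have : ∀ᶠ ρ in 𝓝[<] (1 : ℝ), ∀ j i, i ≠ j → dist (p j) (y i) < ρ := by
    rw [Filter.eventually_all]
    intro j
    rw [Filter.eventually_all]
    intro i
    by_cases h : i = j
    · exact Filter.Eventually.of_forall fun _ hne => absurd h hne
    · filter_upwards [Ioo_mem_nhdsLT (hp j i h)] with ρ hρ _ using hρ.1
  obtain ⟨ρ, h1, h2⟩ := (this.and (Ioo_mem_nhdsLT (zero_lt_one (α := ℝ)))).exists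
  exact ⟨y, ρ, h2.1.le, h2.2, hfar, fun j => ⟨p j, fun i hi => (h1 j i hi).le⟩⟩

/-- Points close to a rescaled stable hole form a hole of the Čech complex. -/
lemma isHole_of_near_stable {d m : ℕ} {y : Fin (m + 1) → EuclideanSpace ℝ (Fin d)} {ρ : ℝ}
    (hm : 1 ≤ m) (hρ0 : 0 ≤ ρ) (hρ : ρ < 1) (hfar : ∀ p, ∃ i, 1 ≤ dist p (y i))
    (hnear : ∀ j, ∃ p, ∀ i, i ≠ j → dist p (y i) ≤ ρ) {r : ℝ} (hr : 0 < r)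
    {x : Fin (m + 1) → EuclideanSpace ℝ (Fin d)} {a : EuclideanSpace ℝ (Fin d)}
    (hx : ∀ i, dist (x i) (a + (2 * r / (1 + ρ)) • y i) ≤ (1 - ρ) / 4 * (2 * r / (1 + ρ))) :
    (cechComplex x r).IsHole Finset.univ := by
  -- At this scale `r` is midway between `s * ρ` and `s`. The margin `s * (1 - ρ) / 2` on either
  -- side exceeds the allowed displacement.
  set s : ℝ := 2 * r / (1 + ρ) with hs
  have hs0 : 0 < s := by positivity
  have hrs : r = s * ((1 + ρ) / 2) := by rw [hs]; field_simp
  have hscale : ∀ p q : EuclideanSpace ℝ (Fin d), dist (a + s • p) (a + s • q) = s * dist p q := by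
    intro p q
    rw [dist_add_left, dist_smul₀, Real.norm_eq_abs, abs_of_pos hs0]
  constructor
  · rintro ⟨-, p, hp⟩
    obtain ⟨i, hi⟩ := hfar (s⁻¹ • (p - a))
    have h1 := hscale (s⁻¹ • (p - a)) (y i)
    rw [smul_inv_smul₀ hs0.ne', add_sub_cancel] at h1
    have h2 : dist p (x i) ≤ r := Set.mem_iInter₂.1 hp i (Finset.mem_univ i)
    have h3 := dist_triangle p (x i) (a + s • y i)
    have h4 := hx i
    have h5 : s * 1 ≤ s * dist (s⁻¹ • (p - a)) (y i) := by gcongr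
    nlinarith
  · intro j _
    obtain ⟨p, hp⟩ := hnear j
    refine ⟨?_, a + s • p, Set.mem_iInter₂.2 fun i hi => ?_⟩
    · rw [← Finset.card_pos, Finset.card_erase_of_mem (Finset.mem_univ _)]
      simp
      omega
    · have h1 := hp i (Finset.mem_erase.1 hi).1
      rw [Metric.mem_closedBall]
      have h2 := dist_triangle_right (a + s • p) (x i) (a + s • y i)
      rw [hscale] at h2
      have h3 := hx i
      have h4 : s * dist p (y i) ≤ s * ρ := by gcongr
      nlinarith

end StableHole

/-! ### Lower bound for the probability of a hollow simplex -/

section LowerBound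

/-- A nonzero density is at least some `1 / (N + 1)` on a set of positive measure, which contains a
compact set of positive measure. -/
lemma exists_smul_restrict_le_withDensity {α : Type*} [MeasurableSpace α] [TopologicalSpace α]
    [OpensMeasurableSpace α] [T2Space α] {ν : Measure α} [ν.InnerRegular] {f : α → ℝ}
    (hf : Measurable f) (h0 : (ν.withDensity fun x => ENNReal.ofReal (f x)) ≠ 0) :
    ∃ t : ℝ, 0 < t ∧ ∃ S : Set α, IsCompact S ∧ 0 < ν S ∧
      ENNReal.ofReal t • ν.restrict S ≤ ν.withDensity fun x => ENNReal.ofReal (f x) := by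
  have hpos : ν {x | 0 < f x} ≠ 0 := by
    intro h
    apply h0
    rw [withDensity_eq_zero_iff (by fun_prop)]
    filter_upwards [measure_eq_zero_iff_ae_notMem.1 h] with x hx
    simpa using hx
  obtain ⟨N, hN⟩ : ∃ N : ℕ, ν {x | 1 / ((N : ℝ) + 1) ≤ f x} ≠ 0 := by
    by_contra! h
    apply hpos
    refine measure_mono_null ?_ (measure_iUnion_null h)
    intro x hx
    obtain ⟨N, hN⟩ := exists_nat_one_div_lt (show 0 < f x from hx)
    exact Set.mem_iUnion.2 ⟨N, hN.le⟩
  obtain ⟨S, hS, hSc, hS0⟩ := (measurableSet_le measurable_const hf :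
    MeasurableSet {x | 1 / ((N : ℝ) + 1) ≤ f x}).exists_lt_isCompact (pos_iff_ne_zero.2 hN)
  refine ⟨1 / ((N : ℝ) + 1), by positivity, S, hSc, hS0, Measure.le_iff.2 fun A hA => ?_⟩
  rw [Measure.smul_apply, Measure.restrict_apply hA, withDensity_apply _ hA, smul_eq_mul,
    ← setLIntegral_const]
  refine (setLIntegral_mono (by fun_prop) fun x hx => ?_).trans
    (lintegral_mono_set Set.inter_subset_left)
  exact ENNReal.ofReal_le_ofReal (hS hx.2)

variable {E : Type*} [NormedAddCommGroup E] [MeasurableSpace E] [BorelSpace E]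

/-- A compact set has an open neighbourhood of only slightly larger measure, and small translates of
its points stay in it. The points leaving `S` under one of the `m` translations thus have total
measure at most half that of `S`. -/
lemma exists_half_le_measure_translates {ν : Measure E}
    [ν.InnerRegularCompactLTTop] [IsLocallyFiniteMeasure ν] [ν.IsAddRightInvariant] {S : Set E}
    (hS : IsCompact S) (hS0 : 0 < ν S) (m : ℕ) :
    ∃ η : ℝ, 0 < η ∧ ∀ u : Fin m → E, (∀ i, ‖u i‖ < η) →
      ν S / 2 ≤ ν {x | x ∈ S ∧ ∀ i, x + u i ∈ S} := by
  have hfin : ν S ≠ ⊤ := hS.measure_lt_top.ne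
  obtain ⟨U, hSU, hU, hUε⟩ := hS.exists_isOpen_lt_add (μ := ν) (ε := ν S / 2 / (m + 1))
    (by simp [ENNReal.div_eq_zero_iff, hS0.ne', ENNReal.add_eq_top])
  obtain ⟨η, hη, hηU⟩ := hS.exists_thickening_subset_open hU hSU
  refine ⟨η, hη, fun u hu => ?_⟩
  have hd : ν (U \ S) ≤ ν S / 2 / (m + 1) := by
    rw [measure_sdiff hSU hS.measurableSet.nullMeasurableSet hfin, tsub_le_iff_left]
    exact hUε.le
  have hcov : S ⊆ {x | x ∈ S ∧ ∀ i, x + u i ∈ S} ∪ ⋃ i, (fun x => x + u i) ⁻¹' (U \ S) := by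
    intro x hx
    by_cases h : ∀ i, x + u i ∈ S
    · exact Or.inl ⟨hx, h⟩
    · push Not at h
      obtain ⟨i, hi⟩ := h
      refine Or.inr (Set.mem_iUnion.2 ⟨i, hηU ?_, hi⟩)
      exact Metric.mem_thickening_iff.2 ⟨x, hx, by simpa [dist_eq_norm] using hu i⟩
  have h1 : ν S ≤ ν {x | x ∈ S ∧ ∀ i, x + u i ∈ S} + ν S / 2 := by
    refine (measure_mono hcov).trans ((measure_union_le _ _).trans ?_)
    gcongr
    refine (measure_iUnion_fintype_le _ _).trans ?_
    calc ∑ i, ν ((fun x => x + u i) ⁻¹' (U \ S))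
        ≤ ∑ _i : Fin m, ν S / 2 / (m + 1) := by
          refine Finset.sum_le_sum fun i _ => ?_
          rw [measure_preimage_add_right]
          exact hd
      _ = m * (ν S / 2 / (m + 1)) := by simp
      _ ≤ (m + 1) * (ν S / 2 / (m + 1)) := by gcongr; exact le_self_add
      _ ≤ ν S / 2 := ENNReal.mul_div_le
  rw [← ENNReal.add_le_add_iff_right (a := ν S / 2)
    (ENNReal.div_ne_top hfin two_ne_zero), ENNReal.add_halves]
  exact h1

/-- Below `μ` lies `t` times `ν` on `S`. In coordinates consisting of a base point and
displacements, Fubini in the displacements yields a factor `v` from the base point and `ν (B i)`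
from each displacement. -/
lemma pi_translates_ge [SecondCountableTopology E] {ν μ : Measure E} [SigmaFinite ν]
    [ν.IsAddLeftInvariant]
    [SigmaFinite μ] {t v : ENNReal} {S : Set E} (hS : MeasurableSet S)
    (hμ : t • ν.restrict S ≤ μ) {m : ℕ} {B : Fin m → Set E} (hB : ∀ i, MeasurableSet (B i))
    (hv : ∀ u : Fin m → E, (∀ i, u i ∈ B i) → v ≤ ν {x | x ∈ S ∧ ∀ i, x + u i ∈ S}) :
    t ^ (m + 1) * (v * ∏ i, ν (B i)) ≤
      Measure.pi (fun _ : Fin (m + 1) => μ) {x | ∀ i, x i.succ - x 0 ∈ B i} := by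
  let A : Set (E × (Fin m → E)) := {z | z.1 ∈ S ∧ ∀ i, z.1 + z.2 i ∈ S ∧ z.2 i ∈ B i}
  have hA : MeasurableSet A := by
    refine (measurable_fst hS).inter ?_
    change MeasurableSet {z : E × (Fin m → E) | ∀ i, z.1 + z.2 i ∈ S ∧ z.2 i ∈ B i}
    rw [Set.ofPred_forall]
    refine MeasurableSet.iInter fun i => MeasurableSet.inter ?_ ?_
    · exact measurableSet_preimage (by fun_prop : Measurable fun z : E × (Fin m → E) =>
        z.1 + z.2 i) hS
    · exact measurableSet_preimage (by fun_prop : Measurable fun z : E × (Fin m → E) => z.2 i) (hB i)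
  have hH : MeasurableSet {z : E × (Fin m → E) | ∀ i, z.2 i - z.1 ∈ B i} := by
    rw [Set.ofPred_forall]
    exact MeasurableSet.iInter fun i => measurableSet_preimage
      (by fun_prop : Measurable fun z : E × (Fin m → E) => z.2 i - z.1) (hB i)
  have hlow : v * ∏ i, ν (B i) ≤ (ν.prod (Measure.pi fun _ : Fin m => ν)) A := by
    rw [Measure.prod_apply_symm hA, ← Measure.pi_pi, ← setLIntegral_const,
      ← lintegral_indicator (MeasurableSet.univ_pi hB)]
    refine lintegral_mono fun u => ?_
    by_cases hu : u ∈ Set.univ.pi B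
    · rw [Set.indicator_of_mem hu]
      refine (hv u fun i => hu i trivial).trans (measure_mono ?_)
      exact fun x hx => ⟨hx.1, fun i => ⟨hx.2 i, hu i trivial⟩⟩
    · simp [Set.indicator_of_notMem hu]
  have hpre : Measure.pi (fun _ : Fin (m + 1) => μ) {x | ∀ i, x i.succ - x 0 ∈ B i} =
      (μ.prod (Measure.pi fun _ : Fin m => μ)) {z | ∀ i, z.2 i - z.1 ∈ B i} := by
    rw [← (measurePreserving_piFinSuccAbove (fun _ : Fin (m + 1) => μ) 0).measure_preimage
      hH.nullMeasurableSet]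
    rfl
  have hle : ∀ C, MeasurableSet C → t * ν (S ∩ C) ≤ μ C := by
    intro C hC
    have := Measure.le_iff.1 hμ C hC
    rwa [Measure.smul_apply, Measure.restrict_apply hC, smul_eq_mul, Set.inter_comm] at this
  calc t ^ (m + 1) * (v * ∏ i, ν (B i))
      ≤ t ^ (m + 1) * (ν.prod (Measure.pi fun _ : Fin m => ν)) A := by gcongr
    _ = t * ∫⁻ x, t ^ m * Measure.pi (fun _ : Fin m => ν) (Prod.mk x ⁻¹' A) ∂ν := by
        rw [Measure.prod_apply hA, pow_succ', mul_assoc, lintegral_const_mul _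
          (measurable_measure_prodMk_left hA)]
    _ = t * ∫⁻ x in S, t ^ m * Measure.pi (fun _ : Fin m => ν) (Prod.mk x ⁻¹' A) ∂ν := by
        congr 1
        rw [← lintegral_indicator hS]
        refine lintegral_congr fun x => ?_
        by_cases hx : x ∈ S
        · rw [Set.indicator_of_mem hx]
        · rw [Set.indicator_of_notMem hx, show Prod.mk x ⁻¹' A = ∅ from ?_]
          · simp
          · exact Set.eq_empty_of_forall_notMem fun u hu => hx hu.1
    _ = ∫⁻ x, t ^ m * Measure.pi (fun _ : Fin m => ν) (Prod.mk x ⁻¹' A) ∂(t • ν.restrict S) := by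
        rw [lintegral_smul_measure, smul_eq_mul]
    _ ≤ ∫⁻ x, t ^ m * Measure.pi (fun _ : Fin m => ν) (Prod.mk x ⁻¹' A) ∂μ :=
        lintegral_mono' hμ le_rfl
    _ ≤ ∫⁻ x, Measure.pi (fun _ : Fin m => μ)
          (Prod.mk x ⁻¹' {z | ∀ i, z.2 i - z.1 ∈ B i}) ∂μ := by
        refine lintegral_mono fun x => ?_
        have hC : ∀ i, MeasurableSet {y | y - x ∈ B i} := fun i =>
          measurableSet_preimage (measurable_sub_const x) (hB i)
        have h1 : Measure.pi (fun _ : Fin m => ν) (Prod.mk x ⁻¹' A) ≤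
            ∏ i, ν (S ∩ {y | y - x ∈ B i}) := by
          rw [← Measure.pi_pi, ← measure_preimage_add _ (fun _ => x : Fin m → E) (Set.univ.pi _)]
          refine measure_mono fun u hu i _ => ⟨(hu.2 i).1, ?_⟩
          simpa using (hu.2 i).2
        have h2 : Prod.mk x ⁻¹' {z : E × (Fin m → E) | ∀ i, z.2 i - z.1 ∈ B i} =
            Set.univ.pi fun i => {y | y - x ∈ B i} := by
          ext u; simp
        rw [h2, Measure.pi_pi]
        calc _ ≤ t ^ m * ∏ i, ν (S ∩ {y | y - x ∈ B i}) := by gcongr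
          _ = ∏ i, (t * ν (S ∩ {y | y - x ∈ B i})) := by simp [Finset.prod_mul_distrib]
          _ ≤ _ := Finset.prod_le_prod' fun i _ => hle _ (hC i)
    _ = _ := by rw [hpre, Measure.prod_apply hH]

lemma exists_hole_measure_ge {d m : ℕ} (hm : 2 ≤ m) (hmd : m ≤ d)
    {f : EuclideanSpace ℝ (Fin d) → ℝ} (hf : Measurable f)
    [IsProbabilityMeasure (volume.withDensity fun x => ENNReal.ofReal (f x))] :
    ∃ c : ℝ, 0 < c ∧ ∃ r₀ : ℝ, 0 < r₀ ∧ ∀ r : ℝ, 0 < r → r ≤ r₀ →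
      ENNReal.ofReal (c * (r ^ d) ^ m) ≤
        Measure.pi (fun _ : Fin (m + 1) => volume.withDensity fun x => ENNReal.ofReal (f x))
          {x | (cechComplex x r).IsHole Finset.univ} := by
  obtain ⟨t, ht, S, hS, hS0, hμ⟩ := exists_smul_restrict_le_withDensity (ν := volume) hf
    (IsProbabilityMeasure.ne_zero _)
  obtain ⟨η, hη, hu⟩ := exists_half_le_measure_translates hS hS0 m
  obtain ⟨y, ρ, hρ0, hρ, hfar, hnear⟩ := exists_stable_hole hm hmd
  have hVfin : volume (Metric.ball (0 : EuclideanSpace ℝ (Fin d)) 1) ≠ ⊤ :=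
    measure_ball_lt_top.ne
  have hV0 : 0 < volume (Metric.ball (0 : EuclideanSpace ℝ (Fin d)) 1) :=
    Metric.measure_ball_pos _ _ one_pos
  have hSfin : volume S / 2 ≠ ⊤ := ENNReal.div_ne_top hS.measure_lt_top.ne two_ne_zero
  have hS2 : volume S / 2 ≠ 0 := by simp [ENNReal.div_eq_zero_iff, hS0.ne']
  set V : ℝ := (volume (Metric.ball (0 : EuclideanSpace ℝ (Fin d)) 1)).toReal with hV
  set w : ℝ := (volume S / 2).toReal with hw
  have hV' : 0 < V := ENNReal.toReal_pos hV0.ne' hVfin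
  have hw' : 0 < w := ENNReal.toReal_pos hS2 hSfin
  set q : ℝ := (1 - ρ) / 4 with hq
  have hq0 : 0 < q := by rw [hq]; linarith
  set R : ℝ := ∑ i : Fin m, ‖y i.succ - y 0‖ + q + 1 with hR
  have hR0 : 0 < R := by positivity
  -- Displacements are at most `s * R ≤ 2 * r * R`, hence at most `η / 2` for `r ≤ η / (4 * R)`.
  -- Each of the `m` balls has radius `q * s ≥ q * r`, which gives the power of `r ^ d`.
  refine ⟨t ^ (m + 1) * (w * (q ^ d * V) ^ m), by positivity, η / (4 * R), by positivity,
    fun r hr hr₀ => ?_⟩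
  set s : ℝ := 2 * r / (1 + ρ) with hs
  have hs0 : 0 < s := by positivity
  have hsr : r ≤ s := by rw [hs, le_div_iff₀ (by positivity)]; nlinarith
  have hs2 : s ≤ 2 * r := div_le_self (by positivity) (by linarith)
  let B : Fin m → Set (EuclideanSpace ℝ (Fin d)) := fun i =>
    Metric.closedBall (s • (y i.succ - y 0)) (q * s)
  have hsmall : ∀ u : Fin m → EuclideanSpace ℝ (Fin d), (∀ i, u i ∈ B i) → ∀ i, ‖u i‖ < η := by
    intro u hu i
    have h1 : ‖u i - s • (y i.succ - y 0)‖ ≤ q * s := by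
      rw [← dist_eq_norm]; exact hu i
    have h2 := norm_le_norm_add_norm_sub' (u i) (s • (y i.succ - y 0))
    rw [norm_smul, Real.norm_eq_abs, abs_of_pos hs0] at h2
    have h3 : ‖y i.succ - y 0‖ ≤ ∑ i : Fin m, ‖y i.succ - y 0‖ :=
      Finset.single_le_sum (f := fun i : Fin m => ‖y i.succ - y 0‖)
        (fun i _ => norm_nonneg _) (Finset.mem_univ i)
    rw [le_div_iff₀ (by positivity)] at hr₀
    have h4 : ‖u i‖ ≤ s * R := by
      have := mul_le_mul_of_nonneg_left h3 hs0.le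
      rw [hR]; nlinarith
    have h5 : s * R ≤ 2 * r * R := by gcongr
    nlinarith
  refine le_trans ?_ ((pi_translates_ge hS.measurableSet hμ (B := B)
    (fun i => Metric.isClosed_closedBall.measurableSet) fun u hu' => hu u (hsmall u hu')).trans
    (measure_mono ?_))
  · have hB : ∀ i, volume (B i) = ENNReal.ofReal ((q * s) ^ d * V) := by
      intro i
      rw [Measure.addHaar_closedBall _ _ (by positivity), finrank_euclideanSpace_fin,
        ENNReal.ofReal_mul (by positivity), hV, ENNReal.ofReal_toReal hVfin]
    simp only [hB, Finset.prod_const, Finset.card_univ, Fintype.card_fin]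
    rw [← ENNReal.ofReal_toReal hSfin, ← hw, ← ENNReal.ofReal_pow (by positivity),
      ← ENNReal.ofReal_pow (by positivity), ← ENNReal.ofReal_mul (by positivity),
      ← ENNReal.ofReal_mul (by positivity)]
    apply ENNReal.ofReal_le_ofReal
    calc _ = t ^ (m + 1) * (w * ((q * r) ^ d * V) ^ m) := by
          rw [mul_pow q r d, mul_right_comm (q ^ d), mul_pow _ (r ^ d)]; ring
      _ ≤ _ := by gcongr
  · intro x hx
    refine isHole_of_near_stable (by omega) hρ0 hρ hfar hnear hr (a := x 0 - s • y 0) fun i => ?_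
    refine Fin.cases ?_ (fun i => ?_) i
    · rw [← hs, sub_add_cancel, dist_self]; positivity
    · have h1 := hx i
      rw [Metric.mem_closedBall, dist_eq_norm] at h1
      rw [dist_eq_norm, ← hs]
      convert h1 using 2
      rw [smul_sub]; abel

end LowerBound

/-! ### Order of the expected Betti number -/

section ExpectedHoles

variable {E : Type*} [PseudoMetricSpace E]

lemma mem_cechComplex_comp {ι κ : Type*} (x : ι → E) (r : ℝ) (e : κ ↪ ι) (τ : Finset κ) :
    τ ∈ cechComplex (fun j => x (e j)) r ↔ τ.map e ∈ cechComplex x r := by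
  change (_ ∧ _) ↔ (_ ∧ _)
  simp

lemma isHole_cechComplex_comp {ι κ : Type*} [LinearOrder ι] [LinearOrder κ] (x : ι → E) (r : ℝ)
    (e : κ ↪ ι) (τ : Finset κ) :
    (cechComplex (fun j => x (e j)) r).IsHole τ ↔ (cechComplex x r).IsHole (τ.map e) := by
  simp only [PreAbstractSimplicialComplex.IsHole, mem_cechComplex_comp, Finset.map_erase,
    Finset.mem_map, forall_exists_index, and_imp, forall_apply_eq_imp_iff₂]

variable [ProperSpace E] [SecondCountableTopology E] [MeasurableSpace E] [BorelSpace E]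
  {μ : Measure E} [IsProbabilityMeasure μ]

lemma measurableSet_isHole {k : ℕ} (r : ℝ) (σ : Finset (Fin k)) :
    MeasurableSet {x : Fin k → E | (cechComplex x r).IsHole σ} :=
  measurableSet_preimage (measurable_cechComplex r) (MeasurableSet.of_discrete
    (s := {K : PreAbstractSimplicialComplex (Fin k) | K.IsHole σ}))

/-- The order embedding onto a `k`-subset preserves the product measure, so all subsets are hollow
with the same probability. -/
lemma integral_card_holes_eq (n k : ℕ) (r : ℝ) :
    ∫ x : Fin n → E, ((holes x r k Finset.univ).card : ℝ) ∂(Measure.pi fun _ => μ) =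
      n.choose k * (Measure.pi fun _ : Fin k => μ).real
        {x | (cechComplex x r).IsHole Finset.univ} := by
  classical
  have h1 : ∀ x : Fin n → E, ((holes x r k Finset.univ).card : ℝ) =
      ∑ σ ∈ Finset.univ.powersetCard k,
        Set.indicator {x : Fin n → E | (cechComplex x r).IsHole σ} (fun _ => (1 : ℝ)) x := by
    intro x
    simp only [holes, Finset.card_filter, Set.indicator_apply, Set.mem_ofPred_eq]
    push_cast
    exact Finset.sum_congr rfl fun σ _ => by congr
  simp only [h1]
  rw [integral_finsetSum _ fun σ _ =>
    (integrable_const (1 : ℝ)).indicator (measurableSet_isHole r σ)]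
  have h2 : ∀ σ ∈ (Finset.univ : Finset (Fin n)).powersetCard k,
      ∫ x : Fin n → E, Set.indicator {x : Fin n → E | (cechComplex x r).IsHole σ}
        (fun _ => (1 : ℝ)) x ∂(Measure.pi fun _ => μ) =
      (Measure.pi fun _ : Fin k => μ).real {x | (cechComplex x r).IsHole Finset.univ} := by
    intro σ hσ
    have hc := (Finset.mem_powersetCard.1 hσ).2
    rw [integral_indicator_const _ (measurableSet_isHole r σ), smul_eq_mul, mul_one]
    have hmp := measurePreserving_comp_injective μ (σ.orderEmbOfFin hc).injective
    rw [← hmp.measureReal_preimage (measurableSet_isHole r _).nullMeasurableSet]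
    congr 1
    ext x
    have := isHole_cechComplex_comp x r (σ.orderEmbOfFin hc).toEmbedding Finset.univ
    rw [show Finset.univ.map (σ.orderEmbOfFin hc).toEmbedding = σ by simp] at this
    exact this.symm
  rw [Finset.sum_congr rfl h2]
  simp

lemma integral_betti_eq (n k : ℕ) (r : ℝ) :
    ∫ x : Fin n → E, ((cechComplex x r).betti (k - 2) : ℝ) ∂(Measure.pi fun _ => μ) =
      ∫ x : Fin n → E, ((holes x r k Finset.univ).card : ℝ) ∂(Measure.pi fun _ => μ) +
        ∫ x : Fin n → E, bettiExcess x r k Finset.univ ∂(Measure.pi fun _ => μ) := by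
  rw [← integral_add (integrable_card_holes _) (integrable_bettiExcess _)]
  refine integral_congr_ae (ae_of_all _ fun x => ?_)
  simp [bettiExcess, inducedBetti_univ]

/-- The expected Betti number is of order at most `n (n p) ^ (k - 1)`. -/
lemma integral_betti_le {n k : ℕ} {r p : ℝ} (hk : 3 ≤ k) (hr : 0 ≤ r) (hp0 : 0 ≤ p)
    (hp : ∀ y, μ (Metric.closedBall y (2 * r * k)) ≤ ENNReal.ofReal p) (hn : n * p ≤ 1) :
    ∫ x : Fin n → E, ((cechComplex x r).betti (k - 2) : ℝ) ∂(Measure.pi fun _ => μ) ≤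
      (momentConst k (k - 1) + 2 * momentConst k k) * (n * (n * p) ^ (k - 1)) := by
  rw [integral_betti_eq]
  have h1 := integral_card_holes_le (μ := μ) (n := n) hk hr hp0 hp hn
  have h2 := (le_abs_self _).trans ((abs_integral_le_integral_abs (f := fun x : Fin n → E =>
    bettiExcess x r k Finset.univ) (μ := Measure.pi fun _ => μ)).trans
      (integral_abs_bettiExcess_le hk hr hp0 hp hn))
  have h3 : ((n : ℝ) * p) ^ k ≤ (n * p) ^ (k - 1) :=
    pow_le_pow_of_le_one (by positivity) hn (by omega)
  have h4 : (n : ℝ) * (2 * momentConst k k * (n * p) ^ k) ≤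
      n * (2 * momentConst k k * (n * p) ^ (k - 1)) := by
    have := momentConst_nonneg k k
    gcongr
  linarith

end ExpectedHoles

lemma div_pow_le_choose {n k : ℕ} (hk : 1 ≤ k) (hn : k ≤ n) :
    ((n : ℝ) / k) ^ k / k.factorial ≤ n.choose k := by
  refine le_trans ?_ (Nat.pow_le_choose k n)
  gcongr
  rw [div_le_iff₀ (by positivity), Nat.cast_sub (by omega)]
  have h1 : (1 : ℝ) ≤ k := by exact_mod_cast hk
  have h2 : (k : ℝ) ≤ n := by exact_mod_cast hn
  push_cast
  nlinarith

/-- The expected Betti number has the order of the expected number of hollow simplices. -/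
theorem exists_le_integral_betti {d k : ℕ} (hk : 3 ≤ k) (hkd : k ≤ d + 1)
    {f : EuclideanSpace ℝ (Fin d) → ℝ} (hf : Measurable f)
    [IsProbabilityMeasure (volume.withDensity fun x => ENNReal.ofReal (f x))] {A : ℝ} (hA : 0 < A)
    (hball : ∀ r : ℝ, 0 < r → ∀ y : EuclideanSpace ℝ (Fin d),
      (volume.withDensity fun x => ENNReal.ofReal (f x)) (Metric.closedBall y (2 * r * k)) ≤
        ENNReal.ofReal (A * r ^ d)) :
    ∃ c : ℝ, 0 < c ∧ ∃ ε : ℝ, 0 < ε ∧ ∀ n : ℕ, k ≤ n → ∀ r : ℝ, 0 < r → n * r ^ d ≤ ε →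
      c * (n * (n * r ^ d) ^ (k - 1)) ≤
        ∫ x : Fin n → EuclideanSpace ℝ (Fin d), ((cechComplex x r).betti (k - 2) : ℝ)
          ∂(Measure.pi fun _ => volume.withDensity fun x => ENNReal.ofReal (f x)) := by
  obtain ⟨m, rfl⟩ : ∃ m, k = m + 1 := ⟨k - 1, by omega⟩
  set μ : Measure (EuclideanSpace ℝ (Fin d)) :=
    volume.withDensity fun x => ENNReal.ofReal (f x) with hμ
  obtain ⟨c, hc, r₀, hr₀, hhole⟩ := exists_hole_measure_ge (m := m) (by omega) (by omega) hf
  rw [← hμ] at hhole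
  set c₁ : ℝ := c / ((m + 1 : ℕ) ^ (m + 1) * (m + 1).factorial) with hc₁
  have hc₁0 : 0 < c₁ := by positivity
  set D : ℝ := 2 * momentConst (m + 1) (m + 1) * A ^ (m + 1) with hD
  have hD0 : 0 ≤ D := by have := momentConst_nonneg (m + 1) (m + 1); positivity
  -- The three bounds ensure `r ≤ r₀`, `n * p ≤ 1`, and that the excess costs at most half of the
  -- lower bound for the expected number of holes.
  refine ⟨c₁ / 2, by positivity, min (r₀ ^ d) (min (1 / A) (c₁ / (2 * (D + 1)))), by positivity,
    fun n hn r hr hnr => ?_⟩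
  have hn1 : (1 : ℝ) ≤ n := by exact_mod_cast (by omega : 1 ≤ n)
  have hrd : 0 < r ^ d := by positivity
  have hr₁ : r ≤ r₀ := by
    refine le_of_pow_le_pow_left₀ (by omega : d ≠ 0) hr₀.le ?_
    exact (le_mul_of_one_le_left hrd.le hn1).trans (hnr.trans (min_le_left _ _))
  have hnp : (n : ℝ) * (A * r ^ d) ≤ 1 := by
    have := hnr.trans ((min_le_right _ _).trans (min_le_left _ _))
    rw [le_div_iff₀ hA] at this
    linarith
  have hnD : (n : ℝ) * r ^ d * D ≤ c₁ / 2 := by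
    have := hnr.trans ((min_le_right _ _).trans (min_le_right _ _))
    rw [le_div_iff₀ (by positivity)] at this
    have h0 : 0 ≤ (n : ℝ) * r ^ d := by positivity
    nlinarith
  have hW : c₁ * (n * (n * r ^ d) ^ m) ≤
      ∫ x : Fin n → EuclideanSpace ℝ (Fin d), ((holes x r (m + 1) Finset.univ).card : ℝ)
        ∂(Measure.pi fun _ => μ) := by
    rw [integral_card_holes_eq]
    have h1 : c * (r ^ d) ^ m ≤ (Measure.pi fun _ : Fin (m + 1) => μ).real
        {x | (cechComplex x r).IsHole Finset.univ} :=
      (ENNReal.ofReal_le_iff_le_toReal (measure_ne_top _ _)).1 (hhole r hr hr₁)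
    calc _ = ((n : ℝ) / (m + 1 : ℕ)) ^ (m + 1) / (m + 1).factorial * (c * (r ^ d) ^ m) := by
          rw [hc₁, div_pow]
          field_simp
          ring
      _ ≤ _ := by
          gcongr
          exact div_pow_le_choose (by omega) hn
  have hE := integral_abs_bettiExcess_le (μ := μ) (n := n) hk hr.le (by positivity)
    (hball r hr) hnp
  have habs := neg_le_of_abs_le (abs_integral_le_integral_abs (f := fun x : Fin n →
    EuclideanSpace ℝ (Fin d) => bettiExcess x r (m + 1) Finset.univ) (μ := Measure.pi fun _ => μ))
  have hE' : (n : ℝ) * (2 * momentConst (m + 1) (m + 1) * (n * (A * r ^ d)) ^ (m + 1)) ≤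
      c₁ / 2 * (n * (n * r ^ d) ^ m) := by
    calc _ = (n : ℝ) * r ^ d * D * (n * (n * r ^ d) ^ m) := by rw [hD]; ring
      _ ≤ _ := by gcongr
  rw [integral_betti_eq, Nat.add_sub_cancel]
  linarith

/-! ### From Poisson approximation to the normal limit -/

section PoissonCLT

/-- Total variation estimates concern real test functions, so characteristic functions are split
into cosine and sine. -/
lemma integral_cexp_mul_I_eq {T : Type*} [MeasurableSpace T] {P : Measure T} [IsFiniteMeasure P]
    {Z : T → ℕ} (hZ : AEMeasurable Z P) (u : ℝ) :
    ∫ ω, Complex.exp (u * (Z ω : ℝ) * Complex.I) ∂P =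
      (∫ ω, Real.cos (u * Z ω) ∂P : ℝ) + (∫ ω, Real.sin (u * Z ω) ∂P : ℝ) * Complex.I := by
  have hi : Integrable (fun ω => Complex.exp (u * (Z ω : ℝ) * Complex.I)) P := by
    refine Integrable.of_bound ?_ 1 (ae_of_all _ fun ω => ?_)
    · exact ((Measurable.of_discrete (f := fun j : ℕ =>
        Complex.exp (u * (j : ℝ) * Complex.I))).comp_aemeasurable hZ).aestronglyMeasurable
    · rw [← Complex.ofReal_mul, Complex.norm_exp_ofReal_mul_I]
  rw [← integral_re_add_im hi]
  simp only [← Complex.ofReal_mul, RCLike.re_to_complex, RCLike.im_to_complex,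
    Complex.exp_ofReal_mul_I_re, Complex.exp_ofReal_mul_I_im]
  rfl

lemma integral_cexp_poissonMeasure (a : ℝ≥0) (u : ℝ) :
    ∫ j, Complex.exp (u * ((j : ℕ) : ℝ) * Complex.I) ∂(poissonMeasure a) =
      Complex.exp (a * (Complex.exp (u * Complex.I) - 1)) := by
  rw [← charFun_map_cast_poissonMeasure, charFun_apply_real,
    integral_map .of_discrete (by fun_prop)]

/-- With `u = t / s n → 0` and `lam n * u ^ 2 → t ^ 2`, the second-order Taylor term has the stated
limit and the cubic remainder is at most `|lam n * u ^ 2| * |u|`. This is the exponent of a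
centered, rescaled Poisson characteristic function. -/
lemma tendsto_mul_exp_sub {lam s : ℕ → ℝ} (hlam : Tendsto lam atTop atTop)
    (hs : Tendsto (fun n => s n ^ 2 / lam n) atTop (𝓝 1)) (hs0 : ∀ n, 0 ≤ s n) (t : ℝ) :
    Tendsto (fun n => (lam n : ℂ) * (Complex.exp ((t / s n : ℝ) * Complex.I) - 1 -
      (t / s n : ℝ) * Complex.I)) atTop (𝓝 (-(t : ℂ) ^ 2 / 2)) := by
  have hs2 : Tendsto (fun n => s n ^ 2) atTop atTop := by
    have := hs.pos_mul_atTop one_pos hlam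
    refine this.congr' ?_
    filter_upwards [hlam.eventually_gt_atTop 0] with n hn
    field_simp
  have hsT : Tendsto s atTop atTop := by
    have := Real.tendsto_sqrt_atTop.comp hs2
    exact this.congr fun n => Real.sqrt_sq (hs0 n)
  have hu : Tendsto (fun n => t / s n) atTop (𝓝 0) := hsT.const_div_atTop t
  have hlu : Tendsto (fun n => lam n * (t / s n) ^ 2) atTop (𝓝 (t ^ 2)) := by
    have := (hs.inv₀ one_ne_zero).const_mul (t ^ 2)
    rw [inv_one, mul_one] at this
    refine this.congr fun n => ?_
    rw [inv_div, div_pow]; ring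
  have hmain : Tendsto (fun n => ((-(lam n * (t / s n) ^ 2) / 2 : ℝ) : ℂ)) atTop
      (𝓝 (-(t : ℂ) ^ 2 / 2)) := by
    have := (Complex.continuous_ofReal.tendsto _).comp (hlu.neg.div_const 2)
    refine this.trans (le_of_eq ?_)
    push_cast
    rfl
  refine hmain.congr_dist ?_
  have hbd : Tendsto (fun n => |lam n * (t / s n) ^ 2| * |t / s n|) atTop (𝓝 0) := by
    simpa using hlu.abs.mul hu.abs
  refine squeeze_zero' (Eventually.of_forall fun n => dist_nonneg) ?_ hbd
  have hev : ∀ᶠ n in atTop, |t / s n| ≤ 1 := by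
    have := hu.abs
    rw [abs_zero] at this
    exact (this.eventually_lt_const one_pos).mono fun n hn => hn.le
  filter_upwards [hev] with n hn
  set u : ℝ := t / s n with hu'
  have h1 : ‖(u : ℂ) * Complex.I‖ = |u| := by simp
  have h2 := Complex.exp_bound (x := (u : ℂ) * Complex.I) (by rw [h1]; exact hn)
    (n := 3) (by norm_num)
  rw [h1] at h2
  rw [dist_comm, dist_eq_norm]
  have h3 : (lam n : ℂ) * (Complex.exp (u * Complex.I) - 1 - u * Complex.I) -
      ((-(lam n * u ^ 2) / 2 : ℝ) : ℂ) = lam n * (Complex.exp (u * Complex.I) -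
        ∑ m ∈ Finset.range 3, ((u : ℂ) * Complex.I) ^ m / m.factorial) := by
    simp only [Finset.sum_range_succ, Finset.sum_range_zero, Nat.factorial]
    push_cast
    ring_nf
    rw [Complex.I_sq]
    ring
  rw [h3, norm_mul, Complex.norm_real, Real.norm_eq_abs]
  calc |lam n| * _ ≤ |lam n| * (|u| ^ 3 * 1) := by
        refine mul_le_mul_of_nonneg_left (h2.trans ?_) (abs_nonneg _)
        refine mul_le_mul_of_nonneg_left ?_ (by positivity)
        norm_num [Nat.factorial]
    _ = |lam n * u ^ 2| * |u| := by rw [abs_mul, abs_pow]; ring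

/-- Integer random variables close to Poisson in total variation, with variances asymptotic to
their diverging means, are asymptotically normal. -/
theorem tendstoInDistribution_of_poisson {Ω : Type*} [MeasurableSpace Ω] {P : Measure Ω}
    [IsProbabilityMeasure P] {Z : ℕ → Ω → ℕ} (hZ : ∀ n, AEMeasurable (Z n) P) {lam δ : ℕ → ℝ}
    (hlam : Tendsto lam atTop atTop) (hδ : Tendsto δ atTop (𝓝 0))
    (htv : ∀ᶠ n in atTop, ∀ h : ℕ → ℝ, (∀ j, |h j| ≤ 1) →
      |∫ ω, h (Z n ω) ∂P - ∫ j, h j ∂(poissonMeasure (lam n).toNNReal)| ≤ δ n)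
    {v : ℕ → ℝ} (hv0 : ∀ n, 0 ≤ v n) (hv : Tendsto (fun n => v n / lam n) atTop (𝓝 1)) :
    TendstoInDistribution (fun n ω => ((Z n ω : ℝ) - lam n) / √(v n)) atTop (id : ℝ → ℝ)
      (fun _ => P) (gaussianReal 0 1) := by
  have hmeas : ∀ n, AEMeasurable (fun ω => ((Z n ω : ℝ) - lam n) / √(v n)) P := fun n =>
    (Measurable.of_discrete (f := fun j : ℕ => ((j : ℝ) - lam n) / √(v n))).comp_aemeasurable (hZ n)
  refine ⟨hmeas, aemeasurable_id, ?_⟩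
  refine ProbabilityMeasure.tendsto_iff_tendsto_charFun.2 fun t => ?_
  change Tendsto (fun n => charFun (P.map fun ω => ((Z n ω : ℝ) - lam n) / √(v n)) t) atTop
    (𝓝 (charFun ((gaussianReal 0 1).map id) t))
  rw [Measure.map_id, charFun_gaussianReal]
  set s : ℕ → ℝ := fun n => √(v n) with hs
  have hlim := tendsto_mul_exp_sub (s := s) hlam (by simpa [hs, Real.sq_sqrt (hv0 _)] using hv)
    (fun n => Real.sqrt_nonneg _) t
  have hexp := (Complex.continuous_exp.tendsto _).comp hlim
  have htarget : Complex.exp (t * (0 : ℝ) * Complex.I - ((1 : ℝ≥0) : ℝ) * t ^ 2 / 2) =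
      Complex.exp (-(t : ℂ) ^ 2 / 2) := by
    congr 1; push_cast; ring
  have hδ2 : Tendsto (fun n => δ n + δ n) atTop (𝓝 0) := by simpa using hδ.add hδ
  rw [htarget]
  -- The comparison is with the rescaled Poisson characteristic function at the same `n`. The
  -- centering factor has modulus one, and cosine and sine each cost `δ n`.
  refine hexp.congr_dist (squeeze_zero' (Eventually.of_forall fun n => dist_nonneg) ?_ hδ2)
  filter_upwards [htv, hlam.eventually_gt_atTop 0] with n hn hl
  set u : ℝ := t / s n with hu
  have hchar : charFun (P.map fun ω => ((Z n ω : ℝ) - lam n) / s n) t =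
      Complex.exp (-(u * lam n : ℝ) * Complex.I) *
        ∫ ω, Complex.exp (u * (Z n ω : ℝ) * Complex.I) ∂P := by
    rw [charFun_apply_real, integral_map (hmeas n) (by fun_prop), ← integral_const_mul]
    refine integral_congr_ae (ae_of_all _ fun ω => ?_)
    simp only
    rw [← Complex.exp_add]
    congr 1
    rw [hu]
    push_cast
    ring
  have hpo : Complex.exp ((lam n : ℂ) * (Complex.exp (u * Complex.I) - 1 - u * Complex.I)) =
      Complex.exp (-(u * lam n : ℝ) * Complex.I) *
        ∫ j, Complex.exp (u * ((j : ℕ) : ℝ) * Complex.I) ∂(poissonMeasure (lam n).toNNReal) := by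
    rw [integral_cexp_poissonMeasure, ← Complex.exp_add]
    congr 1
    rw [Real.coe_toNNReal _ hl.le]
    push_cast
    ring
  have hunit : ‖Complex.exp (-(u * lam n : ℝ) * Complex.I)‖ = 1 := by
    rw [← Complex.ofReal_neg, Complex.norm_exp_ofReal_mul_I]
  simp only [Function.comp_apply]
  rw [hchar, hpo, dist_comm, dist_eq_norm, ← mul_sub, norm_mul, hunit, one_mul,
    integral_cexp_mul_I_eq (hZ n),
    integral_cexp_mul_I_eq (Z := fun j : ℕ => j) Measurable.of_discrete.aemeasurable]
  have hc := hn (fun j => Real.cos (u * j)) fun j => Real.abs_cos_le_one _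
  have hs' := hn (fun j => Real.sin (u * j)) fun j => Real.abs_sin_le_one _
  rw [add_sub_add_comm, ← sub_mul, ← Complex.ofReal_sub, ← Complex.ofReal_sub]
  refine (norm_add_le _ _).trans (add_le_add ?_ ?_)
  · rw [Complex.norm_real]; exact hc
  · rw [norm_mul, Complex.norm_I, mul_one, Complex.norm_real]; exact hs'

end PoissonCLT

lemma steinConst_nonneg (k : ℕ) : 0 ≤ steinConst k := by
  have h1 := momentConst_nonneg k k
  have h2 := momentConst_nonneg (k + k) k
  have h3 := momentConst_nonneg k (k - 1)
  have h4 := momentConst_nonneg k 1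
  unfold steinConst
  positivity

lemma exists_measure_closedBall_le {d : ℕ} {f : EuclideanSpace ℝ (Fin d) → ℝ}
    (hf : ∃ M, ∀ x, f x ≤ M) (k : ℕ) (hk : 1 ≤ k) :
    ∃ A : ℝ, 0 < A ∧ ∀ r : ℝ, 0 < r → ∀ y : EuclideanSpace ℝ (Fin d),
      (volume.withDensity fun x => ENNReal.ofReal (f x)) (Metric.closedBall y (2 * r * k)) ≤
        ENNReal.ofReal (A * r ^ d) := by
  obtain ⟨M, hM⟩ := hf
  have hVfin : volume (Metric.ball (0 : EuclideanSpace ℝ (Fin d)) 1) ≠ ⊤ :=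
    measure_ball_lt_top.ne
  have hV0 : 0 < volume (Metric.ball (0 : EuclideanSpace ℝ (Fin d)) 1) :=
    Metric.measure_ball_pos _ _ one_pos
  set V : ℝ := (volume (Metric.ball (0 : EuclideanSpace ℝ (Fin d)) 1)).toReal with hV
  have hV' : 0 < V := ENNReal.toReal_pos hV0.ne' hVfin
  have hk0 : (0 : ℝ) < k := by exact_mod_cast hk
  refine ⟨(|M| + 1) * ((2 * k) ^ d * V), by positivity, fun r hr y => ?_⟩
  rw [withDensity_apply _ Metric.isClosed_closedBall.measurableSet]
  calc _ ≤ ∫⁻ _ in Metric.closedBall y (2 * r * k), ENNReal.ofReal (|M| + 1) := by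
        refine lintegral_mono fun x => ENNReal.ofReal_le_ofReal ?_
        linarith [hM x, le_abs_self M]
    _ = ENNReal.ofReal (|M| + 1) * (ENNReal.ofReal ((2 * r * k) ^ d) * ENNReal.ofReal V) := by
        rw [setLIntegral_const, Measure.addHaar_closedBall _ _ (by positivity),
          finrank_euclideanSpace_fin, hV, ENNReal.ofReal_toReal hVfin]
    _ = _ := by
        rw [← ENNReal.ofReal_mul (by positivity), ← ENNReal.ofReal_mul (by positivity)]
        congr 1
        rw [show 2 * r * (k : ℝ) = 2 * k * r by ring, mul_pow _ r]
        ring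

/-! ### Transfer from the random sequence to the product measure -/

section Law

variable {Ω E : Type*} [MeasurableSpace Ω] {P : Measure Ω}
  [MeasurableSpace E] {μ : Measure E} {X : ℕ → Ω → E}

lemma map_fin_eq_pi [IsProbabilityMeasure P] (hX : iIndepFun X P) (hlaw : ∀ i, HasLaw (X i) μ P) (n : ℕ) :
    P.map (fun ω (i : Fin n) => X i ω) = Measure.pi fun _ => μ := by
  have h1 := hX.precomp (Fin.val_injective (n := n))
  rw [iIndepFun_iff_map_fun_eq_pi_map fun i : Fin n => (hlaw i).aemeasurable] at h1
  rw [h1]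
  congr 1
  ext1 i
  exact (hlaw i).map_eq

variable [PseudoMetricSpace E] [ProperSpace E] [SecondCountableTopology E] [BorelSpace E]

lemma aemeasurable_cechBetti (hlaw : ∀ i, HasLaw (X i) μ P) (n : ℕ) (r : ℝ) (j : ℕ) :
    AEMeasurable (cechBetti X n r j) P :=
  ((Measurable.of_discrete (f := fun K : PreAbstractSimplicialComplex (Fin n) => K.betti j)).comp
    (measurable_cechComplex r)).comp_aemeasurable
      (aemeasurable_pi_lambda _ fun i : Fin n => (hlaw i).aemeasurable)

lemma integral_cechBetti [IsProbabilityMeasure P] (hX : iIndepFun X P)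
    (hlaw : ∀ i, HasLaw (X i) μ P) (n : ℕ) (r : ℝ)
    (j : ℕ) (F : ℕ → ℝ) :
    ∫ ω, F (cechBetti X n r j ω) ∂P =
      ∫ x : Fin n → E, F ((cechComplex x r).betti j) ∂(Measure.pi fun _ => μ) := by
  rw [← map_fin_eq_pi hX hlaw, integral_map
    (aemeasurable_pi_lambda _ fun i : Fin n => (hlaw i).aemeasurable)
    (measurable_cech fun K => F (K.betti j)).aestronglyMeasurable]
  rfl

lemma integrable_cechBetti [IsProbabilityMeasure P] (hX : iIndepFun X P)
    (hlaw : ∀ i, HasLaw (X i) μ P) (n : ℕ) (r : ℝ)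
    (j : ℕ) (F : ℕ → ℝ) : Integrable (fun ω => F (cechBetti X n r j ω)) P := by
  have : IsProbabilityMeasure μ := by
    rw [← (hlaw 0).map_eq]
    exact Measure.isProbabilityMeasure_map (hlaw 0).aemeasurable
  have h1 := integrable_cech (μ := μ) (n := n) (r := r) fun K => F (K.betti j)
  rw [← map_fin_eq_pi hX hlaw] at h1
  exact h1.comp_aemeasurable (aemeasurable_pi_lambda _ fun i : Fin n => (hlaw i).aemeasurable)

lemma variance_cechBetti [IsProbabilityMeasure P] (hX : iIndepFun X P)
    (hlaw : ∀ i, HasLaw (X i) μ P) (n : ℕ) (r : ℝ)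
    (j : ℕ) :
    variance (fun ω => (cechBetti X n r j ω : ℝ)) P =
      ∫ x : Fin n → E, ((cechComplex x r).betti j : ℝ) ^ 2 ∂(Measure.pi fun _ => μ) -
        (∫ x : Fin n → E, ((cechComplex x r).betti j : ℝ) ∂(Measure.pi fun _ => μ)) ^ 2 := by
  have h1 := integrable_cechBetti hX hlaw n r j fun m => (m : ℝ)
  rw [variance_eq_sub ((memLp_two_iff_integrable_sq h1.aestronglyMeasurable).2
    (integrable_cechBetti hX hlaw n r j fun m => (m : ℝ) ^ 2)),
    ← integral_cechBetti hX hlaw n r j fun m => (m : ℝ),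
    ← integral_cechBetti hX hlaw n r j fun m => (m : ℝ) ^ 2]
  rfl

end Law

/-! ### Assembly of the three regimes -/

section Main

lemma tvDist_map_le {Ω : Type*} [MeasurableSpace Ω] {P : Measure Ω} {Z : Ω → ℕ}
    (hZ : AEMeasurable Z P) {ν : Measure ℕ} {C : ℝ} (hC : 0 ≤ C)
    (h : ∀ g : ℕ → ℝ, (∀ j, |g j| ≤ 1) → |∫ ω, g (Z ω) ∂P - ∫ j, g j ∂ν| ≤ C) :
    tvDist (P.map Z) ν ≤ C := by
  refine Real.iSup_le (fun g => ?_) hC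
  rw [integral_map hZ (Measurable.of_discrete.aestronglyMeasurable)]
  exact h _ g.2

lemma abs_integral_sub_integral_le_two {α β : Type*} [MeasurableSpace α] [MeasurableSpace β]
    {μ : Measure α} {ν : Measure β} [IsProbabilityMeasure μ] [IsProbabilityMeasure ν]
    {g : α → ℝ} {h : β → ℝ} (hg : ∀ x, |g x| ≤ 1) (hh : ∀ x, |h x| ≤ 1) :
    |∫ x, g x ∂μ - ∫ x, h x ∂ν| ≤ 2 := by
  have h1 := norm_integral_le_of_norm_le_const (μ := μ) (f := g) (ae_of_all _ hg)
  have h2 := norm_integral_le_of_norm_le_const (μ := ν) (f := h) (ae_of_all _ hh)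
  simp only [probReal_univ, mul_one, Real.norm_eq_abs] at h1 h2
  exact (abs_sub _ _).trans (by linarith)

lemma integral_poissonMeasure_zero (g : ℕ → ℝ) : ∫ j, g j ∂(poissonMeasure 0) = g 0 := by
  rw [integral_poissonMeasure, tsum_eq_single 0]
  · simp
  · intro j hj; simp [hj]

lemma betti_cechComplex_eq_zero_of_lt {E : Type*} [PseudoMetricSpace E] {n k : ℕ} (hk : 3 ≤ k)
    (hn : n < k) (x : Fin n → E) (r : ℝ) : (cechComplex x r).betti (k - 2) = 0 := by
  have h1 := inducedBetti_of_card_le (x := x) (r := r) hk (A := Finset.univ) (by simp; omega)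
  rw [inducedBetti_univ, show holes x r k Finset.univ = ∅ from ?_] at h1
  · simpa using h1
  · refine Finset.eq_empty_of_forall_notMem fun σ hσ => ?_
    have h2 := (mem_holes.1 hσ).2.1
    have h3 := σ.card_le_univ
    rw [Fintype.card_fin] at h3
    omega

lemma pow_mul_pow_eq (n r : ℝ) (d : ℕ) {k : ℕ} (hk : 1 ≤ k) :
    n ^ k * r ^ (d * (k - 1)) = n * (n * r ^ d) ^ (k - 1) := by
  obtain ⟨m, rfl⟩ := Nat.exists_eq_add_of_le' hk
  rw [Nat.add_sub_cancel, mul_pow, pow_mul, pow_succ]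
  ring

/-- In the sparse regime the Betti number is close to Poisson, with the error of order `n r ^ d`,
and its variance is close to its mean. -/
theorem exists_poisson_approximation {d k : ℕ} (hk : 3 ≤ k) (hkd : k ≤ d + 1)
    {f : EuclideanSpace ℝ (Fin d) → ℝ} (hf : Measurable f) (hf_bdd : ∃ M, ∀ x, f x ≤ M)
    [IsProbabilityMeasure (volume.withDensity fun x => ENNReal.ofReal (f x))] :
    ∃ c : ℝ, 0 < c ∧ ∃ C : ℝ, 0 ≤ C ∧ ∃ ε : ℝ, 0 < ε ∧
      ∀ (Ω : Type*) [MeasurableSpace Ω] (P : Measure Ω) [IsProbabilityMeasure P]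
      (X : ℕ → Ω → EuclideanSpace ℝ (Fin d)), iIndepFun X P →
      (∀ i, HasLaw (X i) (volume.withDensity fun x => ENNReal.ofReal (f x)) P) →
      ∀ n : ℕ, k ≤ n → ∀ r : ℝ, 0 < r → n * r ^ d ≤ ε →
        c * (n * (n * r ^ d) ^ (k - 1)) ≤ ∫ ω, (cechBetti X n r (k - 2) ω : ℝ) ∂P ∧
        (∀ h : ℕ → ℝ, (∀ j, |h j| ≤ 1) →
          |∫ ω, h (cechBetti X n r (k - 2) ω) ∂P - ∫ j, h j ∂(poissonMeasure
            (∫ ω, (cechBetti X n r (k - 2) ω : ℝ) ∂P).toNNReal)| ≤ C * (n * r ^ d)) ∧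
        |variance (fun ω => (cechBetti X n r (k - 2) ω : ℝ)) P /
          (∫ ω, (cechBetti X n r (k - 2) ω : ℝ) ∂P) - 1| ≤ C * (n * r ^ d) := by
  obtain ⟨A, hA, hball⟩ := exists_measure_closedBall_le hf_bdd k (by omega)
  obtain ⟨c, hc, ε, hε, hlow⟩ := exists_le_integral_betti hk hkd hf hA hball
  have hst := steinConst_nonneg k
  refine ⟨c, hc, 2 * steinConst k * A ^ k / c, by positivity, min ε (1 / A), by positivity, ?_⟩
  intro Ω _ P _ X hX hlaw n hn r hr hnr
  have hn0 : (0 : ℝ) < n := by exact_mod_cast (by omega : 0 < n)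
  have hlow' := hlow n hn r hr (hnr.trans (min_le_left _ _))
  have hnp : (n : ℝ) * (A * r ^ d) ≤ 1 := by
    have := hnr.trans (min_le_right _ _)
    rw [le_div_iff₀ hA] at this
    linarith
  rw [integral_cechBetti hX hlaw n r (k - 2) fun m => (m : ℝ)]
  set lam : ℝ := ∫ x : Fin n → EuclideanSpace ℝ (Fin d), ((cechComplex x r).betti (k - 2) : ℝ)
    ∂(Measure.pi fun _ => volume.withDensity fun x => ENNReal.ofReal (f x)) with hlam
  have hlb : 0 < c * (n * (n * r ^ d) ^ (k - 1)) := by positivity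
  have hpos : 0 < lam := hlb.trans_le hlow'
  -- The error is one factor `n * r ^ d` smaller than the lower bound for the mean, so dividing by
  -- the mean leaves this factor.
  have herr : 2 * steinConst k * (n * (n * (A * r ^ d)) ^ k) / lam ≤
      2 * steinConst k * A ^ k / c * (n * r ^ d) := by
    have e : n * (n * (A * r ^ d)) ^ k = A ^ k * (n * r ^ d) * (n * (n * r ^ d) ^ (k - 1)) := by
      obtain ⟨m, rfl⟩ := Nat.exists_eq_add_of_le' (by omega : 1 ≤ k)
      rw [Nat.add_sub_cancel]
      ring
    rw [div_le_iff₀ hpos, e]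
    calc _ = 2 * steinConst k * A ^ k / c * (n * r ^ d) * (c * (n * (n * r ^ d) ^ (k - 1))) := by
          field_simp
      _ ≤ _ := by gcongr
  refine ⟨hlow', fun h hh => ?_, ?_⟩
  · rw [integral_cechBetti hX hlaw]
    exact (abs_integral_betti_sub_poisson_le hk hr.le (by positivity) (hball r hr) hnp hh hlam
      hpos).trans herr
  · refine le_trans ?_ herr
    rw [variance_cechBetti hX hlaw, ← hlam]
    -- For the identity function the Stein identity compares E[β²] with λ (λ + 1), that is, the
    -- variance with λ.
    have h1 := abs_stein_le (μ := volume.withDensity fun x => ENNReal.ofReal (f x)) (n := n) hk hr.le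
      (by positivity) (hball r hr) hnp (g := fun m => (m : ℝ)) (L := 1) (by intro m; simp)
    rw [← hlam] at h1
    have h2 : ∫ x : Fin n → EuclideanSpace ℝ (Fin d),
        (((cechComplex x r).betti (k - 2) + 1 : ℕ) : ℝ)
        ∂(Measure.pi fun _ => volume.withDensity fun x => ENNReal.ofReal (f x)) = lam + 1 := by
      push_cast
      rw [integral_add (integrable_cech fun K => (K.betti (k - 2) : ℝ)) (integrable_const _)]
      simp [hlam]
    rw [h2] at h1
    simp only [← pow_two] at h1
    rw [div_sub_one hpos.ne', abs_div, abs_of_pos hpos]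
    gcongr
    have h3 : 0 ≤ steinConst k * (n * (n * (A * r ^ d)) ^ k) := by positivity
    calc _ = _ := by congr 1; ring
      _ ≤ _ := h1
      _ ≤ _ := by linarith

lemma tvDist_cechBetti_of_eq_zero {Ω E : Type*} [MeasurableSpace Ω] {P : Measure Ω}
    [IsProbabilityMeasure P] [PseudoMetricSpace E] {X : ℕ → Ω → E} {n j : ℕ} {r : ℝ}
    (h : ∀ ω, cechBetti X n r j ω = 0) {C : ℝ} (hC : 0 ≤ C) :
    tvDist (P.map (cechBetti X n r j))
      (poissonMeasure (∫ ω, (cechBetti X n r j ω : ℝ) ∂P).toNNReal) ≤ C := by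
  rw [show cechBetti X n r j = fun _ => 0 from funext h]
  refine tvDist_map_le aemeasurable_const hC fun g _ => ?_
  simpa [integral_poissonMeasure_zero] using hC

/-- Markov's inequality: the mean is at most a constant times `n ^ k * r ^ (d * (k - 1))` once `n *
p ≤ 1`. -/
lemma tendsto_measure_cechBetti_eq_zero {d k : ℕ} (hk : 3 ≤ k)
    {μ : Measure (EuclideanSpace ℝ (Fin d))} [IsProbabilityMeasure μ] {A : ℝ} (hA : 0 < A)
    (hball : ∀ r : ℝ, 0 < r → ∀ y, μ (Metric.closedBall y (2 * r * k)) ≤ ENNReal.ofReal (A * r ^ d))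
    {Ω : Type*} [MeasurableSpace Ω] {P : Measure Ω} [IsProbabilityMeasure P]
    {X : ℕ → Ω → EuclideanSpace ℝ (Fin d)} {r : ℕ → ℝ} (hX : iIndepFun X P)
    (hlaw : ∀ i, HasLaw (X i) μ P) (hr : ∀ n, 0 < r n)
    (hnr : Tendsto (fun n : ℕ => (n : ℝ) * r n ^ d) atTop (𝓝 0))
    (h : Tendsto (fun n : ℕ => (n : ℝ) ^ k * r n ^ (d * (k - 1))) atTop (𝓝 0)) :
    Tendsto (fun n : ℕ => P {ω | cechBetti X n (r n) (k - 2) ω = 0}) atTop (𝓝 1) := by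
  set C : ℝ := (momentConst k (k - 1) + 2 * momentConst k k) * A ^ (k - 1) with hC
  have hlim : Tendsto (fun n : ℕ => 1 - ENNReal.ofReal
      (C * ((n : ℝ) ^ k * r n ^ (d * (k - 1))))) atTop (𝓝 1) := by
    have h1 := ENNReal.tendsto_ofReal (h.const_mul C)
    have h2 := ENNReal.Tendsto.sub (tendsto_const_nhds (x := (1 : ENNReal))) h1
      (Or.inl ENNReal.one_ne_top)
    simpa using h2
  refine tendsto_of_tendsto_of_tendsto_of_le_of_le' hlim tendsto_const_nhds ?_
    (Eventually.of_forall fun n => prob_le_one)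
  filter_upwards [hnr.eventually_lt_const (by positivity : 0 < 1 / A)] with n hn
  have hrn := hr n
  rw [lt_div_iff₀ hA] at hn
  have hmean : ∫ ω, (cechBetti X n (r n) (k - 2) ω : ℝ) ∂P ≤
      C * ((n : ℝ) ^ k * r n ^ (d * (k - 1))) := by
    rw [integral_cechBetti hX hlaw n (r n) (k - 2) fun m => (m : ℝ)]
    refine (integral_betti_le hk hrn.le (by positivity) (hball _ hrn)
      (by linarith)).trans_eq ?_
    rw [pow_mul_pow_eq _ _ _ (by omega), hC, mul_left_comm (n : ℝ) A, mul_pow A]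
    ring
  have hmarkov := mul_meas_ge_le_integral_of_nonneg (μ := P)
    (f := fun ω => (cechBetti X n (r n) (k - 2) ω : ℝ)) (ae_of_all _ fun ω => Nat.cast_nonneg _)
    (integrable_cechBetti hX hlaw n (r n) (k - 2) fun m => (m : ℝ)) 1
  rw [one_mul] at hmarkov
  rw [tsub_le_iff_right, ← measure_univ (μ := P)]
  calc P Set.univ ≤ P ({ω | cechBetti X n (r n) (k - 2) ω = 0} ∪
        {ω | 1 ≤ (cechBetti X n (r n) (k - 2) ω : ℝ)}) := by
        refine measure_mono fun ω _ => ?_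
        rcases Nat.eq_zero_or_pos (cechBetti X n (r n) (k - 2) ω) with h0 | h0
        · exact Or.inl h0
        · exact Or.inr (by exact_mod_cast h0)
    _ ≤ _ := measure_union_le _ _
    _ ≤ _ := by
        gcongr
        rw [ENNReal.le_ofReal_iff_toReal_le (measure_ne_top _ _)
          ((integral_nonneg fun ω => Nat.cast_nonneg _).trans hmean)]
        exact hmarkov.trans hmean

end Main

end

theorem theorem3p1 (d k : ℕ) (hk : 3 ≤ k) (f : EuclideanSpace ℝ (Fin d) → ℝ)
    (hf_meas : Measurable f) (hf_nonneg : ∀ x, 0 ≤ f x) (hf_bdd : ∃ M, ∀ x, f x ≤ M) :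
    ∃ c : ℝ, ∀ (Ω : Type*) [MeasurableSpace Ω] (P : Measure Ω) [IsProbabilityMeasure P]
      (X : ℕ → Ω → EuclideanSpace ℝ (Fin d)) (r : ℕ → ℝ),
      iIndepFun X P →
      (∀ i, HasLaw (X i) (volume.withDensity fun x => ENNReal.ofReal (f x)) P) →
      (∀ n, 0 < r n) →
      Tendsto (fun n : ℕ => (n : ℝ) * r n ^ d) atTop (𝓝 0) →
      (Tendsto (fun n : ℕ => (n : ℝ) ^ k * r n ^ (d * (k - 1))) atTop (𝓝 0) →
        Tendsto (fun n : ℕ => P {ω | cechBetti X n (r n) (k - 2) ω = 0}) atTop (𝓝 1)) ∧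
      (∀ α : ℝ, 0 < α →
        Tendsto (fun n : ℕ => (n : ℝ) ^ k * r n ^ (d * (k - 1))) atTop (𝓝 α) →
        ∀ n : ℕ,
          tvDist (P.map (cechBetti X n (r n) (k - 2)))
            (poissonMeasure (∫ ω, (cechBetti X n (r n) (k - 2) ω : ℝ) ∂P).toNNReal)
            ≤ c * ((n : ℝ) * r n ^ d)) ∧
      (k ≤ d + 1 →
        Tendsto (fun n : ℕ => (n : ℝ) ^ k * r n ^ (d * (k - 1))) atTop atTop →
        TendstoInDistribution
          (fun (n : ℕ) (ω : Ω) =>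
            ((cechBetti X n (r n) (k - 2) ω : ℝ)
                - ∫ ω', (cechBetti X n (r n) (k - 2) ω' : ℝ) ∂P)
              / √(variance (fun ω' => (cechBetti X n (r n) (k - 2) ω' : ℝ)) P))
          atTop (id : ℝ → ℝ) (fun _ => P) (gaussianReal 0 1)) := by
  by_cases hprob : IsProbabilityMeasure (volume.withDensity fun x => ENNReal.ofReal (f x))
  swap
  -- If `f` is not a probability density, no random vector has this law.
  · refine ⟨0, fun Ω _ P _ X r _ hlaw => absurd ?_ hprob⟩
    rw [← (hlaw 0).map_eq]
    exact Measure.isProbabilityMeasure_map (hlaw 0).aemeasurable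
  obtain ⟨A, hA, hball⟩ := exists_measure_closedBall_le hf_bdd k (by omega)
  by_cases hkd : k ≤ d + 1
  · obtain ⟨c, hc, C, hC, ε, hε, happ⟩ := exists_poisson_approximation hk hkd hf_meas hf_bdd
    -- `C` serves when `n * r ^ d ≤ ε`; beyond that, the trivial bound `2` is below `2 / ε * (n * r
    -- ^ d)`.
    refine ⟨C + 2 / ε, fun Ω _ P _ X r hX hlaw hr hnr => ⟨fun h => ?_, fun α _ _ n => ?_,
      fun _ h => ?_⟩⟩
    · exact tendsto_measure_cechBetti_eq_zero hk hA hball hX hlaw hr hnr h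
    · have hnr0 : 0 ≤ (n : ℝ) * r n ^ d := by have := hr n; positivity
      have hc0 : 0 ≤ (C + 2 / ε) * ((n : ℝ) * r n ^ d) := by positivity
      by_cases hn : n < k
      · exact tvDist_cechBetti_of_eq_zero
          (fun ω => betti_cechComplex_eq_zero_of_lt hk hn _ _) hc0
      refine tvDist_map_le (aemeasurable_cechBetti hlaw n (r n) (k - 2)) hc0 fun g hg => ?_
      rw [add_mul]
      by_cases hsmall : n * r n ^ d ≤ ε
      · refine ((happ Ω P X hX hlaw n (by omega) (r n) (hr n) hsmall).2.1 g hg).trans ?_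
        have : 0 ≤ 2 / ε * ((n : ℝ) * r n ^ d) := by positivity
        linarith
      · refine (abs_integral_sub_integral_le_two (fun ω => hg _) hg).trans ?_
        have h1 : 0 ≤ C * ((n : ℝ) * r n ^ d) := by positivity
        have h2 : 2 / ε * ε ≤ 2 / ε * ((n : ℝ) * r n ^ d) := by
          gcongr
          exact (not_le.1 hsmall).le
        rw [div_mul_cancel₀ _ hε.ne'] at h2
        linarith
    · have hev : ∀ᶠ n : ℕ in atTop, k ≤ n ∧ n * r n ^ d ≤ ε :=
        (eventually_ge_atTop k).and ((hnr.eventually_lt_const hε).mono fun n hn => hn.le)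
      have hδ : Tendsto (fun n : ℕ => C * ((n : ℝ) * r n ^ d)) atTop (𝓝 0) := by
        simpa using hnr.const_mul C
      refine tendstoInDistribution_of_poisson (δ := fun n : ℕ => C * ((n : ℝ) * r n ^ d))
        (fun n => aemeasurable_cechBetti hlaw n (r n) (k - 2)) ?_ hδ ?_
        (fun n => variance_nonneg _ _) ?_
      · refine tendsto_atTop_mono' _ ?_ (h.const_mul_atTop hc)
        filter_upwards [hev] with n hn
        rw [pow_mul_pow_eq _ _ _ (by omega)]
        exact (happ Ω P X hX hlaw n hn.1 (r n) (hr n) hn.2).1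
      · filter_upwards [hev] with n hn
        exact (happ Ω P X hX hlaw n hn.1 (r n) (hr n) hn.2).2.1
      · rw [tendsto_iff_dist_tendsto_zero]
        refine squeeze_zero' (Eventually.of_forall fun n => dist_nonneg) ?_ hδ
        filter_upwards [hev] with n hn
        exact (happ Ω P X hX hlaw n hn.1 (r n) (hr n) hn.2).2.2
  -- Here `k - 2 ≥ d`, so the Betti number vanishes identically and both laws are the point mass at
  -- zero: the constant `0` suffices.
  · refine ⟨0, fun Ω _ P _ X r hX hlaw hr hnr => ⟨fun h => ?_, fun α _ _ n => ?_,
      fun h => absurd h hkd⟩⟩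
    · exact tendsto_measure_cechBetti_eq_zero hk hA hball hX hlaw hr hnr h
    · exact tvDist_cechBetti_of_eq_zero
        (fun ω => betti_cechComplex_eq_zero _ _ (by omega) (by omega)) (by simp)
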